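/- Let $q\in\{2,3,4\}$ and let $F=F_q$ be the function field of the elliptic curve $X_q/\mathbf F_q$ given by $y^2+y=x^3+x+1$ ($q=2$), $y^2=x^3-x-1$ ($q=3$), $y^2+y=x^3+\alpha$ with $\mathbf F_4=\mathbf F_2(\alpha)$ ($q=4$). Let $\mathbf A$ be the adele ring of $F$, $\mathcal O_{\mathbf A}$ its maximal compact subring, $G=\mathrm{GL}_2$, $Z$ the center of $G$, $K=G(\mathcal O_{\mathbf A})$, and let $\mathcal A$ be the space of functions $f:G_F\backslash G_{\mathbf A}/KZ_{\mathbf A}\to\mathbf C$. For a quadratic separable extension $E/F$, let $T\subset G$ be a maximal torus with $T_F\cong E^\times$ (given by a choice of $F$-basis of $E$), and put $$\mathsf T_F(E)=\Big\{f\in\mathcal A \;:\; \int_{T_FZ_{\mathbf A}\backslash T_{\mathbf A}} f(tg)\,dt=0\ \text{ for all } g\in G_{\mathbf A}\Big\},\qquad \mathsf T_F=\bigcap_E\mathsf T_F(E),$$ where $dt$ is a Haar measure and the intersection is over all quadratic separable $E/F$. Let $F^{(2)}_q=\mathbf F_{q^2}F$ be the quadratic constant extension. Let $\infty$ be the point at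 infinity of $X_q$, $F_\infty$ and $\mathcal O_\infty$ the completion of $F$ at $\infty$ and its ring of integers, $t=x/y$, $G_\infty=G(F_\infty)$, $K_\infty=G(\mathcal O_\infty)$, $Z_\infty=Z(F_\infty)$, and $\Gamma=G(A)$, where $A\subset F$ is the ring of functions holomorphic outside $\infty$. Write $[[a,b]]=\begin{pmatrix}a&b\\0&1\end{pmatrix}$. Let $\mathcal T$ be the graph with vertex set $G_\infty/K_\infty Z_\infty$ in which the classes of $g_1,g_2$ are adjacent if $g_1^{-1}g_2$ is equivalent modulo $K_\infty Z_\infty$ to $[[t,b]]$ for some $b\in\mathcal O_\infty/t$, or to $[[t^{-1},0]]$. Functions on $\Gamma\backslash\mathcal T$ are identified with $\Gamma$-invariant functions on the vertices of $\mathcal T$; the Hecke operator $\Phi_\infty$ sends $f$ to the function whose value at a vertex of $\mathcal T$ is the sum of the values of $f$ at its neighbours. An element of $\mathcal A$ is viewed as a function on $\Gamma\backslash\mathcal T$ by restriction to $G_\infty\subset G_{\mathbf A}$. Consider the following vertices of $\Gamma\backslash\mathcal T$: $c_n=[[t^{-n},0]]$ ($n\ge 0$), $z_0=[[1,t^{-1}]]$,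 $z_1=[[t,t^{-1}]]$, and $t_i=[[t^2,t^{-1}+\ell_i t]]$ ($1\le i\le q$), where $\ell_1,\dots,\ell_q$ are the elements of $\mathbf F_q$. Then there are constants $\lambda_n,\mu_n,\nu_n\in\mathbf C$ ($n\ge0$), depending only on $q$ and $n$, such that the following holds. Let $\mathcal S$ be the linear space of functions on $\Gamma\backslash\mathcal T$ whose values $T_i$ at $t_i$, $Z_j$ at $z_j$ and $C_n$ at $c_n$ satisfy $C_0=-2(T_1+\dots+T_q)$ and, for all $n\ge0$, $$C_n=\begin{cases}\lambda_nZ_0+\mu_n(T_1+\dots+T_q)&\text{if } n \text{ is even},\\ \nu_nZ_1&\text{if } n \text{ is odd}.\end{cases}$$ Then $\mathcal S$ is $\Phi_\infty$-stable, $\dim\mathcal S=q+2$, and every $f\in\mathsf T_{F_q}(F_q^{(2)})$ belongs to $\mathcal S$. In particular $\dim\mathsf T_{F_q}(F_q^{(2)})\le\dim\mathcal S=q+2$, and $\mathsf T_{F_q}$ is finite-dimensional. -/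

import Mathlib

open scoped RestrictedProduct

noncomputable section

namespace Toroidal

/-! ### Matrices -/

/-- The group `GL₂(R)`. -/
abbrev GL2 (R : Type*) [CommRing R] : Type _ := Matrix.GeneralLinearGroup (Fin 2) R

/-- The matrix with rows `(a, b)` and `(0, 1)`. -/
def affineMat {R : Type*} [CommRing R] (a : Rˣ) (b : R) : GL2 R where
  val := !![(a : R), b; 0, 1]
  inv := !![((a⁻¹ : Rˣ) : R), -((a⁻¹ : Rˣ) : R) * b; 0, 1]
  val_inv := by
    ext i j
    fin_cases i <;> fin_cases j <;> simp [Matrix.mul_apply, Fin.sum_univ_two]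
  inv_val := by
    ext i j
    fin_cases i <;> fin_cases j <;> simp [Matrix.mul_apply, Fin.sum_univ_two]

/-- The subgroup `GL₂(S)` of `GL₂(R)` for a subring `S` of `R`. -/
def integralGL2 {R : Type*} [CommRing R] (S : Subring R) : Subgroup (GL2 R) :=
  (Matrix.GeneralLinearGroup.map (n := Fin 2) S.subtype).range

/-! ### Places, completions and adeles

For a function field in one variable over a finite field, the places are the valuation rings
of `F` other than `F` itself; the finite constant field lies in every one of them. -/

/-- The places of `F`. -/
def Place (F : Type*) [Field F] : Type _ := {O : ValuationSubring F // O ≠ ⊤}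

/-- The completion `F_v` of `F` at the place `v`. -/
abbrev Place.Completion {F : Type*} [Field F] (v : Place F) : Type _ :=
  v.1.valuation.Completion

instance {F : Type*} [Field F] (v : Place F) : Algebra F v.Completion :=
  ((UniformSpace.Completion.coeRingHom (α := WithVal v.1.valuation)).comp
    (WithVal.equiv v.1.valuation).symm.toRingHom).toAlgebra

/-- The ring of integers `O_v` of `F_v`. -/
def Place.integers {F : Type*} [Field F] (v : Place F) : ValuationSubring v.Completion :=
  (Valued.v : Valuation v.Completion v.1.ValueGroup).valuationSubring

/-- The ring of adeles of `F`, with the restricted product topology. -/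
abbrev Adele (F : Type*) [Field F] : Type _ :=
  Πʳ v : Place F, [v.Completion, v.integers]

section Adelic

variable {F : Type*} [Field F]

/-- The embedding of `GL₂(F)` in `GL₂(F_v)`. -/
def toLocal (v : Place F) : GL2 F →* GL2 v.Completion :=
  Matrix.GeneralLinearGroup.map (algebraMap F v.Completion)

/-- The component of an element of `GL₂(𝐀)` at the place `v`. -/
def component (v : Place F) : GL2 (Adele F) →* GL2 v.Completion :=
  Matrix.GeneralLinearGroup.map
    (RestrictedProduct.evalRingHom (fun w : Place F => w.Completion) v)

/-- The adelic elements all of whose components come from one and the same element of the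
subgroup `H` of `GL₂(F)`: the image of `H` under the diagonal embedding of `GL₂(F)` in
`GL₂(𝐀)`. -/
def diagonal (H : Subgroup (GL2 F)) : Subgroup (GL2 (Adele F)) :=
  (H.map (MonoidHom.pi fun v : Place F => toLocal v)).comap
    (MonoidHom.pi fun v : Place F => component v)

variable (F) in
/-- The standard maximal compact subgroup `K = GL₂(O_𝐀)` of `GL₂(𝐀)`. -/
def maxCompact : Subgroup (GL2 (Adele F)) :=
  ⨅ v : Place F, (integralGL2 v.integers.toSubring).comap (component v)

variable (F) in
/-- The unramified automorphic forms: the functions on `G_F \ G_𝐀 / K Z_𝐀`. -/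
def automorphicForms : Submodule ℂ (GL2 (Adele F) → ℂ) where
  carrier := {f | ∀ γ ∈ diagonal (⊤ : Subgroup (GL2 F)), ∀ κ ∈ maxCompact F,
    ∀ z ∈ Subgroup.center (GL2 (Adele F)), ∀ g, f (γ * g * (κ * z)) = f g}
  zero_mem' := by
    intro γ _ κ _ z _ g
    rfl
  add_mem' := by
    intro f₁ f₂ h₁ h₂ γ hγ κ hκ z hz g
    simp only [Pi.add_apply, h₁ γ hγ κ hκ z hz g, h₂ γ hγ κ hκ z hz g]
  smul_mem' := by
    intro c f h γ hγ κ hκ z hz g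
    simp only [Pi.smul_apply, h γ hγ κ hκ z hz g]

end Adelic

/-! ### Tori and toroidal automorphic forms

A basis `b` of a quadratic extension `E` of `F` gives `E^× = Aut_E(E) ⊆ Aut_F(E) ≅ GL₂(F)`,
hence a maximal non-split torus `T` of `GL₂` with `T_F ≅ E^×`. -/

section Torus

variable {F E : Type*} [Field F] [Field E] [Algebra F E]

/-- The group `T_F`. -/
def rationalTorus (b : Module.Basis (Fin 2) F E) : Subgroup (GL2 F) :=
  (Units.map (Algebra.leftMulMatrix b : E →* Matrix (Fin 2) (Fin 2) F)).range

/-- The group `T(F_v) = (F_v ⊗ E)^×`. -/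
def localTorus (b : Module.Basis (Fin 2) F E) (v : Place F) : Subgroup (GL2 v.Completion) :=
  (Units.map (Algebra.leftMulMatrix (Algebra.TensorProduct.basis v.Completion b) :
    TensorProduct F v.Completion E →* Matrix (Fin 2) (Fin 2) v.Completion)).range

/-- The group `T_𝐀`: the elements of `GL₂(𝐀)` with all components in the torus. -/
def adelicTorus (b : Module.Basis (Fin 2) F E) : Subgroup (GL2 (Adele F)) :=
  ⨅ v : Place F, (localTorus b v).comap (component v)

/-- The group `T_F Z_𝐀`, as a subgroup of `T_𝐀`. -/
def toralPeriods (b : Module.Basis (Fin 2) F E) : Subgroup (adelicTorus b) :=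
  (diagonal (rationalTorus b) ⊔ Subgroup.center (GL2 (Adele F))).subgroupOf (adelicTorus b)

theorem component_injective {g h : GL2 (Adele F)} (H : ∀ v, component v g = component v h) :
    g = h := by
  ext i j v
  exact congrArg (fun m : GL2 v.Completion => m.val i j) (H v)

theorem adelicTorus_comm (b : Module.Basis (Fin 2) F E) (s t : adelicTorus b) :
    s * t = t * s := by
  apply Subtype.ext
  apply component_injective
  intro v
  have hs : component v s ∈ localTorus b v := Subgroup.mem_iInf.1 s.2 v
  have ht : component v t ∈ localTorus b v := Subgroup.mem_iInf.1 t.2 v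
  obtain ⟨x, hx⟩ := hs
  obtain ⟨y, hy⟩ := ht
  simp only [Subgroup.coe_mul, map_mul, ← hx, ← hy]
  rw [← map_mul, ← map_mul, mul_comm]

instance toralPeriods_normal (b : Module.Basis (Fin 2) F E) : (toralPeriods b).Normal :=
  ⟨fun n hn g => by rwa [adelicTorus_comm b g n, mul_inv_cancel_right]⟩

/-- The group `T_F Z_𝐀 \ T_𝐀`, with the quotient of the topology induced by `GL₂(𝐀)`. -/
def ToralQuotient (b : Module.Basis (Fin 2) F E) : Type _ := adelicTorus b ⧸ toralPeriods b

instance (b : Module.Basis (Fin 2) F E) : Group (ToralQuotient b) :=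
  inferInstanceAs (Group (adelicTorus b ⧸ toralPeriods b))

instance (b : Module.Basis (Fin 2) F E) : TopologicalSpace (ToralQuotient b) :=
  inferInstanceAs (TopologicalSpace (adelicTorus b ⧸ toralPeriods b))

instance (b : Module.Basis (Fin 2) F E) : MeasurableSpace (ToralQuotient b) :=
  borel (ToralQuotient b)

instance (b : Module.Basis (Fin 2) F E) : BorelSpace (ToralQuotient b) := ⟨rfl⟩

/-- The function `t ↦ f (t g)` on `T_F Z_𝐀 \ T_𝐀`. For an automorphic form `f` it does not
depend on the representative that is chosen in each class. -/
def toralTranslate (b : Module.Basis (Fin 2) F E) (f : GL2 (Adele F) → ℂ)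
    (g : GL2 (Adele F)) (x : ToralQuotient b) : ℂ :=
  f ((Quotient.out (s := QuotientGroup.leftRel (toralPeriods b)) x : adelicTorus b) * g)

/-- The toroidal automorphic forms with respect to the torus given by `b`. Haar measure is
unique up to a scalar, so that the quantifier over `μ` only removes the normalisation; the
integrability holds for every automorphic form, the quotient being compact. -/
def toroidalFor (b : Module.Basis (Fin 2) F E) : Submodule ℂ (GL2 (Adele F) → ℂ) where
  carrier := {f | f ∈ automorphicForms F ∧ ∀ g : GL2 (Adele F),
    ∀ μ : MeasureTheory.Measure (ToralQuotient b), μ.IsHaarMeasure →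
      MeasureTheory.Integrable (toralTranslate b f g) μ ∧ ∫ x, toralTranslate b f g x ∂μ = 0}
  zero_mem' := by
    refine ⟨Submodule.zero_mem _, fun g μ _ => ?_⟩
    have h : toralTranslate b (0 : GL2 (Adele F) → ℂ) g = 0 := rfl
    rw [h]
    exact ⟨MeasureTheory.integrable_zero _ _ _, by simp⟩
  add_mem' := by
    rintro f₁ f₂ ⟨h₁, k₁⟩ ⟨h₂, k₂⟩
    refine ⟨Submodule.add_mem _ h₁ h₂, fun g μ hμ => ?_⟩
    have h : toralTranslate b (f₁ + f₂) g = toralTranslate b f₁ g + toralTranslate b f₂ g := rfl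
    obtain ⟨i₁, e₁⟩ := k₁ g μ hμ
    obtain ⟨i₂, e₂⟩ := k₂ g μ hμ
    rw [h]
    exact ⟨i₁.add i₂, by rw [MeasureTheory.integral_add' i₁ i₂, e₁, e₂, add_zero]⟩
  smul_mem' := by
    rintro c f ⟨h₁, k₁⟩
    refine ⟨Submodule.smul_mem _ c h₁, fun g μ hμ => ?_⟩
    have h : toralTranslate b (c • f) g = c • toralTranslate b f g := rfl
    obtain ⟨i₁, e₁⟩ := k₁ g μ hμ
    rw [h]
    refine ⟨i₁.smul c, ?_⟩
    simp only [Pi.smul_apply]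
    rw [MeasureTheory.integral_smul, e₁, smul_zero]

end Torus

/-- The toroidal automorphic forms for `F`: those which are toroidal with respect to every
quadratic separable extension of `F`. -/
def toroidalForms (F : Type) [Field F] : Submodule ℂ (GL2 (Adele F) → ℂ) :=
  automorphicForms F ⊓
    ⨅ (E : Type) (_ : Field E) (_ : Algebra F E) (_ : Algebra.IsSeparable F E)
      (b : Module.Basis (Fin 2) F E), toroidalFor b

/-- `E` is the compositum of `F` and a field with `q²` elements. For a field `F` with constant
field `𝐅_q` this says that `E` is the quadratic constant extension of `F`. -/
def IsQuadraticConstantExtension (F E : Type*) [Field F] [Field E] [Algebra F E] (q : ℕ) :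
    Prop :=
  ∃ κ : Subfield E, Nat.card κ = q ^ 2 ∧ IntermediateField.adjoin F (κ : Set E) = ⊤

/-! ### The tree at a place and its quotient -/

section Tree

variable {F : Type*} [Field F]

/-- The ring `A` of the elements of `F` that are holomorphic outside the place `v`. -/
def holomorphicOutside (v : Place F) : Subring F :=
  ⨅ w : {w : Place F // w ≠ v}, w.1.1.toSubring

/-- The vertices `G_v / K_v Z_v` of the Bruhat-Tits tree at the place `v`. -/
abbrev TreeVertex (v : Place F) : Type _ :=
  GL2 v.Completion ⧸
    (integralGL2 v.integers.toSubring ⊔ Subgroup.center (GL2 v.Completion))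

/-- The vertex represented by a matrix with entries in `F`. -/
def vertex (v : Place F) (g : GL2 F) : TreeVertex v := QuotientGroup.mk (toLocal v g)

/-- Adjacency in the tree, for a uniformizer `t` at `v`: the classes of `g₁` and `g₂` are
adjacent if `g₁⁻¹ g₂` is equivalent to the matrix `(t, b; 0, 1)` for an integral `b`, which only
matters modulo `t`, or to `(t⁻¹, 0; 0, 1)`. -/
def TreeAdj (v : Place F) (t : Fˣ) (x y : TreeVertex v) : Prop :=
  ∃ g₁ g₂ : GL2 v.Completion, QuotientGroup.mk g₁ = x ∧ QuotientGroup.mk g₂ = y ∧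
    ((∃ b ∈ v.integers, (QuotientGroup.mk (g₁⁻¹ * g₂) : TreeVertex v) =
        QuotientGroup.mk (affineMat (Units.map (algebraMap F v.Completion : F →* _) t) b)) ∨
      (QuotientGroup.mk (g₁⁻¹ * g₂) : TreeVertex v) = vertex v (affineMat t⁻¹ 0))

/-- The Hecke operator `Φ_v` on functions on the vertices: the sum over the neighbours. -/
def heckeOp (v : Place F) (t : Fˣ) (φ : TreeVertex v → ℂ) (x : TreeVertex v) : ℂ :=
  ∑ᶠ (y : TreeVertex v) (_ : TreeAdj v t x y), φ y

/-- The functions on the vertices of `Γ \ 𝒯` with `Γ = GL₂(A)`, as `Γ`-invariant functions on the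
vertices of `𝒯`. -/
def quotientGraphFunctions (v : Place F) : Submodule ℂ (TreeVertex v → ℂ) where
  carrier := {φ | ∀ γ ∈ integralGL2 (holomorphicOutside v), ∀ x, φ (toLocal v γ • x) = φ x}
  zero_mem' := by
    intro γ _ x
    rfl
  add_mem' := by
    intro φ ψ h₁ h₂ γ hγ x
    simp only [Pi.add_apply, h₁ γ hγ x, h₂ γ hγ x]
  smul_mem' := by
    intro c φ h γ hγ x
    simp only [Pi.smul_apply, h γ hγ x]

open scoped Classical in
/-- The matrix over the adeles with component `m` at `v` and the identity matrix at all
other places. -/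
def singleMatrix (v : Place F) (m : Matrix (Fin 2) (Fin 2) v.Completion) :
    Matrix (Fin 2) (Fin 2) (Adele F) := fun i j =>
  ⟨Function.update (fun w : Place F => (1 : Matrix (Fin 2) (Fin 2) w.Completion) i j) v (m i j),
    by
      refine (Set.finite_singleton v).subset fun w hw => ?_
      by_contra hne
      apply hw
      have hne' : w ≠ v := hne
      simp only [Set.mem_ofPred_eq, Function.update_of_ne hne', Matrix.one_apply]
      split_ifs
      · exact w.integers.one_mem
      · exact w.integers.zero_mem⟩

open scoped Classical in
theorem singleMatrix_apply_same (v : Place F) (m : Matrix (Fin 2) (Fin 2) v.Completion)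
    (i j : Fin 2) : singleMatrix v m i j v = m i j :=
  Function.update_self v (m i j)
    (fun w : Place F => (1 : Matrix (Fin 2) (Fin 2) w.Completion) i j)

open scoped Classical in
theorem singleMatrix_apply_ne (v : Place F) (m : Matrix (Fin 2) (Fin 2) v.Completion)
    (i j : Fin 2) {w : Place F} (h : w ≠ v) :
    singleMatrix v m i j w = (1 : Matrix (Fin 2) (Fin 2) w.Completion) i j :=
  Function.update_of_ne h (m i j)
    (fun w : Place F => (1 : Matrix (Fin 2) (Fin 2) w.Completion) i j)

/-- The embedding of `G_v = GL₂(F_v)` in `GL₂(𝐀)`. -/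
def fromLocal (v : Place F) : GL2 v.Completion →* GL2 (Adele F) :=
  Units.map
    { toFun := singleMatrix v
      map_one' := by
        ext i j w
        by_cases h : w = v
        · subst h
          rw [singleMatrix_apply_same]
          fin_cases i <;> fin_cases j <;> rfl
        · rw [singleMatrix_apply_ne _ _ _ _ h]
          fin_cases i <;> fin_cases j <;> rfl
      map_mul' := by
        intro m n
        ext i j w
        have e : (singleMatrix v m * singleMatrix v n) i j w =
            singleMatrix v m i 0 w * singleMatrix v n 0 j w +
              singleMatrix v m i 1 w * singleMatrix v n 1 j w := by
          rw [Matrix.mul_apply, Fin.sum_univ_two]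
          rfl
        rw [e]
        by_cases h : w = v
        · subst h
          simp only [singleMatrix_apply_same, Matrix.mul_apply, Fin.sum_univ_two]
        · simp only [singleMatrix_apply_ne _ _ _ _ h]
          rw [← Fin.sum_univ_two (fun l => (1 : Matrix (Fin 2) (Fin 2) w.Completion) i l *
            (1 : Matrix (Fin 2) (Fin 2) w.Completion) l j), ← Matrix.mul_apply, one_mul] }

/-- The function on the vertices of the tree that corresponds to an automorphic form, by
restriction to `G_v`; it does not depend on the representative that is chosen in each class. -/
def toTree (v : Place F) (f : GL2 (Adele F) → ℂ) (x : TreeVertex v) : ℂ :=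
  f (fromLocal v (Quotient.out x))

end Tree

/-! ### The three elliptic function fields -/

/-- `W` is one of the curves `y² + y = x³ + x + 1` over `𝐅₂`, `y² = x³ - x - 1` over `𝐅₃`,
`y² + y = x³ + α` over `𝐅₄ = 𝐅₂(α)`; `q` is the number of elements of the ground field. -/
inductive IsSpecialCurve {k : Type*} [Field k] : ℕ → WeierstrassCurve.Affine k → Prop
  | two (h : Nat.card k = 2) : IsSpecialCurve 2 ⟨0, 0, 1, 1, 1⟩
  | three (h : Nat.card k = 3) : IsSpecialCurve 3 ⟨0, 0, 0, -1, -1⟩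
  | four (h : Nat.card k = 4) (α : k) (h₀ : α ≠ 0) (h₁ : α ≠ 1) : IsSpecialCurve 4 ⟨0, 0, 1, 0, α⟩

section Curve

variable {k : Type*} [Field k] (W : WeierstrassCurve.Affine k)

/-- The coordinate function `x` in the function field. -/
def xFun : W.FunctionField :=
  algebraMap W.CoordinateRing W.FunctionField
    (WeierstrassCurve.Affine.CoordinateRing.mk W (Polynomial.C Polynomial.X))

/-- The coordinate function `y` in the function field. -/
def yFun : W.FunctionField :=
  algebraMap W.CoordinateRing W.FunctionField
    (WeierstrassCurve.Affine.CoordinateRing.mk W Polynomial.X)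

theorem xFun_ne_zero : xFun W ≠ 0 := by
  have h := WeierstrassCurve.Affine.CoordinateRing.XClass_ne_zero (W' := W) (0 : k)
  simp only [WeierstrassCurve.Affine.CoordinateRing.XClass, Polynomial.C_0, sub_zero] at h
  exact fun h' => h ((IsFractionRing.injective W.CoordinateRing W.FunctionField)
    (h'.trans (map_zero _).symm))

theorem yFun_ne_zero : yFun W ≠ 0 := by
  have h := WeierstrassCurve.Affine.CoordinateRing.YClass_ne_zero (W' := W) (0 : Polynomial k)
  simp only [WeierstrassCurve.Affine.CoordinateRing.YClass, Polynomial.C_0, sub_zero] at h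
  exact fun h' => h ((IsFractionRing.injective W.CoordinateRing W.FunctionField)
    (h'.trans (map_zero _).symm))

/-- The uniformizer `t = x / y` at the point at infinity. -/
def unif : W.FunctionFieldˣ :=
  Units.mk0 (xFun W / yFun W) (div_ne_zero (xFun_ne_zero W) (yFun_ne_zero W))

variable (v : Place W.FunctionField)

/-- The vertex `c_n`, represented by `(t^(-n), 0; 0, 1)`. -/
def cVertex (n : ℕ) : TreeVertex v := vertex v (affineMat ((unif W)⁻¹ ^ n) 0)

/-- The vertex `z_0`, represented by `(1, t⁻¹; 0, 1)`. -/
def zVertex₀ : TreeVertex v :=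
  vertex v (affineMat 1 (((unif W)⁻¹ : W.FunctionFieldˣ) : W.FunctionField))

/-- The vertex `z_1`, represented by `(t, t⁻¹; 0, 1)`. -/
def zVertex₁ : TreeVertex v :=
  vertex v (affineMat (unif W) (((unif W)⁻¹ : W.FunctionFieldˣ) : W.FunctionField))

/-- The vertex represented by `(t², t⁻¹ + ℓ t; 0, 1)`, for `ℓ` in the ground field. -/
def tVertex (l : k) : TreeVertex v :=
  vertex v (affineMat (unif W ^ 2) (((unif W)⁻¹ : W.FunctionFieldˣ) +
    algebraMap k W.FunctionField l * (unif W : W.FunctionField)))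

variable [Fintype k]

/-- The sum `T_1 + ... + T_q` of the values at the vertices `t_1, ..., t_q`. -/
def tSum (φ : TreeVertex v → ℂ) : ℂ := ∑ l : k, φ (tVertex W v l)

/-- The space `𝒮` of functions `[T_1, ..., T_q | Z_0, Z_1 | C_0, C_1, ...]` on `Γ \ 𝒯` with
`C_0 = -2 (T_1 + ... + T_q)`, `C_n = lam n * Z_0 + mu n * (T_1 + ... + T_q)` for even `n` and
`C_n = nu n * Z_1` for odd `n`. -/
def spaceS (lam mu nu : ℕ → ℂ) : Submodule ℂ (TreeVertex v → ℂ) where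
  carrier := {φ | φ ∈ quotientGraphFunctions v ∧
    φ (cVertex W v 0) = -2 * tSum W v φ ∧
    ∀ n : ℕ, (Even n → φ (cVertex W v n) = lam n * φ (zVertex₀ W v) + mu n * tSum W v φ) ∧
      (Odd n → φ (cVertex W v n) = nu n * φ (zVertex₁ W v))}
  zero_mem' := by
    refine ⟨Submodule.zero_mem _, ?_, fun n => ⟨fun _ => ?_, fun _ => ?_⟩⟩ <;> simp [tSum]
  add_mem' := by
    rintro φ ψ ⟨h₁, h₂, h₃⟩ ⟨k₁, k₂, k₃⟩
    have hs : tSum W v (φ + ψ) = tSum W v φ + tSum W v ψ := Finset.sum_add_distrib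
    refine ⟨Submodule.add_mem _ h₁ k₁, ?_, fun n => ⟨fun hn => ?_, fun hn => ?_⟩⟩
    · rw [hs, Pi.add_apply, h₂, k₂]
      ring
    · rw [hs, Pi.add_apply, Pi.add_apply, (h₃ n).1 hn, (k₃ n).1 hn]
      ring
    · rw [Pi.add_apply, Pi.add_apply, (h₃ n).2 hn, (k₃ n).2 hn]
      ring
  smul_mem' := by
    rintro c φ ⟨h₁, h₂, h₃⟩
    have hs : tSum W v (c • φ) = c * tSum W v φ := by
      simp only [tSum, Pi.smul_apply, smul_eq_mul, Finset.mul_sum]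
    refine ⟨Submodule.smul_mem _ c h₁, ?_, fun n => ⟨fun hn => ?_, fun hn => ?_⟩⟩
    · rw [hs, Pi.smul_apply, h₂, smul_eq_mul]
      ring
    · rw [hs, Pi.smul_apply, Pi.smul_apply, (h₃ n).1 hn, smul_eq_mul, smul_eq_mul]
      ring
    · rw [Pi.smul_apply, Pi.smul_apply, (h₃ n).2 hn, smul_eq_mul, smul_eq_mul]
      ring

end Curve

end Toroidal

end

open scoped RestrictedProduct

noncomputable section

namespace Toroidal

/-! ### Affine curves without rational points -/

/-- Coordinates `x, y` generating a field `F` over `k`, subject to the equation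
`y² + a₃ y = x³ + a₄ x + a₆` of a curve without affine `k`-rational points. -/
structure PointlessCurve (k F : Type*) [Field k] [Field F] [Algebra k F] where
  x : F
  y : F
  a₃ : k
  a₄ : k
  a₆ : k
  x_ne_zero : x ≠ 0
  y_ne_zero : y ≠ 0
  equation : y ^ 2 + algebraMap k F a₃ * y = x ^ 3 + algebraMap k F a₄ * x + algebraMap k F a₆
  no_point : ∀ r s : k, s ^ 2 + a₃ * s ≠ r ^ 3 + a₄ * r + a₆
  -- This is the discriminant of Y² + a₃ Y - (r³ + a₄ r + a₆); in characteristic 2 it only asks for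
  -- a₃ ≠ 0.
  disc_ne_zero : ∀ r : k, a₃ ^ 2 + 4 * (r ^ 3 + a₄ * r + a₆) ≠ 0
  exists_div : ∀ f : F, ∃ a ∈ Algebra.adjoin k {x, y}, ∃ b ∈ Algebra.adjoin k {x, y},
    b ≠ 0 ∧ f = a / b

/-- A nonzero constant is a root of unity, and an ordered value group has no torsion. -/
theorem valuation_algebraMap {k F : Type*} [Field k] [Finite k] [Field F] [Algebra k F]
    (O : ValuationSubring F) {c : k} (hc : c ≠ 0) : O.valuation (algebraMap k F c) = 1 := by
  have := Fintype.ofFinite k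
  have h := congrArg (fun z => O.valuation (algebraMap k F z))
    (FiniteField.pow_card_sub_one_eq_one c hc)
  simp only [map_pow, map_one] at h
  have h1 : 1 < Fintype.card k := Fintype.one_lt_card
  exact (pow_eq_one_iff_of_nonneg zero_le (by omega)).1 h

theorem valuation_algebraMap_le {k F : Type*} [Field k] [Finite k] [Field F] [Algebra k F]
    (O : ValuationSubring F) (c : k) : O.valuation (algebraMap k F c) ≤ 1 := by
  by_cases hc : c = 0
  · simp [hc]
  · exact (valuation_algebraMap O hc).le

theorem algebraMap_mem {k F : Type*} [Field k] [Finite k] [Field F] [Algebra k F]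
    (O : ValuationSubring F) (c : k) : algebraMap k F c ∈ O :=
  (O.valuation_le_one_iff _).1 (valuation_algebraMap_le O c)

namespace PointlessCurve

variable {k F : Type*} [Field k] [Field F] [Algebra k F] (C : PointlessCurve k F)

/-- The ring generated by the coordinates. -/
def A : Subalgebra k F := Algebra.adjoin k {C.x, C.y}

/-- The function `x / y`. -/
def t : Fˣ := Units.mk0 (C.x / C.y) (div_ne_zero C.x_ne_zero C.y_ne_zero)

theorem coe_t : (C.t : F) = C.x / C.y := rfl

theorem t_mul_y : (C.t : F) * C.y = C.x := by
  rw [coe_t, div_mul_cancel₀ _ C.y_ne_zero]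

theorem x_mem : C.x ∈ C.A := Algebra.subset_adjoin (by simp)

theorem y_mem : C.y ∈ C.A := Algebra.subset_adjoin (by simp)

/-- A function in `A` with pole order `n` at infinity, for `n ≠ 1`. -/
def mono (n : ℕ) : F := if Even n then C.x ^ (n / 2) else C.x ^ ((n - 3) / 2) * C.y

theorem mono_even (i : ℕ) : C.mono (2 * i) = C.x ^ i := by
  simp [mono]

theorem mono_odd (i : ℕ) : C.mono (2 * i + 3) = C.x ^ i * C.y := by
  have h : ¬ Even (2 * i + 3) := by
    rw [Nat.not_even_iff_odd]
    exact ⟨i + 1, by ring⟩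
  simp [mono, h]

/-- The semigroup generated by the pole orders 2 and 3 of x and y has the single gap 1. -/
theorem exists_eq_of_ne_one {n : ℕ} (h : n ≠ 1) : ∃ i, n = 2 * i ∨ n = 2 * i + 3 := by
  rcases Nat.even_or_odd' n with ⟨i, hi | hi⟩
  · exact ⟨i, Or.inl hi⟩
  · exact ⟨i - 1, Or.inr (by omega)⟩

theorem mono_mem {n : ℕ} (h : n ≠ 1) : C.mono n ∈ C.A := by
  obtain ⟨i, rfl | rfl⟩ := exists_eq_of_ne_one h
  · rw [mono_even]
    exact pow_mem C.x_mem i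
  · rw [mono_odd]
    exact mul_mem (pow_mem C.x_mem i) C.y_mem

/-- The span contains 1 and is stable under multiplication by x and by y; only the product of y with
an odd monomial requires the equation of the curve, to eliminate y². -/
theorem mem_span_mono {a : F} (ha : a ∈ C.A) :
    a ∈ Submodule.span k (C.mono '' {n | n ≠ 1}) := by
  set M := Submodule.span k (C.mono '' {n | n ≠ 1}) with hM
  have hm : ∀ n, n ≠ 1 → C.mono n ∈ M := fun n hn => Submodule.subset_span ⟨n, hn, rfl⟩
  have hx : ∀ m ∈ M, m * C.x ∈ M := by
    intro m hm'
    induction hm' using Submodule.span_induction with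
    | mem m h =>
      obtain ⟨n, hn, rfl⟩ := h
      obtain ⟨i, rfl | rfl⟩ := exists_eq_of_ne_one hn
      · rw [mono_even, ← pow_succ, ← mono_even]
        exact hm _ (by omega)
      · rw [mono_odd, show C.x ^ i * C.y * C.x = C.x ^ (i + 1) * C.y by ring, ← mono_odd]
        exact hm _ (by omega)
    | zero => simp
    | add a b _ _ ha hb => rw [add_mul]; exact add_mem ha hb
    | smul c a _ ha => rw [smul_mul_assoc]; exact M.smul_mem c ha
  have hy : ∀ m ∈ M, m * C.y ∈ M := by
    intro m hm'
    induction hm' using Submodule.span_induction with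
    | mem m h =>
      obtain ⟨n, hn, rfl⟩ := h
      obtain ⟨i, rfl | rfl⟩ := exists_eq_of_ne_one hn
      · rw [mono_even, ← mono_odd]
        exact hm _ (by omega)
      · have e : C.x ^ i * C.y * C.y = C.mono (2 * (i + 3)) + C.a₄ • C.mono (2 * (i + 1))
            + C.a₆ • C.mono (2 * i) - C.a₃ • C.mono (2 * i + 3) := by
          rw [mono_even, mono_even, mono_even, mono_odd]
          simp only [Algebra.smul_def]
          linear_combination C.x ^ i * C.equation
        rw [mono_odd, e]
        refine sub_mem (add_mem (add_mem (hm _ ?_) (M.smul_mem _ (hm _ ?_)))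
          (M.smul_mem _ (hm _ ?_))) (M.smul_mem _ (hm _ ?_)) <;> omega
    | zero => simp
    | add a b _ _ ha hb => rw [add_mul]; exact add_mem ha hb
    | smul c a _ ha => rw [smul_mul_assoc]; exact M.smul_mem c ha
  have h1 : (1 : F) ∈ M := by simpa [mono] using hm 0 (by omega)
  have key : ∀ b ∈ Algebra.adjoin k {C.x, C.y}, ∀ m ∈ M, m * b ∈ M := by
    intro b hb
    induction hb using Algebra.adjoin_induction with
    | mem z hz =>
      rcases hz with rfl | hz
      · exact hx
      · rw [Set.mem_singleton_iff.1 hz]; exact hy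
    | algebraMap c =>
      intro m hm
      rw [mul_comm, ← Algebra.smul_def]
      exact M.smul_mem c hm
    | add a b _ _ ha hb => intro m hm; rw [mul_add]; exact add_mem (ha m hm) (hb m hm)
    | mul a b _ _ ha hb => intro m hm; rw [← mul_assoc]; exact hb _ (ha m hm)
  simpa using key a ha 1 h1

/-! ### Pole orders at infinity -/

variable [Finite k] {O : ValuationSubring F} (hO : C.x ∉ O)

include hO in
-- If x has a pole then x³ dominates the right side of the equation; so y has a pole as well, and y²
-- dominates the left side.
theorem valuation_x_aux : 1 < O.valuation C.x ∧ O.valuation C.y ^ 2 = O.valuation C.x ^ 3 := by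
  have hx : 1 < O.valuation C.x := by
    rw [← not_le, O.valuation_le_one_iff]
    exact hO
  have h1 : O.valuation C.x < O.valuation C.x ^ 3 := lt_self_pow₀ hx (by norm_num)
  have hr : O.valuation (C.x ^ 3 + algebraMap k F C.a₄ * C.x + algebraMap k F C.a₆)
      = O.valuation C.x ^ 3 := by
    rw [add_assoc, Valuation.map_add_eq_of_lt_left, map_pow]
    rw [map_pow]
    refine lt_of_le_of_lt (O.valuation.map_add_le (g := O.valuation C.x) ?_ ?_) h1
    · rw [map_mul]
      exact mul_le_of_le_one_left' (valuation_algebraMap_le O _)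
    · exact (valuation_algebraMap_le O _).trans hx.le
  have hy : 1 < O.valuation C.y := by
    by_contra hy
    rw [not_lt] at hy
    have : O.valuation (C.y ^ 2 + algebraMap k F C.a₃ * C.y) ≤ 1 := by
      apply O.valuation.map_add_le
      · rw [map_pow]; exact pow_le_one' hy 2
      · rw [map_mul]; exact mul_le_one' (valuation_algebraMap_le O _) hy
    rw [C.equation, hr] at this
    exact absurd (hx.trans h1) (not_lt.2 this)
  refine ⟨hx, ?_⟩
  rw [← hr, ← C.equation, Valuation.map_add_eq_of_lt_left, map_pow]
  rw [map_pow, map_mul]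
  exact lt_of_le_of_lt (mul_le_of_le_one_left' (valuation_algebraMap_le O _))
    (lt_self_pow₀ hy (by norm_num))

include hO in
theorem valuation_x : O.valuation C.x = O.valuation C.t ^ (-2 : ℤ) := by
  have h := (C.valuation_x_aux hO).2
  have hx : O.valuation C.x ≠ 0 := (Valuation.ne_zero_iff _).2 C.x_ne_zero
  have hy : O.valuation C.y ≠ 0 := (Valuation.ne_zero_iff _).2 C.y_ne_zero
  rw [coe_t, map_div₀, zpow_neg, ← inv_zpow, inv_div, div_zpow]
  rw [eq_div_iff (zpow_ne_zero _ hx)]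
  norm_cast
  rw [h]
  exact (pow_succ' _ _).symm

include hO in
theorem valuation_y : O.valuation C.y = O.valuation C.t ^ (-3 : ℤ) := by
  have ht : O.valuation (C.t : F) ≠ 0 := (Valuation.ne_zero_iff _).2 C.t.ne_zero
  have h : O.valuation C.y = O.valuation C.x / O.valuation C.t := by
    rw [eq_div_iff ht, ← map_mul, mul_comm, t_mul_y]
  rw [h, C.valuation_x hO, div_eq_mul_inv, ← zpow_neg_one, ← zpow_add₀ ht]
  norm_num

include hO in
theorem valuation_t_lt_one : O.valuation (C.t : F) < 1 := by
  have h := (C.valuation_x_aux hO).1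
  by_contra h1
  rw [not_lt] at h1
  rw [C.valuation_x hO, zpow_neg, one_lt_inv₀ (zpow_pos (zero_lt_one.trans_le h1) _)] at h
  exact absurd h (not_lt.2 (one_le_zpow₀ h1 (by norm_num)))

omit [Finite k] in
theorem valuation_t_pos (O : ValuationSubring F) : 0 < O.valuation (C.t : F) :=
  (Valuation.pos_iff _).2 C.t.ne_zero

include hO in
theorem zpow_t_lt_iff {m n : ℤ} :
    O.valuation (C.t : F) ^ m < O.valuation (C.t : F) ^ n ↔ n < m :=
  zpow_lt_zpow_iff_right_of_lt_one₀ (C.valuation_t_pos O) (C.valuation_t_lt_one hO)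

include hO in
theorem zpow_t_le_iff {m n : ℤ} :
    O.valuation (C.t : F) ^ m ≤ O.valuation (C.t : F) ^ n ↔ n ≤ m :=
  zpow_le_zpow_iff_right_of_lt_one₀ (C.valuation_t_pos O) (C.valuation_t_lt_one hO)

include hO in
theorem zpow_t_inj {m n : ℤ} :
    O.valuation (C.t : F) ^ m = O.valuation (C.t : F) ^ n ↔ m = n := by
  rw [le_antisymm_iff, C.zpow_t_le_iff hO, C.zpow_t_le_iff hO, le_antisymm_iff, and_comm]

include hO in
theorem valuation_mono {n : ℕ} (h : n ≠ 1) :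
    O.valuation (C.mono n) = O.valuation C.t ^ (-n : ℤ) := by
  have ht : O.valuation (C.t : F) ≠ 0 := (C.valuation_t_pos O).ne'
  obtain ⟨i, rfl | rfl⟩ := exists_eq_of_ne_one h
  · rw [mono_even, map_pow, C.valuation_x hO, ← zpow_natCast, ← zpow_mul]
    congr 1
  · rw [mono_odd, map_mul, map_pow, C.valuation_x hO, C.valuation_y hO, ← zpow_natCast,
      ← zpow_mul, ← zpow_add₀ ht]
    congr 1
    push_cast
    ring

/-- Every element of `A` has a leading term. -/
theorem exists_leading {a : F} (ha : a ∈ C.A) (h0 : a ≠ 0) :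
    ∃ n : ℕ, n ≠ 1 ∧ ∃ c : k, c ≠ 0 ∧ ∀ O : ValuationSubring F, C.x ∉ O →
      O.valuation a = O.valuation C.t ^ (-n : ℤ) ∧
      O.valuation (a - algebraMap k F c * C.mono n) < O.valuation C.t ^ (-n : ℤ) := by
  obtain ⟨l, hl, rfl⟩ := (Finsupp.mem_span_image_iff_linearCombination k).1 (C.mem_span_mono ha)
  have hs : l.support.Nonempty := by
    rw [Finsupp.support_nonempty_iff]
    rintro rfl
    simp at h0
  set n := l.support.max' hs
  -- The monomials have distinct pole orders, so the largest index in the support dominates. Index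
  -- and coefficient are chosen before the valuation ring, which later gives uniqueness of the place
  -- at infinity.
  have hn : n ∈ l.support := l.support.max'_mem hs
  refine ⟨n, hl hn, l n, Finsupp.mem_support_iff.1 hn, fun O hO => ?_⟩
  have h : O.valuation (Finsupp.linearCombination k C.mono l - algebraMap k F (l n) * C.mono n)
      < O.valuation C.t ^ (-n : ℤ) := by
    rw [Finsupp.linearCombination_apply, Finsupp.sum, ← Finset.add_sum_erase _ _ hn,
      Algebra.smul_def, add_sub_cancel_left]
    refine O.valuation.map_sum_lt (zpow_ne_zero _ (C.valuation_t_pos O).ne') fun i hi => ?_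
    obtain ⟨hin, hi⟩ := Finset.mem_erase.1 hi
    rw [Algebra.smul_def, map_mul, valuation_algebraMap O (Finsupp.mem_support_iff.1 hi), one_mul,
      C.valuation_mono hO (hl hi), C.zpow_t_lt_iff hO]
    have := l.support.le_max' i hi
    omega
  refine ⟨?_, h⟩
  have h' : O.valuation (algebraMap k F (l n) * C.mono n) = O.valuation C.t ^ (-n : ℤ) := by
    rw [map_mul, valuation_algebraMap O (Finsupp.mem_support_iff.1 hn), one_mul,
      C.valuation_mono hO (hl hn)]
  rw [← h'] at h
  have := O.valuation.map_add_eq_of_lt_left h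
  rwa [add_sub_cancel, h'] at this

include hO in
theorem exists_leading' {a : F} (ha : a ∈ C.A) (h0 : a ≠ 0) :
    ∃ n : ℕ, n ≠ 1 ∧ O.valuation a = O.valuation C.t ^ (-n : ℤ) ∧ ∃ c : k, c ≠ 0 ∧
      O.valuation (a - algebraMap k F c * C.mono n) < O.valuation C.t ^ (-n : ℤ) := by
  obtain ⟨n, hn, c, hc, h⟩ := C.exists_leading ha h0
  exact ⟨n, hn, (h O hO).1, c, hc, (h O hO).2⟩

include hO in
theorem exists_valuation_eq {f : F} (hf : f ≠ 0) :
    ∃ n : ℤ, O.valuation f = O.valuation (C.t : F) ^ n := by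
  obtain ⟨a, ha, b, hb, hb0, rfl⟩ := C.exists_div f
  have ha0 : a ≠ 0 := by
    rintro rfl
    simp at hf
  obtain ⟨n, -, hn, -⟩ := C.exists_leading' hO ha ha0
  obtain ⟨m, -, hm, -⟩ := C.exists_leading' hO hb hb0
  refine ⟨-n + m, ?_⟩
  rw [map_div₀, hn, hm, zpow_add₀ (C.valuation_t_pos O).ne', zpow_neg _ (m : ℤ),
    div_inv_eq_mul]

include hO in
/-- The residue field of the place at infinity is `k`. -/
theorem exists_const {f : F} (hf : O.valuation f ≤ 1) :
    ∃ c : k, O.valuation (f - algebraMap k F c) < 1 := by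
  rcases hf.lt_or_eq with hf | hf
  · exact ⟨0, by simpa using hf⟩
  obtain ⟨a, ha, b, hb, hb0, rfl⟩ := C.exists_div f
  have ha0 : a ≠ 0 := by
    rintro rfl
    simp at hf
  obtain ⟨n, -, hn, c, hc, hc'⟩ := C.exists_leading' hO ha ha0
  obtain ⟨m, -, hm, d, hd, hd'⟩ := C.exists_leading' hO hb hb0
  have hb' : O.valuation b ≠ 0 := (Valuation.ne_zero_iff _).2 hb0
  rw [map_div₀, div_eq_one_iff_eq hb'] at hf
  rw [hn, hm, C.zpow_t_inj hO] at hf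
  obtain rfl : n = m := by omega
  -- Numerator and denominator have the same pole order, so the residue is the quotient of the
  -- leading coefficients.
  refine ⟨c / d, ?_⟩
  have hd0 : algebraMap k F d ≠ 0 := by simpa using hd
  have e : a / b - algebraMap k F (c / d) = ((a - algebraMap k F c * C.mono n)
      - algebraMap k F (c / d) * (b - algebraMap k F d * C.mono n)) / b := by
    rw [map_div₀]
    field_simp
    ring
  rw [e, map_div₀, div_lt_one₀ (zero_lt_iff.2 hb'), hm]
  refine O.valuation.map_sub_lt hc' ?_
  rw [map_mul]
  exact lt_of_le_of_lt (mul_le_of_le_one_left' (valuation_algebraMap_le O _)) hd'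

include hO in
/-- A function in `A` with at most a simple pole at infinity is constant. -/
theorem eq_const_of_mem {a : F} (ha : a ∈ C.A) (h : O.valuation a ≤ O.valuation C.t ^ (-1 : ℤ)) :
    ∃ c : k, a = algebraMap k F c := by
  by_cases h0 : a = 0
  · exact ⟨0, by simpa using h0⟩
  obtain ⟨n, hn, hv, c, -, hc⟩ := C.exists_leading' hO ha h0
  rw [hv, C.zpow_t_le_iff hO] at h
  -- Of the orders 0 and 1 the second is the gap.
  obtain rfl : n = 0 := by omega
  refine ⟨c, ?_⟩
  have hm : C.mono 0 = 1 := by simp [mono]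
  rw [hm, mul_one] at hc
  by_contra h1
  obtain ⟨m, -, hv', -⟩ :=
    C.exists_leading' hO (sub_mem ha (C.A.algebraMap_mem c)) (sub_ne_zero.2 h1)
  rw [hv', C.zpow_t_lt_iff hO] at hc
  omega

include hO in
-- The pole order of a nonzero element of `A` is a natural number, so such an element cannot vanish
-- at infinity.
theorem eq_zero_of_mem {a : F} (ha : a ∈ C.A) (h : O.valuation a < 1) : a = 0 := by
  by_contra h0
  obtain ⟨n, -, hv, -⟩ := C.exists_leading' hO ha h0
  rw [hv, ← zpow_zero (O.valuation (C.t : F)), C.zpow_t_lt_iff hO] at h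
  omega

end PointlessCurve
end Toroidal
end

open scoped RestrictedProduct

noncomputable section

namespace Toroidal

/-! ### The coordinate ring is principal -/

namespace PointlessCurve

variable {k F : Type*} [Field k] [Field F] [Algebra k F] (C : PointlessCurve k F)
variable [Finite k] {O : ValuationSubring F} (hO : C.x ∉ O)

include hO in
-- The residue field is `k`, so the leading term of `z` can be cancelled by a constant multiple of
-- `u`.
theorem exists_const_mul {z u : F} (hu : u ≠ 0) (h : O.valuation z = O.valuation u) :
    ∃ c : k, O.valuation (z - algebraMap k F c * u) < O.valuation u := by
  have hu' : O.valuation u ≠ 0 := (Valuation.ne_zero_iff _).2 hu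
  obtain ⟨c, hc⟩ := C.exists_const hO (f := z / u) (by rw [map_div₀, h, div_self hu'])
  refine ⟨c, ?_⟩
  have e : z - algebraMap k F c * u = (z / u - algebraMap k F c) * u := by
    field_simp
  rw [e, map_mul]
  exact mul_lt_of_lt_one_left (zero_lt_iff.2 hu') hc

include hO in
theorem exists_order {a : F} (ha : a ∈ C.A) (h0 : a ≠ 0) :
    ∃ n : ℕ, O.valuation a = O.valuation C.t ^ (-n : ℤ) := by
  obtain ⟨n, -, h, -⟩ := C.exists_leading' hO ha h0
  exact ⟨n, h⟩

include hO in
/-- Division with remainder in `A`. -/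
theorem exists_remainder {a : F} (ha : a ∈ C.A) {m : ℕ}
    (hm : O.valuation a = O.valuation C.t ^ (-m : ℤ)) {z : F} (hz : z ∈ C.A) :
    ∃ α ∈ C.A, z - α * a = 0 ∨
      ∃ n : ℕ, O.valuation (z - α * a) = O.valuation C.t ^ (-n : ℤ) ∧ (n < m ∨ n = m + 1) := by
  have ht := (C.valuation_t_pos O).ne'
  have key : ∀ N : ℕ, ∀ z ∈ C.A, O.valuation z = O.valuation C.t ^ (-N : ℤ) →
      ∃ α ∈ C.A, z - α * a = 0 ∨
      ∃ n : ℕ, O.valuation (z - α * a) = O.valuation C.t ^ (-n : ℤ) ∧ (n < m ∨ n = m + 1) := by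
    intro N
    induction N using Nat.strong_induction_on with
    | _ N ih =>
      intro z hz hN
      -- Order m + 1 is irreducible too: lowering it would need a multiplier of pole order 1.
      by_cases hc : N < m ∨ N = m + 1
      · exact ⟨0, zero_mem _, Or.inr ⟨N, by simpa using hN, hc⟩⟩
      have hle : m ≤ N := by omega
      have hne : N - m ≠ 1 := by omega
      have hu : O.valuation (C.mono (N - m) * a) = O.valuation C.t ^ (-N : ℤ) := by
        rw [map_mul, C.valuation_mono hO hne, hm, ← zpow_add₀ ht]
        congr 1
        omega
      have hu0 : C.mono (N - m) * a ≠ 0 := by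
        rw [← Valuation.ne_zero_iff O.valuation, hu]
        exact zpow_ne_zero _ ht
      obtain ⟨c, hc⟩ := C.exists_const_mul hO hu0 (hN.trans hu.symm)
      have hm1 : algebraMap k F c * C.mono (N - m) ∈ C.A :=
        mul_mem (C.A.algebraMap_mem c) (C.mono_mem hne)
      have hz' : z - algebraMap k F c * (C.mono (N - m) * a) ∈ C.A := by
        rw [← mul_assoc]
        exact sub_mem hz (mul_mem hm1 ha)
      by_cases h0 : z - algebraMap k F c * (C.mono (N - m) * a) = 0
      · exact ⟨_, hm1, Or.inl (by rw [← h0]; ring)⟩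
      obtain ⟨n, hn⟩ := C.exists_order hO hz' h0
      rw [hn, hu, C.zpow_t_lt_iff hO] at hc
      obtain ⟨α, hα, h⟩ := ih n (by omega) _ hz' hn
      refine ⟨α + algebraMap k F c * C.mono (N - m), add_mem hα hm1, ?_⟩
      rwa [show z - (α + algebraMap k F c * C.mono (N - m)) * a
        = z - algebraMap k F c * (C.mono (N - m) * a) - α * a by ring]
  by_cases h0 : z = 0
  · exact ⟨0, zero_mem _, Or.inl (by simp [h0])⟩
  obtain ⟨N, hN⟩ := C.exists_order hO hz h0
  exact key N z hz hN

include hO in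
/-- An ideal of `A` that is not principal gives a rational point. -/
theorem isPrincipalIdealRing : IsPrincipalIdealRing C.A := by
  refine ⟨fun I => ⟨?_⟩⟩
  by_cases hI : I = ⊥
  · exact ⟨0, by simp [hI]⟩
  have ht := (C.valuation_t_pos O).ne'
  -- Take an element `a` of least pole order m in the ideal. Division by it leaves either 0 or an
  -- element of order exactly m + 1.
  have hex : ∃ n : ℕ, ∃ a ∈ I, O.valuation (a : F) = O.valuation (C.t : F) ^ (-n : ℤ) := by
    obtain ⟨a, haI, ha0⟩ := Submodule.exists_mem_ne_zero_of_ne_bot hI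
    obtain ⟨n, hn⟩ := C.exists_order hO a.2 (by simpa using ha0)
    exact ⟨n, a, haI, hn⟩
  classical
  set m := Nat.find hex
  obtain ⟨a, haI, ha⟩ := Nat.find_spec hex
  have hmin : ∀ z ∈ I, ∀ n : ℕ, O.valuation (z : F) = O.valuation (C.t : F) ^ (-n : ℤ) → m ≤ n :=
    fun z hz n hn => Nat.find_min' hex ⟨z, hz, hn⟩
  have ha0 : (a : F) ≠ 0 := by
    rw [← Valuation.ne_zero_iff O.valuation, ha]
    exact zpow_ne_zero _ ht
  have hsmall : ∀ z ∈ I, O.valuation (z : F) < O.valuation (C.t : F) ^ (-m : ℤ) → z = 0 := by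
    intro z hz h
    by_contra h0
    obtain ⟨n, hn⟩ := C.exists_order hO z.2 (by simpa using h0)
    rw [hn, C.zpow_t_lt_iff hO] at h
    have := hmin z hz n hn
    omega
  have hdiv : ∀ z ∈ I, ∃ α : C.A, z - α * a = 0 ∨
      O.valuation ((z - α * a : C.A) : F) = O.valuation (C.t : F) ^ (-(m + 1 : ℕ) : ℤ) := by
    intro z hz
    obtain ⟨α, hα, h⟩ := C.exists_remainder hO a.2 ha z.2
    refine ⟨⟨α, hα⟩, ?_⟩
    rcases h with h | ⟨n, hn, h⟩
    · exact Or.inl (Subtype.ext h)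
    · refine Or.inr ?_
      have := hmin (z - ⟨α, hα⟩ * a) (sub_mem hz (I.mul_mem_left _ haI)) n hn
      obtain rfl : n = m + 1 := by omega
      exact hn
  by_cases hall : ∀ z ∈ I, ∃ α : C.A, z - α * a = 0
  · refine ⟨a, le_antisymm (fun z hz => ?_) ((Ideal.span_singleton_le_iff_mem _).2 haI)⟩
    obtain ⟨α, hα⟩ := hall z hz
    exact Ideal.mem_span_singleton'.2 ⟨α, (sub_eq_zero.1 hα).symm⟩
  exfalso
  push Not at hall
  obtain ⟨z, hz, hzα⟩ := hall
  obtain ⟨α, hα⟩ := hdiv z hz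
  set b := z - α * a with hb
  have hbI : b ∈ I := sub_mem hz (I.mul_mem_left _ haI)
  replace hα := hα.resolve_left (hzα α)
  have hb0 : (b : F) ≠ 0 := by simpa using hzα α
  -- If a remainder `b` of order m + 1 exists, the ideal is `A a + k b`: its quotient by `A a` is
  -- spanned by `b` over `k`.
  have hgen : ∀ z ∈ I, ∃ α : C.A, ∃ β : k, z = α * a + algebraMap k C.A β * b := by
    intro z hz
    obtain ⟨α, h | h⟩ := hdiv z hz
    · exact ⟨α, 0, by rw [sub_eq_zero] at h; simp [h]⟩
    · obtain ⟨c, hc⟩ := C.exists_const_mul hO hb0 (h.trans hα.symm)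
      set r : C.A := z - α * a - algebraMap k C.A c * b with hr
      have hrI : r ∈ I :=
        sub_mem (sub_mem hz (I.mul_mem_left _ haI)) (I.mul_mem_left _ hbI)
      have hr' : O.valuation (r : F) < O.valuation (b : F) := hc
      by_cases hr0 : r = 0
      · refine ⟨α, c, ?_⟩
        rw [hr0] at hr
        linear_combination -hr
      obtain ⟨n, hn⟩ := C.exists_order hO r.2 (by simpa using hr0)
      have h1 := hmin r hrI n hn
      rw [hn, hα, C.zpow_t_lt_iff hO] at hr'
      obtain rfl : n = m := by omega
      obtain ⟨d, hd⟩ := C.exists_const_mul hO ha0 (hn.trans ha.symm)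
      rw [ha] at hd
      have := hsmall (r - algebraMap k C.A d * a) (sub_mem hrI (I.mul_mem_left _ haI)) hd
      refine ⟨α + algebraMap k C.A d, c, ?_⟩
      linear_combination -hr + this
  set X : C.A := ⟨C.x, C.x_mem⟩
  set Y : C.A := ⟨C.y, C.y_mem⟩
  have hXY : Y ^ 2 + algebraMap k C.A C.a₃ * Y
      = X ^ 3 + algebraMap k C.A C.a₄ * X + algebraMap k C.A C.a₆ := Subtype.ext C.equation
  -- On that line x and y act as scalars r and s. The curve equation then says that `d`, its defect
  -- at (r, s), multiplies `b` into `A a`; as (r, s) is not on the curve, `d` is invertible and `b`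
  -- itself lies in `A a`.
  obtain ⟨αx, r, hx⟩ := hgen (X * b) (I.mul_mem_left _ hbI)
  obtain ⟨αy, s, hy⟩ := hgen (Y * b) (I.mul_mem_left _ hbI)
  set d : k := (s ^ 2 + C.a₃ * s) - (r ^ 3 + C.a₄ * r + C.a₆) with hd
  have hd0 : d ≠ 0 := sub_ne_zero.2 (C.no_point r s)
  have hda : algebraMap k C.A d = (algebraMap k C.A s ^ 2 + algebraMap k C.A C.a₃ *
      algebraMap k C.A s) - (algebraMap k C.A r ^ 3 + algebraMap k C.A C.a₄ * algebraMap k C.A r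
      + algebraMap k C.A C.a₆) := by
    rw [hd]
    simp only [map_sub, map_add, map_mul, map_pow]
  set R := algebraMap k C.A r
  set S := algebraMap k C.A s
  set A3 := algebraMap k C.A C.a₃
  set A4 := algebraMap k C.A C.a₄
  have h1 : algebraMap k C.A d * b = ((X ^ 2 + X * R + R ^ 2 + A4) * αx - (Y + S + A3) * αy) * a := by
    rw [hda]
    linear_combination b * hXY + (X ^ 2 + X * R + R ^ 2 + A4) * hx - (Y + S + A3) * hy
  apply hzα (α + algebraMap k C.A d⁻¹ * ((X ^ 2 + X * R + R ^ 2 + A4) * αx - (Y + S + A3) * αy))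
  have h2 : algebraMap k C.A d⁻¹ * algebraMap k C.A d = 1 := by
    rw [← map_mul, inv_mul_cancel₀ hd0, map_one]
  rw [hb] at h1
  linear_combination (-(z - α * a)) * h2 + algebraMap k C.A d⁻¹ * h1

omit [Finite k] in
theorem isFractionRing : IsFractionRing C.A F where
  map_units z := by
    have h : (z : C.A) ≠ 0 := nonZeroDivisors.ne_zero z.2
    exact IsUnit.mk0 _ fun h' => h (Subtype.ext h')
  surj f := by
    obtain ⟨a, ha, b, hb, hb0, rfl⟩ := C.exists_div f
    refine ⟨⟨⟨a, ha⟩, ⟨⟨b, hb⟩, mem_nonZeroDivisors_of_ne_zero fun h => hb0 ?_⟩⟩, ?_⟩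
    · exact congrArg Subtype.val h
    · exact div_mul_cancel₀ a hb0
  exists_of_eq {a b} h := ⟨1, congrArg _ (Subtype.ext h : a = b)⟩

include hO in
-- Each pole order adds at most one dimension over the finite field `k`.
theorem finite_le (N : ℕ) :
    {a : F | a ∈ C.A ∧ O.valuation a ≤ O.valuation C.t ^ (-N : ℤ)}.Finite := by
  induction N with
  | zero =>
    refine (Set.finite_range (algebraMap k F)).subset fun a ⟨ha, h⟩ => ?_
    obtain ⟨c, hc⟩ := C.eq_const_of_mem hO ha
      (h.trans ((C.zpow_t_le_iff hO).2 (by norm_num)))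
    exact ⟨c, hc.symm⟩
  | succ N ih =>
    by_cases hu : ∃ u ∈ C.A, O.valuation u = O.valuation C.t ^ (-(N + 1 : ℕ) : ℤ)
    · obtain ⟨u, huA, hu⟩ := hu
      have hu0 : u ≠ 0 := by
        rw [← Valuation.ne_zero_iff O.valuation, hu]
        exact zpow_ne_zero _ (C.valuation_t_pos O).ne'
      refine ((ih.prod (Set.finite_univ (α := k))).image
        fun p => p.1 + algebraMap k F p.2 * u).subset fun a ⟨ha, h⟩ => ?_
      have hc : ∃ c : k, O.valuation (a - algebraMap k F c * u)
          < O.valuation C.t ^ (-(N + 1 : ℕ) : ℤ) := by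
        rcases h.lt_or_eq with h | h
        · exact ⟨0, by simpa using h⟩
        · obtain ⟨c, hc⟩ := C.exists_const_mul hO hu0 (h.trans hu.symm)
          exact ⟨c, by rwa [← hu]⟩
      obtain ⟨c, hc⟩ := hc
      have hA : a - algebraMap k F c * u ∈ C.A := sub_mem ha (mul_mem (C.A.algebraMap_mem c) huA)
      refine ⟨(a - algebraMap k F c * u, c), ⟨⟨hA, ?_⟩, Set.mem_univ _⟩, by simp⟩
      by_cases h0 : a - algebraMap k F c * u = 0
      · simp [h0]
      obtain ⟨n, hn⟩ := C.exists_order hO hA h0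
      rw [hn, C.zpow_t_lt_iff hO] at hc
      rw [hn, C.zpow_t_le_iff hO]
      omega
    · refine ih.subset fun a ⟨ha, h⟩ => ⟨ha, ?_⟩
      by_cases h0 : a = 0
      · simp [h0]
      obtain ⟨n, hn⟩ := C.exists_order hO ha h0
      rw [hn, C.zpow_t_le_iff hO] at h
      rw [hn, C.zpow_t_le_iff hO]
      have : n ≠ N + 1 := by
        rintro rfl
        exact hu ⟨a, ha, hn⟩
      omega

include hO in
-- The quotient of `A` by a nonzero element is finite, because remainders of the division have
-- bounded pole order.
theorem exists_finite_reps {a : F} (ha : a ∈ C.A) (h0 : a ≠ 0) :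
    ∃ s : Set F, s.Finite ∧ s ⊆ C.A ∧ ∀ z ∈ C.A, ∃ r ∈ s, ∃ c ∈ C.A, z = r + c * a := by
  obtain ⟨m, hm⟩ := C.exists_order hO ha h0
  refine ⟨_, C.finite_le hO (m + 1), fun _ h => h.1, fun z hz => ?_⟩
  obtain ⟨α, hα, h⟩ := C.exists_remainder hO ha hm hz
  refine ⟨z - α * a, ⟨sub_mem hz (mul_mem hα ha), ?_⟩, α, hα, by ring⟩
  rcases h with h | ⟨n, hn, h⟩
  · simp [h]
  · rw [hn, C.zpow_t_le_iff hO]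
    omega

end PointlessCurve
end Toroidal
end

open scoped RestrictedProduct

noncomputable section

namespace Toroidal

/-! ### The places of the function field -/

/-- The element `ϖ` generates the value group of the place `w`. -/
structure Place.IsUniformizer {F : Type*} [Field F] (w : Place F) (ϖ : Fˣ) : Prop where
  lt_one : w.1.valuation (ϖ : F) < 1
  exists_zpow : ∀ f : F, f ≠ 0 → ∃ n : ℤ, w.1.valuation f = w.1.valuation (ϖ : F) ^ n

namespace Place.IsUniformizer

variable {F : Type*} [Field F] {w : Place F} {ϖ : Fˣ} (h : w.IsUniformizer ϖ)

theorem _root_.Toroidal.Place.valuation_pos (w : Place F) (ϖ : Fˣ) :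
    0 < w.1.valuation (ϖ : F) := (Valuation.pos_iff _).2 ϖ.ne_zero

include h in
theorem zpow_le_iff {m n : ℤ} :
    w.1.valuation (ϖ : F) ^ m ≤ w.1.valuation (ϖ : F) ^ n ↔ n ≤ m :=
  zpow_le_zpow_iff_right_of_lt_one₀ (w.valuation_pos ϖ) h.lt_one

include h in
theorem zpow_lt_iff {m n : ℤ} :
    w.1.valuation (ϖ : F) ^ m < w.1.valuation (ϖ : F) ^ n ↔ n < m :=
  zpow_lt_zpow_iff_right_of_lt_one₀ (w.valuation_pos ϖ) h.lt_one

include h in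
theorem zpow_inj {m n : ℤ} :
    w.1.valuation (ϖ : F) ^ m = w.1.valuation (ϖ : F) ^ n ↔ m = n := by
  rw [le_antisymm_iff, h.zpow_le_iff, h.zpow_le_iff, le_antisymm_iff, and_comm]

end Place.IsUniformizer

namespace PointlessCurve

variable {k F : Type*} [Field k] [Field F] [Algebra k F] (C : PointlessCurve k F)
variable [Finite k]

theorem isUniformizer_t {v : Place F} (hv : C.x ∉ v.1) : v.IsUniformizer C.t :=
  ⟨C.valuation_t_lt_one hv, fun _ hf => C.exists_valuation_eq hv hf⟩

/-- There is only one place at infinity. -/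
theorem place_eq {v w : Place F} (hv : C.x ∉ v.1) (hw : C.x ∉ w.1) : v = w := by
  have key : ∀ {v w : Place F}, C.x ∉ v.1 → C.x ∉ w.1 → v.1 ≤ w.1 := by
    intro v w hv hw f hf
    by_cases h0 : f = 0
    · simp [h0]
    obtain ⟨a, ha, b, hb, hb0, rfl⟩ := C.exists_div f
    have ha0 : a ≠ 0 := by
      rintro rfl
      simp at h0
    -- The orders n and m do not depend on the place, so both places have the same integral
    -- elements.
    obtain ⟨n, -, _, -, hn⟩ := C.exists_leading ha ha0
    obtain ⟨m, -, _, -, hm⟩ := C.exists_leading hb hb0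
    rw [← ValuationSubring.valuation_le_one_iff, map_div₀, (hn v.1 hv).1,
      (hm v.1 hv).1,
      ← zpow_sub₀ (v.valuation_pos _).ne',
      ← zpow_zero (v.1.valuation (C.t : F)), C.zpow_t_le_iff hv] at hf
    rwa [← ValuationSubring.valuation_le_one_iff, map_div₀, (hn w.1 hw).1, (hm w.1 hw).1,
      ← zpow_sub₀ (w.valuation_pos _).ne',
      ← zpow_zero (w.1.valuation (C.t : F)), C.zpow_t_le_iff hw]
  exact Subtype.ext (le_antisymm (key hv hw) (key hw hv))

variable {v : Place F} (hv : C.x ∉ v.1)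

include hv in
theorem x_mem_of_ne {w : Place F} (hw : w ≠ v) : C.x ∈ w.1 := by
  by_contra h
  exact hw (C.place_eq h hv)

/-- The function y is integral over k[x], so a valuation ring containing x contains y. -/
theorem A_le_of_x_mem {w : ValuationSubring F} (hx : C.x ∈ w) {a : F} (ha : a ∈ C.A) : a ∈ w := by
  have hy : C.y ∈ w := by
    by_contra hy
    have hy' : 1 < w.valuation C.y := by
      rw [← not_le, w.valuation_le_one_iff]
      exact hy
    have h1 : w.valuation (C.y ^ 2 + algebraMap k F C.a₃ * C.y) = w.valuation C.y ^ 2 := by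
      rw [Valuation.map_add_eq_of_lt_left, map_pow]
      rw [map_pow, map_mul]
      exact lt_of_le_of_lt (mul_le_of_le_one_left' (valuation_algebraMap_le w _))
        (lt_self_pow₀ hy' (by norm_num))
    have h2 : w.valuation (C.y ^ 2 + algebraMap k F C.a₃ * C.y) ≤ 1 := by
      rw [w.valuation_le_one_iff, C.equation]
      exact add_mem (add_mem (pow_mem hx 3) (mul_mem (algebraMap_mem w _) hx)) (algebraMap_mem w _)
    rw [h1] at h2
    exact absurd h2 (not_le.2 (one_lt_pow₀ hy' (by norm_num)))
  induction ha using Algebra.adjoin_induction with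
  | mem z hz =>
    rcases hz with rfl | hz
    · exact hx
    · rwa [Set.mem_singleton_iff.1 hz]
  | algebraMap c => exact algebraMap_mem w c
  | add a b _ _ ha hb => exact add_mem ha hb
  | mul a b _ _ ha hb => exact mul_mem ha hb

include hv in
theorem A_le {w : Place F} (hw : w ≠ v) {a : F} (ha : a ∈ C.A) : a ∈ w.1 :=
  C.A_le_of_x_mem (C.x_mem_of_ne hv hw) ha

include hv in
theorem valuation_A_le {w : Place F} (hw : w ≠ v) {a : F} (ha : a ∈ C.A) : w.1.valuation a ≤ 1 :=
  (w.1.valuation_le_one_iff a).2 (C.A_le hv hw ha)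

include hv in
/-- The prime element of `A` at a finite place. -/
theorem exists_prime {w : Place F} (hw : w ≠ v) : ∃ π ∈ C.A, π ≠ 0 ∧ w.1.valuation π < 1 ∧
    ∀ a ∈ C.A, w.1.valuation a < 1 → ∃ c ∈ C.A, a = π * c := by
  have := C.isPrincipalIdealRing hv
  -- The trace of the maximal ideal of the place on `A`; its generator is the prime element.
  let I : Ideal C.A :=
    { carrier := {a | w.1.valuation (a : F) < 1}
      zero_mem' := by simp
      add_mem' := fun {a b} ha hb => w.1.valuation.map_add_lt ha hb
      smul_mem' := fun c a ha => by
        simp only [Set.mem_ofPred_eq, smul_eq_mul, MulMemClass.coe_mul, map_mul]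
        exact lt_of_le_of_lt (mul_le_of_le_one_left' (C.valuation_A_le hv hw c.2)) ha }
  obtain ⟨π, hπ⟩ := (IsPrincipalIdealRing.principal I).principal
  have hmem : ∀ a : C.A, w.1.valuation (a : F) < 1 ↔ ∃ c, c * π = a := by
    intro a
    rw [← Ideal.mem_span_singleton', ← Ideal.submodule_span_eq, ← hπ]
    rfl
  refine ⟨π, π.2, ?_, (hmem π).2 ⟨1, one_mul _⟩, fun a ha h => ?_⟩
  -- If the ideal were zero, every nonzero denominator would be a unit at `w` and the valuation ring
  -- would be all of `F`.
  · intro h0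
    apply w.2
    rw [eq_top_iff]
    intro f _
    obtain ⟨a, ha, b, hb, hb0, rfl⟩ := C.exists_div f
    have h1 : w.1.valuation b = 1 := by
      refine le_antisymm (C.valuation_A_le hv hw hb) (not_lt.1 fun h => ?_)
      obtain ⟨c, hc⟩ := (hmem ⟨b, hb⟩).1 h
      apply hb0
      have := congrArg Subtype.val hc
      simpa [h0] using this.symm
    rw [← ValuationSubring.valuation_le_one_iff, map_div₀, h1, div_one]
    exact C.valuation_A_le hv hw ha
  · obtain ⟨c, hc⟩ := (hmem ⟨a, ha⟩).1 h
    exact ⟨c, c.2, by rw [mul_comm]; exact (congrArg Subtype.val hc).symm⟩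

include hv in
/-- The element `π` generates the prime ideal of `A` at the place `w`. -/
theorem exists_pow_mul {w : Place F} (hw : w ≠ v) {π : F} (hπA : π ∈ C.A)
    (hπ : w.1.valuation π < 1)
    (hgen : ∀ a ∈ C.A, w.1.valuation a < 1 → ∃ c ∈ C.A, a = π * c) {a : F} (ha : a ∈ C.A)
    (ha0 : a ≠ 0) : ∃ n : ℕ, ∃ c ∈ C.A, a = π ^ n * c ∧ w.1.valuation c = 1 := by
  have := C.isPrincipalIdealRing hv
  have hu : ¬ IsUnit (⟨π, hπA⟩ : C.A) := by
    intro hu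
    obtain ⟨b, hb⟩ := hu.exists_right_inv
    have h1 := congrArg (fun z : C.A => w.1.valuation (z : F)) hb
    simp only [MulMemClass.coe_mul, map_mul, OneMemClass.coe_one, map_one] at h1
    exact absurd h1 (lt_of_le_of_lt (mul_le_of_le_one_right' (C.valuation_A_le hv hw b.2)) hπ).ne
  have ha0' : (⟨a, ha⟩ : C.A) ≠ 0 := fun h => ha0 (congrArg Subtype.val h)
  obtain ⟨c, hc, hdvd⟩ := (FiniteMultiplicity.of_not_isUnit hu ha0').exists_eq_pow_mul_and_not_dvd
  refine ⟨_, c, c.2, congrArg Subtype.val hc, ?_⟩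
  refine le_antisymm (C.valuation_A_le hv hw c.2) (not_lt.1 fun h => hdvd ?_)
  obtain ⟨d, hd, h⟩ := hgen c c.2 h
  exact ⟨⟨d, hd⟩, Subtype.ext h⟩

include hv in
-- Powers of π are split off numerator and denominator: the valuation ring is the localisation of
-- `A` at π.
theorem exists_fraction {w : Place F} (hw : w ≠ v) {π : F} (hπA : π ∈ C.A) (hπ0 : π ≠ 0)
    (hπ : w.1.valuation π < 1)
    (hgen : ∀ a ∈ C.A, w.1.valuation a < 1 → ∃ c ∈ C.A, a = π * c) {f : F} (hf : f ≠ 0) :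
    ∃ n : ℤ, ∃ c ∈ C.A, ∃ d ∈ C.A, f = π ^ n * c / d ∧ w.1.valuation c = 1 ∧
      w.1.valuation d = 1 := by
  obtain ⟨a, ha, b, hb, hb0, rfl⟩ := C.exists_div f
  have ha0 : a ≠ 0 := by
    rintro rfl
    simp at hf
  obtain ⟨n, c, hc, h1, h2⟩ := C.exists_pow_mul hv hw hπA hπ hgen ha ha0
  obtain ⟨m, d, hd, h3, h4⟩ := C.exists_pow_mul hv hw hπA hπ hgen hb hb0
  have hd0 : d ≠ 0 := by
    rintro rfl
    simp at h4
  refine ⟨n - m, c, hc, d, hd, ?_, h2, h4⟩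
  rw [h1, h3, zpow_sub₀ hπ0, zpow_natCast, zpow_natCast]
  field_simp

include hv in
/-- A finite place is determined by its prime ideal in `A`. -/
theorem place_eq_of_valuation_lt_one_iff {w w' : Place F} (hw : w ≠ v) (hw' : w' ≠ v)
    (h : ∀ a ∈ C.A, w.1.valuation a < 1 ↔ w'.1.valuation a < 1) : w = w' := by
  have key : ∀ {w w' : Place F}, w ≠ v → w' ≠ v →
      (∀ a ∈ C.A, w.1.valuation a < 1 ↔ w'.1.valuation a < 1) → w.1 ≤ w'.1 := by
    intro w w' hw hw' h f hf
    by_cases hf0 : f = 0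
    · simp [hf0]
    obtain ⟨π, hπA, hπ0, hπ, hgen⟩ := C.exists_prime hv hw
    obtain ⟨n, c, hc, d, hd, rfl, h1, h2⟩ := C.exists_fraction hv hw hπA hπ0 hπ hgen hf0
    have hd' : w'.1.valuation d = 1 := by
      refine le_antisymm (C.valuation_A_le hv hw' hd) (not_lt.1 fun hlt => ?_)
      exact absurd h2 ((h d hd).2 hlt).ne
    rw [← ValuationSubring.valuation_le_one_iff, map_div₀, map_mul, h1, h2, map_zpow₀, mul_one,
      div_one] at hf
    have hn : 0 ≤ n := by
      by_contra hn
      rw [not_le] at hn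
      exact absurd hf (not_le.2 (one_lt_zpow_of_neg₀ ((Valuation.pos_iff _).2 hπ0) hπ hn))
    rw [← ValuationSubring.valuation_le_one_iff, map_div₀, map_mul, hd', map_zpow₀, div_one]
    refine mul_le_one' ?_ (C.valuation_A_le hv hw' hc)
    lift n to ℕ using hn
    rw [zpow_natCast]
    exact pow_le_one' (C.valuation_A_le hv hw' hπA) n
  exact Subtype.ext (le_antisymm (key hw hw' h) (key hw' hw fun a ha => (h a ha).symm))

include hv in
/-- At a finite place there is a uniformizer that is a unit at all other finite places, and
elements of `F` can be approximated by elements integral at all other finite places. -/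
theorem exists_uniformizer {w : Place F} (hw : w ≠ v) : ∃ ϖ : Fˣ, w.IsUniformizer ϖ ∧
    (ϖ : F) ∈ C.A ∧ (∀ a ∈ C.A, w.1.valuation a < 1 → ∃ c ∈ C.A, a = ϖ * c) ∧
    (∀ w' : Place F, w' ≠ v → w' ≠ w → w'.1.valuation (ϖ : F) = 1) ∧
    ∀ (f : F) (n : ℤ), ∃ m : ℤ, ∃ c ∈ C.A,
      w.1.valuation (f - (ϖ : F) ^ m * c) ≤ w.1.valuation (ϖ : F) ^ n ∧
      (w.1.valuation f ≤ 1 → 0 ≤ m) := by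
  obtain ⟨π, hπA, hπ0, hπ, hgen⟩ := C.exists_prime hv hw
  have hun : w.IsUniformizer (Units.mk0 π hπ0) := by
    refine ⟨hπ, fun f hf => ?_⟩
    obtain ⟨n, c, hc, d, hd, rfl, h1, h2⟩ := C.exists_fraction hv hw hπA hπ0 hπ hgen hf
    exact ⟨n, by simp [h1, h2]⟩
  refine ⟨Units.mk0 π hπ0, hun, hπA, hgen, fun w' hw' hne => ?_, fun f n => ?_⟩
  · refine le_antisymm (C.valuation_A_le hv hw' hπA) (not_lt.1 fun hlt => hne ?_)
    have hlt' : w'.1.valuation π < 1 := hlt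
    obtain ⟨π', hπA', hπ0', hπ', hgen'⟩ := C.exists_prime hv hw'
    obtain ⟨c, hcA, hc⟩ := hgen' π hπA hlt'
    -- The relation π = π' c with π' a unit at `w` would make c divisible by π and hence π' a unit
    -- of `A`. So the two primes are associated and the two places coincide.
    have hass : w.1.valuation π' < 1 := by
      by_contra h1
      have h1 : w.1.valuation π' = 1 := le_antisymm (C.valuation_A_le hv hw hπA') (not_lt.1 h1)
      have h2 : w.1.valuation c < 1 := by
        rw [hc, map_mul, h1, one_mul] at hπ
        exact hπ
      obtain ⟨e, he, rfl⟩ := hgen c hcA h2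
      have h3 : π' * e = 1 := mul_left_cancel₀ hπ0 (by linear_combination -hc)
      have h4 := congrArg w'.1.valuation h3
      rw [map_mul, map_one] at h4
      exact absurd h4 (lt_of_le_of_lt
        (mul_le_of_le_one_right' (C.valuation_A_le hv hw' he)) hπ').ne
    refine (C.place_eq_of_valuation_lt_one_iff hv hw hw' fun a ha => ⟨fun h => ?_, fun h => ?_⟩).symm
    · obtain ⟨e, he, rfl⟩ := hgen a ha h
      rw [map_mul]
      exact lt_of_le_of_lt (mul_le_of_le_one_right' (C.valuation_A_le hv hw' he)) hlt'
    · obtain ⟨e, he, rfl⟩ := hgen' a ha h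
      rw [map_mul]
      exact lt_of_le_of_lt (mul_le_of_le_one_right' (C.valuation_A_le hv hw he)) hass
  · by_cases hf : f = 0
    · exact ⟨0, 0, zero_mem _, by simp [hf], fun _ => le_rfl⟩
    obtain ⟨N, c, hc, d, hd, rfl, h1, h2⟩ := C.exists_fraction hv hw hπA hπ0 hπ hgen hf
    have := C.isPrincipalIdealRing hv
    have hirr : Irreducible (⟨π, hπA⟩ : C.A) := by
      refine ⟨fun hu => ?_, fun {a b} hab => ?_⟩
      · obtain ⟨b, hb⟩ := hu.exists_right_inv
        have h1 := congrArg (fun z : C.A => w.1.valuation (z : F)) hb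
        simp only [MulMemClass.coe_mul, map_mul, OneMemClass.coe_one, map_one] at h1
        exact absurd h1
          (lt_of_le_of_lt (mul_le_of_le_one_right' (C.valuation_A_le hv hw b.2)) hπ).ne
      · have hab' : π = a * b := congrArg Subtype.val hab
        have key : ∀ a b : C.A, π = a * b → w.1.valuation (a : F) < 1 → IsUnit b := by
          intro a b hab h
          obtain ⟨e, he, hae⟩ := hgen a a.2 h
          refine IsUnit.of_mul_eq_one ⟨e, he⟩ (Subtype.ext (mul_left_cancel₀ hπ0 ?_))
          simp only [MulMemClass.coe_mul, OneMemClass.coe_one]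
          linear_combination (b : F) * (-hae) - hab
        by_cases ha : w.1.valuation (a : F) < 1
        · exact Or.inr (key a b hab' ha)
        · refine Or.inl (key b a (hab'.trans (mul_comm _ _)) ?_)
          have ha1 : w.1.valuation (a : F) = 1 :=
            le_antisymm (C.valuation_A_le hv hw a.2) (not_lt.1 ha)
          rwa [hab', map_mul, ha1, one_mul] at hπ
    have hcop : IsCoprime (⟨π, hπA⟩ : C.A) ⟨d, hd⟩ := by
      rw [hirr.coprime_iff_not_dvd]
      rintro ⟨e, he⟩
      have he' : d = π * e := congrArg Subtype.val he
      rw [he', map_mul] at h2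
      exact absurd h2 (lt_of_le_of_lt
        (mul_le_of_le_one_right' (C.valuation_A_le hv hw e.2)) hπ).ne
    -- The coefficient u' inverts the denominator d modulo a power of π. The exponent is chosen so
    -- that, after multiplication by π^N, the error has order at least n.
    obtain ⟨u, u', huu⟩ := hcop.pow_left (m := (n - N).toNat)
    have huu' : (u : F) * π ^ (n - N).toNat + u' * d = 1 := congrArg Subtype.val huu
    have hd0 : d ≠ 0 := by
      rintro rfl
      simp at h2
    refine ⟨N, c * u', mul_mem hc u'.2, ?_, fun hle => ?_⟩
    · have e : π ^ N * c / d - (Units.mk0 π hπ0 : F) ^ N * (c * u')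
          = π ^ (N + (n - N).toNat) * (c / d * u) := by
        rw [zpow_add₀ hπ0, zpow_natCast, Units.val_mk0]
        field_simp
        linear_combination -c * huu'
      rw [e, map_mul, map_mul, map_div₀, h1, h2, div_one, one_mul, map_zpow₀]
      refine (mul_le_of_le_one_right' (C.valuation_A_le hv hw u.2)).trans ?_
      exact (hun.zpow_le_iff (m := N + (n - N).toNat)).2 (by omega)
    · rw [map_div₀, map_mul, h1, h2, mul_one, div_one, map_zpow₀,
        ← zpow_zero (w.1.valuation π)] at hle
      exact (hun.zpow_le_iff (m := N)).1 hle

include hv in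
/-- The residue fields are finite. -/
theorem exists_residue_reps {w : Place F} (hw : w ≠ v) : ∃ s : Set F, s.Finite ∧ s ⊆ C.A ∧
    ∀ f, w.1.valuation f ≤ 1 → ∃ r ∈ s, w.1.valuation (f - r) < 1 := by
  obtain ⟨ϖ, hϖ, hϖA, -, -, happ⟩ := C.exists_uniformizer hv hw
  obtain ⟨s, hs, hsA, hrep⟩ := C.exists_finite_reps hv hϖA ϖ.ne_zero
  refine ⟨s, hs, hsA, fun f hf => ?_⟩
  obtain ⟨m, c, hc, h1, h2⟩ := happ f 1
  lift m to ℕ using h2 hf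
  rw [zpow_natCast] at h1
  obtain ⟨r, hr, e, he, h⟩ := hrep (ϖ ^ m * c) (mul_mem (pow_mem hϖA m) hc)
  refine ⟨r, hr, ?_⟩
  rw [show f - r = (f - ϖ ^ m * c) + e * ϖ by linear_combination h]
  refine w.1.valuation.map_add_lt (lt_of_le_of_lt h1 (by simpa using hϖ.lt_one)) ?_
  rw [map_mul]
  exact lt_of_le_of_lt (mul_le_of_le_one_left' (C.valuation_A_le hv hw he)) hϖ.lt_one

include hv in
/-- A function has finitely many poles. -/
theorem finite_poles (f : F) : {w : Place F | f ∉ w.1}.Finite := by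
  obtain ⟨a, ha, b, hb, hb0, rfl⟩ := C.exists_div f
  obtain ⟨s, hs, hsA, hrep⟩ := C.exists_finite_reps hv hb hb0
  -- Poles away from `v` are places where the denominator b is not a unit. Such a place is recovered
  -- from the finitely many residues modulo b that vanish there.
  refine (Set.Finite.of_finite_image (s := {w : Place F | w ≠ v ∧ w.1.valuation b < 1})
    (f := fun w => {r ∈ s | w.1.valuation r < 1}) ?_ ?_ |>.insert v).subset ?_
  · exact hs.finite_subsets.subset (by rintro _ ⟨w, -, rfl⟩; exact fun _ h => h.1)
  · rintro w ⟨hw, hwb⟩ w' ⟨hw', hwb'⟩ h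
    have key : ∀ {w : Place F}, w ≠ v → w.1.valuation b < 1 → ∀ r : F, ∀ c ∈ C.A,
        (w.1.valuation (r + c * b) < 1 ↔ w.1.valuation r < 1) := by
      intro w hw hwb r c hc
      have hcb : w.1.valuation (c * b) < 1 := by
        rw [map_mul]
        exact lt_of_le_of_lt (mul_le_of_le_one_left' (C.valuation_A_le hv hw hc)) hwb
      refine ⟨fun h => ?_, fun h => w.1.valuation.map_add_lt h hcb⟩
      rw [show r = (r + c * b) - c * b by ring]
      exact w.1.valuation.map_sub_lt h hcb
    refine C.place_eq_of_valuation_lt_one_iff hv hw hw' fun a ha => ?_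
    obtain ⟨r, hr, c, hc, rfl⟩ := hrep a ha
    rw [key hw hwb r c hc, key hw' hwb' r c hc]
    have h' := Set.ext_iff.1 h r
    simpa [hr] using h'
  · intro w hw
    rw [Set.mem_insert_iff, or_iff_not_imp_left]
    intro hwv
    refine ⟨hwv, lt_of_not_ge fun h => hw ?_⟩
    have h1 : w.1.valuation b = 1 := le_antisymm (C.valuation_A_le hv hwv hb) h
    rw [← ValuationSubring.valuation_le_one_iff, map_div₀, h1, div_one]
    exact C.valuation_A_le hv hwv ha

include hv in
-- A principal ideal domain is integrally closed, so an element outside `A` is missed by some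
-- valuation ring containing `A`. That ring contains x, hence is not the one at infinity.
theorem mem_holomorphicOutside_iff {f : F} : f ∈ holomorphicOutside v ↔ f ∈ C.A := by
  have hiff : f ∈ holomorphicOutside v ↔ ∀ w : Place F, w ≠ v → f ∈ w.1 := by
    simp only [holomorphicOutside, Subring.mem_iInf, Subtype.forall]
    rfl
  rw [hiff]
  refine ⟨fun h => ?_, fun h w hw => C.A_le hv hw h⟩
  by_contra hf
  have := C.isPrincipalIdealRing hv
  have := C.isFractionRing
  have : IsIntegrallyClosedIn C.A F := isIntegrallyClosed_iff_isIntegrallyClosedIn F |>.1 inferInstance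
  have : IsIntegrallyClosedIn C.A.toSubring F := this
  obtain ⟨V, hV, hfV⟩ := Subring.exists_le_valuationSubring_of_isIntegrallyClosedIn
    (R := C.A.toSubring) (x := f) hf
  have hV' : V ≠ ⊤ := by
    rintro rfl
    exact hfV (ValuationSubring.mem_top f)
  refine hfV (h ⟨V, hV'⟩ ?_)
  rintro rfl
  exact hv (hV C.x_mem)

end PointlessCurve
end Toroidal
end

open scoped RestrictedProduct

noncomputable section

namespace Toroidal

/-! ### Completions -/

namespace Place

variable {F : Type*} [Field F] (w : Place F)

/-- The valuation of the completion. -/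
abbrev val : Valuation w.Completion w.1.ValueGroup := Valued.v

theorem val_algebraMap (a : F) : w.val (algebraMap F w.Completion a) = w.1.valuation a :=
  Valued.valuedCompletion_apply (K := WithVal w.1.valuation) _

theorem mem_integers {α : w.Completion} : α ∈ w.integers ↔ w.val α ≤ 1 := Iff.rfl

theorem algebraMap_mem_integers {a : F} : algebraMap F w.Completion a ∈ w.integers ↔ a ∈ w.1 := by
  rw [mem_integers, val_algebraMap, ValuationSubring.valuation_le_one_iff]

theorem exists_val_eq (α : w.Completion) : ∃ a : F, w.val α = w.1.valuation a := by
  obtain ⟨r, hr⟩ := Valued.exists_coe_eq_v (K := WithVal w.1.valuation) α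
  exact ⟨WithVal.equiv _ r, hr⟩

theorem isOpen_integers : IsOpen (w.integers : Set w.Completion) :=
  Valued.isOpen_valuationSubring w.Completion

theorem isClosed_integers : IsClosed (w.integers : Set w.Completion) :=
  Valued.isClosed_valuationSubring w.Completion

theorem denseRange_algebraMap : DenseRange (algebraMap F w.Completion) :=
  (UniformSpace.Completion.denseRange_coe (α := WithVal w.1.valuation)).comp
    (WithVal.equiv w.1.valuation).symm.surjective.denseRange
    (UniformSpace.Completion.continuous_coe _)

theorem exists_approx (α : w.Completion) {g : F} (hg : g ≠ 0) :
    ∃ a : F, w.val (α - algebraMap F w.Completion a) ≤ w.1.valuation g := by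
  have hg' : algebraMap F w.Completion g ≠ 0 := by simpa using hg
  have hcont : Continuous fun β : w.Completion => (α - β) * (algebraMap F w.Completion g)⁻¹ := by
    fun_prop
  obtain ⟨a, ha⟩ := w.denseRange_algebraMap.exists_mem_open
    (w.isOpen_integers.preimage hcont) ⟨α, by simp⟩
  refine ⟨a, ?_⟩
  have ha' : w.val ((α - algebraMap F w.Completion a) * (algebraMap F w.Completion g)⁻¹) ≤ 1 := ha
  rwa [map_mul, map_inv₀, val_algebraMap, ← div_eq_mul_inv,
    div_le_one₀ ((Valuation.pos_iff _).2 hg)] at ha'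

variable {w} {ϖ : Fˣ} (hϖ : w.IsUniformizer ϖ)

include hϖ in
theorem IsUniformizer.exists_val_eq {α : w.Completion} (hα : α ≠ 0) :
    ∃ n : ℤ, w.val α = w.1.valuation (ϖ : F) ^ n := by
  obtain ⟨a, ha⟩ := w.exists_val_eq α
  have ha0 : a ≠ 0 := by
    rw [← Valuation.ne_zero_iff w.1.valuation, ← ha]
    exact (Valuation.ne_zero_iff _).2 hα
  obtain ⟨n, hn⟩ := hϖ.exists_zpow a ha0
  exact ⟨n, ha.trans hn⟩

include hϖ in
/-- The ring of integers of a completion with finite residue field is compact. -/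
theorem IsUniformizer.isCompact_integers {s : Set F} (hs : s.Finite)
    (h1 : ∀ f, w.1.valuation f ≤ 1 → ∃ r ∈ s, w.1.valuation (f - r) < 1) :
    IsCompact (w.integers : Set w.Completion) := by
  have hpos := w.valuation_pos ϖ
  -- Truncated expansions in powers of the uniformizer with digits in `s` form finite nets of every
  -- precision; with closedness this gives compactness.
  have step : ∀ n : ℕ, ∃ S : Set F, S.Finite ∧ ∀ α ∈ w.integers, ∃ r ∈ S,
      w.val (α - algebraMap F w.Completion r) ≤ w.1.valuation (ϖ : F) ^ n := by
    intro n
    induction n with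
    | zero =>
      refine ⟨{0}, Set.finite_singleton 0, fun α hα => ⟨0, rfl, ?_⟩⟩
      simpa using mem_integers _ |>.1 hα
    | succ n ih =>
      obtain ⟨S, hS, h⟩ := ih
      refine ⟨_, (hS.prod hs).image fun p => p.1 + (ϖ : F) ^ n * p.2, fun α hα => ?_⟩
      obtain ⟨r, hr, hrα⟩ := h α hα
      obtain ⟨a, ha⟩ := w.exists_approx (α - algebraMap F w.Completion r)
        (pow_ne_zero (n + 1) ϖ.ne_zero)
      rw [map_pow] at ha
      have hlt : w.1.valuation (ϖ : F) ^ (n + 1) ≤ w.1.valuation (ϖ : F) ^ n :=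
        pow_le_pow_right_of_le_one' hϖ.lt_one.le (Nat.le_succ n)
      have hpn : 0 < w.1.valuation (ϖ : F) ^ n := pow_pos hpos n
      have haϖ : w.1.valuation (a / (ϖ : F) ^ n) ≤ 1 := by
        rw [map_div₀, map_pow, div_le_one₀ hpn, ← val_algebraMap]
        have := w.val.map_sub_le hrα (ha.trans hlt)
        simpa using this
      obtain ⟨d, hd, hda⟩ := h1 _ haϖ
      refine ⟨_, ⟨(r, d), ⟨hr, hd⟩, rfl⟩, ?_⟩
      have hda' : w.1.valuation (a - (ϖ : F) ^ n * d) ≤ w.1.valuation (ϖ : F) ^ (n + 1) := by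
        by_cases h0 : a / (ϖ : F) ^ n - d = 0
        · have : a - (ϖ : F) ^ n * d = 0 := by
            have := ϖ.ne_zero
            field_simp at h0
            linear_combination h0
          simp [this]
        obtain ⟨m, hm⟩ := hϖ.exists_zpow _ h0
        rw [hm, ← zpow_zero (w.1.valuation (ϖ : F)), hϖ.zpow_lt_iff] at hda
        have e : a - (ϖ : F) ^ n * d = (ϖ : F) ^ n * (a / (ϖ : F) ^ n - d) := by
          have := ϖ.ne_zero
          field_simp
        rw [e, map_mul, map_pow, hm, ← zpow_natCast, ← zpow_natCast, ← zpow_add₀ hpos.ne',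
          hϖ.zpow_le_iff]
        push_cast
        omega
      have e : α - algebraMap F w.Completion (r + (ϖ : F) ^ n * d)
          = (α - algebraMap F w.Completion r - algebraMap F w.Completion a)
            + algebraMap F w.Completion (a - (ϖ : F) ^ n * d) := by
        simp only [map_add, map_sub]
        ring
      rw [e]
      exact w.val.map_add_le ha ((w.val_algebraMap _).le.trans hda')
  refine TotallyBounded.isCompact_of_isClosed ?_ w.isClosed_integers
  rw [totallyBounded_iff_subset_finite_iUnion_nhds_zero]
  intro U hU
  obtain ⟨γ, hγ⟩ := Valued.mem_nhds_zero.1 hU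
  obtain ⟨ρ, hρ⟩ := MonoidWithZeroHom.ValueGroup₀.restrict₀_surjective (MonoidWithZeroHom.ofClass w.val) γ.1
  have hρ' : w.val.restrict ρ = γ.1 := hρ
  have hρ0 : ρ ≠ 0 := by
    rintro rfl
    rw [map_zero] at hρ'
    exact γ.ne_zero hρ'.symm
  obtain ⟨m, hm⟩ := hϖ.exists_val_eq hρ0
  obtain ⟨S, hS, h⟩ := step (m + 1).toNat
  refine ⟨_, hS.image (algebraMap F w.Completion), fun α hα => ?_⟩
  obtain ⟨r, hr, hrα⟩ := h α hα
  simp only [Set.mem_iUnion]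
  refine ⟨_, ⟨r, hr, rfl⟩, α - algebraMap F w.Completion r, hγ ?_, by simp⟩
  rw [Set.mem_ofPred_eq, ← hρ', Valuation.restrict_lt_iff, hm]
  refine lt_of_le_of_lt hrα ?_
  rw [← zpow_natCast, hϖ.zpow_lt_iff]
  omega

end Place

/-! ### Integral matrices over a field -/

section Integral

variable {K : Type*} [Field K]

theorem mem_integralGL2_iff {S : Subring K} {g : GL2 K} :
    g ∈ integralGL2 S ↔ (∀ i j, g i j ∈ S) ∧ (g.val.det)⁻¹ ∈ S := by
  constructor
  · rintro ⟨h, rfl⟩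
    refine ⟨fun i j => (h i j).2, ?_⟩
    have e : (Matrix.GeneralLinearGroup.map S.subtype h : GL2 K).val.det = S.subtype h.val.det :=
      (RingHom.map_det S.subtype h.val).symm
    have h1 : S.subtype h.val.det * S.subtype (h⁻¹).val.det = 1 := by
      rw [← map_mul, ← Matrix.det_mul, ← Units.val_mul, mul_inv_cancel, Units.val_one,
        Matrix.det_one, map_one]
    rw [e, inv_eq_of_mul_eq_one_right h1]
    exact (h⁻¹).val.det.2
  · rintro ⟨h, hd⟩
    have hdet : g.val.det ≠ 0 := g.det.ne_zero
    let M : Matrix (Fin 2) (Fin 2) S := fun i j => ⟨g i j, h i j⟩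
    have hM : S.subtype M.det = g.val.det := by
      rw [RingHom.map_det]
      rfl
    have hu : IsUnit M.det := IsUnit.of_mul_eq_one ⟨_, hd⟩ (Subtype.ext (by
      change S.subtype M.det * _ = 1
      rw [hM, mul_inv_cancel₀ hdet]))
    refine ⟨((Matrix.isUnit_iff_isUnit_det M).2 hu).unit, ?_⟩
    ext i j
    rfl

theorem mem_integralGL2_of_valuation {Γ₀ : Type*} [LinearOrderedCommGroupWithZero Γ₀]
    (V : Valuation K Γ₀) {S : Subring K} (hS : ∀ a, a ∈ S ↔ V a ≤ 1) {g : GL2 K} :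
    g ∈ integralGL2 S ↔ (∀ i j, V (g i j) ≤ 1) ∧ V g.val.det = 1 := by
  rw [mem_integralGL2_iff]
  simp only [hS]
  refine and_congr_right fun h => ?_
  have hdet : V g.val.det ≤ 1 := by
    rw [Matrix.det_fin_two]
    refine V.map_sub_le ?_ ?_ <;> rw [map_mul] <;> exact mul_le_one' (h _ _) (h _ _)
  have hpos : 0 < V g.val.det := (Valuation.pos_iff _).2 g.det.ne_zero
  rw [map_inv₀, inv_le_one₀ hpos]
  exact ⟨fun h' => le_antisymm hdet h', fun h' => h'.ge⟩

end Integral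

/-- The matrix with rows `(a, b)` and `(0, d)`. -/
def upperMat {R : Type*} [CommRing R] (a d : Rˣ) (b : R) : GL2 R where
  val := !![(a : R), b; 0, d]
  inv := !![((a⁻¹ : Rˣ) : R), -((a⁻¹ : Rˣ) : R) * b * ((d⁻¹ : Rˣ) : R); 0, ((d⁻¹ : Rˣ) : R)]
  val_inv := by
    ext i j
    fin_cases i <;> fin_cases j <;> simp [Matrix.mul_apply, Fin.sum_univ_two, mul_assoc]
  inv_val := by
    ext i j
    fin_cases i <;> fin_cases j <;> simp [Matrix.mul_apply, Fin.sum_univ_two, mul_assoc]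

/-- The matrix with rows `(a, b)` and `(c, d)`. -/
def mat {K : Type*} [Field K] (a b c d : K) (h : a * d - b * c ≠ 0) : GL2 K :=
  Matrix.GeneralLinearGroup.mkOfDetNeZero !![a, b; c, d] (by rwa [Matrix.det_fin_two_of])

theorem val_mat {K : Type*} [Field K] (a b c d : K) (h : a * d - b * c ≠ 0) :
    (mat a b c d h).val = !![a, b; c, d] := rfl

namespace Place

variable {F : Type*} [Field F] {w : Place F}

theorem mem_integralGL2_integers {g : GL2 w.Completion} :
    g ∈ integralGL2 w.integers.toSubring ↔
      (∀ i j, w.val (g i j) ≤ 1) ∧ w.val g.val.det = 1 :=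
  mem_integralGL2_of_valuation w.val fun _ => Iff.rfl

theorem mem_integralGL2_place {g : GL2 F} :
    g ∈ integralGL2 w.1.toSubring ↔
      (∀ i j, w.1.valuation (g i j) ≤ 1) ∧ w.1.valuation g.val.det = 1 :=
  mem_integralGL2_of_valuation w.1.valuation fun a => (w.1.valuation_le_one_iff a).symm

theorem toLocal_apply (g : GL2 F) (i j : Fin 2) :
    toLocal w g i j = algebraMap F w.Completion (g i j) := rfl

theorem det_toLocal (g : GL2 F) :
    (toLocal w g).val.det = algebraMap F w.Completion g.val.det :=
  (RingHom.map_det (algebraMap F w.Completion) g.val).symm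

theorem toLocal_mem_integralGL2_iff {g : GL2 F} :
    toLocal w g ∈ integralGL2 w.integers.toSubring ↔ g ∈ integralGL2 w.1.toSubring := by
  simp only [mem_integralGL2_integers, mem_integralGL2_place, toLocal_apply, det_toLocal,
    val_algebraMap]

/-- Every matrix can be made upper triangular by an integral matrix. -/
theorem exists_mul_integral_lower_eq_zero (h : GL2 w.Completion) :
    ∃ κ ∈ integralGL2 w.integers.toSubring, (h * κ) 1 0 = 0 := by
  have hdet : h 0 0 * h 1 1 - h 0 1 * h 1 0 ≠ 0 := by
    rw [← Matrix.det_fin_two]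
    exact h.det.ne_zero
  -- A column operation with the larger entry of the bottom row as pivot has integral coefficients.
  rcases le_or_gt (w.val (h 1 0)) (w.val (h 1 1)) with hle | hlt
  · have hd : h 1 1 ≠ 0 := by
      intro h0
      rw [h0, map_zero, le_zero_iff, map_eq_zero] at hle
      simp [h0, hle] at hdet
    refine ⟨mat 1 0 (-(h 1 0 / h 1 1)) 1 (by simp),
      mem_integralGL2_integers.2 ⟨fun i j => ?_, ?_⟩, ?_⟩
    · have h1 : w.val (h 1 0) / w.val (h 1 1) ≤ 1 :=
        (div_le_one₀ ((Valuation.pos_iff _).2 hd)).2 hle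
      fin_cases i <;> fin_cases j <;> simp [val_mat, h1]
    · simp [val_mat]
    · simp only [Units.val_mul, val_mat, Matrix.mul_apply, Fin.sum_univ_two]
      simp
      field_simp
      ring
  · have hc : h 1 0 ≠ 0 := by
      intro h0
      simp [h0] at hlt
    refine ⟨mat (-(h 1 1 / h 1 0)) 1 1 0 (by simp),
      mem_integralGL2_integers.2 ⟨fun i j => ?_, ?_⟩, ?_⟩
    · have h1 : w.val (h 1 1) / w.val (h 1 0) ≤ 1 :=
        (div_le_one₀ ((Valuation.pos_iff _).2 hc)).2 hlt.le
      fin_cases i <;> fin_cases j <;> simp [val_mat, h1]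
    · simp [val_mat]
    · simp only [Units.val_mul, val_mat, Matrix.mul_apply, Fin.sum_univ_two]
      simp
      field_simp
      ring

/-- The Iwasawa decomposition, with the unipotent part in a dense set. -/
theorem IsUniformizer.exists_upperMat_mul {ϖ : Fˣ} (hϖ : w.IsUniformizer ϖ) {B : Set F}
    (hB : ∀ (f : F) (n : ℤ), ∃ b ∈ B, w.1.valuation (f - b) ≤ w.1.valuation (ϖ : F) ^ n)
    (h : GL2 w.Completion) :
    ∃ i j : ℤ, ∃ b ∈ B, ∃ κ ∈ integralGL2 w.integers.toSubring,
      h = toLocal w (upperMat (ϖ ^ i) (ϖ ^ j) b) * κ := by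
  obtain ⟨κ₀, hκ₀, h10⟩ := exists_mul_integral_lower_eq_zero h
  obtain ⟨g, hg⟩ : ∃ g, g = h * κ₀ := ⟨_, rfl⟩
  rw [← hg] at h10
  have hdet : g 0 0 * g 1 1 ≠ 0 := by
    have := g.det.ne_zero
    change g.val.det ≠ 0 at this
    rw [Matrix.det_fin_two, h10, mul_zero, sub_zero] at this
    exact this
  have ha := left_ne_zero_of_mul hdet
  have hd := right_ne_zero_of_mul hdet
  obtain ⟨i, hi⟩ := hϖ.exists_val_eq ha
  obtain ⟨j, hj⟩ := hϖ.exists_val_eq hd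
  set p : w.Completion := algebraMap F w.Completion ϖ with hp
  have hp0 : p ≠ 0 := by simp [hp]
  have hpv : ∀ n : ℤ, w.val (p ^ n) = w.1.valuation (ϖ : F) ^ n := fun n => by
    rw [map_zpow₀, val_algebraMap]
  have hpos := (w.valuation_pos ϖ).ne'
  -- After the diagonal has been normalised by units, the upper right entry only matters modulo the
  -- i-th power of the uniformizer, so it can be replaced by an element of `B`.
  obtain ⟨f, hf⟩ := w.exists_approx (g 0 1 / (g 1 1 * p ^ (-j)))
    (zpow_ne_zero i ϖ.ne_zero)
  obtain ⟨b, hb, hfb⟩ := hB f i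
  have happ : w.val (g 0 1 / (g 1 1 * p ^ (-j)) - algebraMap F w.Completion b)
      ≤ w.1.valuation (ϖ : F) ^ i := by
    rw [show g 0 1 / (g 1 1 * p ^ (-j)) - algebraMap F w.Completion b =
      (g 0 1 / (g 1 1 * p ^ (-j)) - algebraMap F w.Completion f)
        + algebraMap F w.Completion (f - b) by rw [map_sub]; ring]
    rw [map_zpow₀] at hf
    exact w.val.map_add_le hf ((w.val_algebraMap _).le.trans hfb)
  have hu : w.val (g 1 1 * p ^ (-j)) = 1 := by
    rw [map_mul, hj, hpv, ← zpow_add₀ hpos, add_neg_cancel, zpow_zero]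
  have hu' : w.val (g 0 0 * p ^ (-i)) = 1 := by
    rw [map_mul, hi, hpv, ← zpow_add₀ hpos, add_neg_cancel, zpow_zero]
  have hu0 : g 1 1 * p ^ (-j) ≠ 0 := mul_ne_zero hd (zpow_ne_zero _ hp0)
  refine ⟨i, j, b, hb, mat (g 0 0 * p ^ (-i)) (p ^ (-i) * (g 0 1 / (g 1 1 * p ^ (-j))
    - algebraMap F w.Completion b) * (g 1 1 * p ^ (-j))) 0 (g 1 1 * p ^ (-j)) ?_ * κ₀⁻¹,
    mul_mem (mem_integralGL2_integers.2 ⟨fun r s => ?_, ?_⟩) (inv_mem hκ₀), ?_⟩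
  · rw [mul_zero, sub_zero]
    exact mul_ne_zero (mul_ne_zero ha (zpow_ne_zero _ hp0)) hu0
  · have h1 : w.val (p ^ (-i) * (g 0 1 / (g 1 1 * p ^ (-j))
        - algebraMap F w.Completion b) * (g 1 1 * p ^ (-j))) ≤ 1 := by
      rw [map_mul, map_mul, hu, mul_one, hpv]
      refine (mul_le_mul_right happ _).trans ?_
      rw [← zpow_add₀ hpos, neg_add_cancel, zpow_zero]
    rw [val_mat]
    fin_cases r <;> fin_cases s
    · exact hu'.le
    · exact h1
    · simp
    · exact hu.le
  · rw [val_mat, Matrix.det_fin_two_of, mul_zero, sub_zero, map_mul, hu, hu', one_mul]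
  · rw [← mul_assoc, eq_mul_inv_iff_mul_eq, ← hg]
    ext r s
    have e : ∀ (u : Fˣ) (n : ℤ), algebraMap F w.Completion ((u ^ n : Fˣ) : F)
        = (algebraMap F w.Completion u) ^ n := fun u n => by
      rw [Units.val_zpow_eq_zpow_val, map_zpow₀]
    have e00 : toLocal w (upperMat (ϖ ^ i) (ϖ ^ j) b) 0 0 = p ^ i := e ϖ i
    have e01 : toLocal w (upperMat (ϖ ^ i) (ϖ ^ j) b) 0 1 = algebraMap F w.Completion b := rfl
    have e10 : toLocal w (upperMat (ϖ ^ i) (ϖ ^ j) b) 1 0 = 0 :=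
      map_zero (algebraMap F w.Completion)
    have e11 : toLocal w (upperMat (ϖ ^ i) (ϖ ^ j) b) 1 1 = p ^ j := e ϖ j
    have hi1 : p ^ i * p ^ (-i) = 1 := by rw [← zpow_add₀ hp0, add_neg_cancel, zpow_zero]
    have hj1 : p ^ j * p ^ (-j) = 1 := by rw [← zpow_add₀ hp0, add_neg_cancel, zpow_zero]
    have hdiv := div_mul_cancel₀ (g 0 1) hu0
    rw [Units.val_mul, Matrix.mul_apply, Fin.sum_univ_two, val_mat]
    fin_cases r <;> fin_cases s
    · simp only [Fin.zero_eta, e00, e01, Matrix.of_apply, Matrix.cons_val_zero,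
        Matrix.cons_val_one, Matrix.cons_val', Matrix.cons_val_fin_one]
      linear_combination (-g 0 0) * hi1
    · simp only [Fin.zero_eta, Fin.mk_one, e00, e01, Matrix.of_apply, Matrix.cons_val_zero,
        Matrix.cons_val_one, Matrix.cons_val', Matrix.cons_val_fin_one]
      linear_combination (-((g 0 1 / (g 1 1 * p ^ (-j))
        - algebraMap F w.Completion b) * (g 1 1 * p ^ (-j)))) * hi1 - hdiv
    · simp [e10, e11, h10]
    · simp only [Fin.mk_one, e10, e11, Matrix.of_apply, Matrix.cons_val_zero,
        Matrix.cons_val_one, Matrix.cons_val', Matrix.cons_val_fin_one]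
      linear_combination (-g 1 1) * hj1

end Place
end Toroidal
end

open scoped RestrictedProduct

noncomputable section

namespace Toroidal

/-! ### Vertices of the tree -/

theorem scalar_mem_center {R : Type*} [CommRing R] (u : Rˣ) :
    Matrix.GeneralLinearGroup.scalar (Fin 2) u ∈ Subgroup.center (GL2 R) := by
  rw [Matrix.GeneralLinearGroup.center_eq_range_scalar]
  exact ⟨u, rfl⟩

theorem scalar_mul_apply {R : Type*} [CommRing R] (u : Rˣ) (g : GL2 R) (i j : Fin 2) :
    (Matrix.GeneralLinearGroup.scalar (Fin 2) u * g) i j = u * g i j := by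
  rw [Units.val_mul]
  simp [Matrix.GeneralLinearGroup.scalar, Matrix.mul_apply, Fin.sum_univ_two, Matrix.scalar_apply]
  fin_cases i <;> simp

theorem det_scalar_mul {R : Type*} [CommRing R] (u : Rˣ) (g : GL2 R) :
    (Matrix.GeneralLinearGroup.scalar (Fin 2) u * g).val.det = u ^ 2 * g.val.det := by
  rw [Matrix.det_fin_two, Matrix.det_fin_two, scalar_mul_apply, scalar_mul_apply,
    scalar_mul_apply, scalar_mul_apply]
  ring

theorem scalar_mul_comm {R : Type*} [CommRing R] (u : Rˣ) (g : GL2 R) :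
    Matrix.GeneralLinearGroup.scalar (Fin 2) u * g =
      g * Matrix.GeneralLinearGroup.scalar (Fin 2) u :=
  (Subgroup.mem_center_iff.1 (scalar_mem_center u) g).symm

namespace Place.IsUniformizer

variable {F : Type*} [Field F] {v : Place F} {t : Fˣ} (ht : v.IsUniformizer t)

include ht in
-- Here `j` is the valuation of the central factor. Dividing by the j-th power of the uniformizer
-- leaves integral entries and a unit determinant.
theorem mem_sup_center_iff {h : GL2 v.Completion} :
    h ∈ integralGL2 v.integers.toSubring ⊔ Subgroup.center (GL2 v.Completion) ↔
      ∃ j : ℤ, (∀ r s, v.val (h r s) ≤ v.1.valuation (t : F) ^ j) ∧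
        v.val h.val.det = v.1.valuation (t : F) ^ (2 * j) := by
  have hpos := v.valuation_pos t
  rw [Subgroup.mem_sup_of_normal_right]
  constructor
  · rintro ⟨κ, hκ, z, hz, rfl⟩
    rw [Matrix.GeneralLinearGroup.center_eq_range_scalar] at hz
    obtain ⟨u, rfl⟩ := hz
    obtain ⟨j, hj⟩ := ht.exists_val_eq u.ne_zero
    obtain ⟨h1, h2⟩ := Place.mem_integralGL2_integers.1 hκ
    refine ⟨j, fun r s => ?_, ?_⟩
    · rw [← scalar_mul_comm, scalar_mul_apply, map_mul, hj]
      exact mul_le_of_le_one_right' (h1 r s)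
    · rw [← scalar_mul_comm, det_scalar_mul, map_mul, h2, map_pow, hj, mul_one, ← zpow_natCast,
        ← zpow_mul, mul_comm]
      rfl
  · rintro ⟨j, h1, h2⟩
    set u : v.Completionˣ := Units.map (algebraMap F v.Completion : F →* _) (t ^ (-j)) with hu
    have hu' : v.val (u : v.Completion) = v.1.valuation (t : F) ^ (-j) := by
      rw [hu, Units.coe_map, MonoidHom.coe_coe, Place.val_algebraMap,
        Units.val_zpow_eq_zpow_val, map_zpow₀]
    refine ⟨Matrix.GeneralLinearGroup.scalar (Fin 2) u * h,
      Place.mem_integralGL2_integers.2 ⟨fun r s => ?_, ?_⟩,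
      Matrix.GeneralLinearGroup.scalar (Fin 2) u⁻¹, scalar_mem_center _, ?_⟩
    · rw [scalar_mul_apply, map_mul, hu']
      refine (mul_le_mul_right (h1 r s) _).trans ?_
      rw [← zpow_add₀ hpos.ne', neg_add_cancel, zpow_zero]
    · rw [det_scalar_mul, map_mul, map_pow, hu', h2, ← zpow_natCast, ← zpow_mul,
        ← zpow_add₀ hpos.ne', show -j * ((2 : ℕ) : ℤ) + 2 * j = 0 by push_cast; ring, zpow_zero]
    · rw [← scalar_mul_comm, ← mul_assoc, ← map_mul, inv_mul_cancel, map_one, one_mul]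

include ht in
theorem mk_eq_mk_iff {g h : GL2 v.Completion} :
    (QuotientGroup.mk g : TreeVertex v) = QuotientGroup.mk h ↔
      ∃ j : ℤ, (∀ r s, v.val ((g⁻¹ * h) r s) ≤ v.1.valuation (t : F) ^ j) ∧
        v.val (g⁻¹ * h).val.det = v.1.valuation (t : F) ^ (2 * j) := by
  rw [QuotientGroup.eq, ht.mem_sup_center_iff]

include ht in
theorem vertex_eq_vertex_iff {g h : GL2 F} : vertex v g = vertex v h ↔
      ∃ j : ℤ, (∀ r s, v.1.valuation ((g⁻¹ * h) r s) ≤ v.1.valuation (t : F) ^ j) ∧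
        v.1.valuation (g⁻¹ * h).val.det = v.1.valuation (t : F) ^ (2 * j) := by
  rw [vertex, vertex, ht.mk_eq_mk_iff]
  simp only [← map_inv, ← map_mul, Place.toLocal_apply, Place.det_toLocal, Place.val_algebraMap]

theorem _root_.Toroidal.toLocal_smul_vertex (γ g : GL2 F) :
    toLocal v γ • vertex v g = vertex v (γ * g) := by
  rw [vertex, vertex, map_mul]
  rfl

theorem _root_.Toroidal.vertex_mul_scalar (g : GL2 F) (u : Fˣ) :
    vertex v (Matrix.GeneralLinearGroup.scalar (Fin 2) u * g) = vertex v g := by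
  rw [vertex, vertex, eq_comm, QuotientGroup.eq, ← map_inv, ← map_mul, scalar_mul_comm,
    inv_mul_cancel_left]
  refine Subgroup.mem_sup_right ?_
  exact Matrix.GeneralLinearGroup.map_center_le (algebraMap F v.Completion) (scalar_mem_center u)

theorem _root_.Toroidal.vertex_mul_integral (g : GL2 F) {κ : GL2 F}
    (hκ : κ ∈ integralGL2 v.1.toSubring) : vertex v (g * κ) = vertex v g := by
  rw [vertex, vertex, eq_comm, QuotientGroup.eq, ← map_inv, ← map_mul, inv_mul_cancel_left]
  exact Subgroup.mem_sup_left (Place.toLocal_mem_integralGL2_iff.2 hκ)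

theorem upperMat_eq_scalar_mul (a d : Fˣ) (b : F) : upperMat a d b =
    Matrix.GeneralLinearGroup.scalar (Fin 2) d * affineMat (a / d) (b / d) := by
  ext r s
  rw [scalar_mul_apply]
  have := d.ne_zero
  fin_cases r <;> fin_cases s <;> simp [upperMat, affineMat] <;> field_simp

include ht in
/-- Every vertex is represented by an affine matrix over `F`. -/
theorem exists_eq_vertex (x : TreeVertex v) :
    ∃ (n : ℤ) (b : F), x = vertex v (affineMat (t ^ n) b) := by
  obtain ⟨h, rfl⟩ := QuotientGroup.mk_surjective x
  obtain ⟨i, j, b, -, κ, hκ, rfl⟩ := ht.exists_upperMat_mul (B := Set.univ)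
    (fun f n => ⟨f, Set.mem_univ _, by simp⟩) h
  refine ⟨i - j, b / (t ^ j : Fˣ), ?_⟩
  have h1 : (QuotientGroup.mk (toLocal v (upperMat (t ^ i) (t ^ j) b) * κ) : TreeVertex v)
      = vertex v (upperMat (t ^ i) (t ^ j) b) := by
    rw [vertex, eq_comm, QuotientGroup.eq, inv_mul_cancel_left]
    exact Subgroup.mem_sup_left hκ
  rw [h1, upperMat_eq_scalar_mul, vertex_mul_scalar, zpow_sub]
  rfl

/-- The entries of the matrix that compares the images of two affine matrices. -/
theorem affineMat_inv_mul_mul (a a' : Fˣ) (β β' : F) (γ : GL2 F) :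
    ((affineMat a' β')⁻¹ * (γ * affineMat a β)).val =
      !![(a / a' : F) * (γ 0 0 - β' * γ 1 0),
        ((γ 0 0 * β + γ 0 1) - β' * (γ 1 0 * β + γ 1 1)) / a';
        a * γ 1 0, γ 1 0 * β + γ 1 1] := by
  have h1 : ((affineMat a' β')⁻¹ : GL2 F).val = !![(a' : F)⁻¹, -(a' : F)⁻¹ * β'; 0, 1] := by
    rw [← Units.val_inv_eq_inv_val a']
    rfl
  have h2 : (affineMat a β).val = !![(a : F), β; 0, 1] := rfl
  rw [Units.val_mul, Units.val_mul, h1, h2]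
  have := a'.ne_zero
  ext r s
  fin_cases r <;> fin_cases s <;> simp [Matrix.mul_apply, Fin.sum_univ_two] <;> field_simp <;> ring

include ht in
-- These are the four entries and the determinant of the matrix that compares the two lattices, up
-- to a scalar of valuation `j`. Vertex computations become estimates of pole orders in this way.
theorem smul_vertex_eq_vertex_iff (γ : GL2 F) (n m : ℤ) (β β' : F) :
    toLocal v γ • vertex v (affineMat (t ^ n) β) = vertex v (affineMat (t ^ m) β') ↔
      ∃ j : ℤ, v.1.valuation γ.val.det * v.1.valuation (t : F) ^ n =
          v.1.valuation (t : F) ^ (m + 2 * j) ∧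
        v.1.valuation (γ 0 0 - β' * γ 1 0) ≤ v.1.valuation (t : F) ^ (m - n + j) ∧
        v.1.valuation ((γ 0 0 * β + γ 0 1) - β' * (γ 1 0 * β + γ 1 1)) ≤
          v.1.valuation (t : F) ^ (m + j) ∧
        v.1.valuation (γ 1 0) ≤ v.1.valuation (t : F) ^ (j - n) ∧
        v.1.valuation (γ 1 0 * β + γ 1 1) ≤ v.1.valuation (t : F) ^ j := by
  have hpos := v.valuation_pos t
  have hdet : ((affineMat (t ^ m) β')⁻¹ * (γ * affineMat (t ^ n) β)).val.det
      = (t : F) ^ (-m) * γ.val.det * (t : F) ^ n := by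
    rw [affineMat_inv_mul_mul, Matrix.det_fin_two_of, Matrix.det_fin_two]
    have := t.ne_zero
    rw [Units.val_zpow_eq_zpow_val, Units.val_zpow_eq_zpow_val, zpow_neg]
    field_simp
    ring
  rw [toLocal_smul_vertex, eq_comm, ht.vertex_eq_vertex_iff]
  refine exists_congr fun j => ?_
  rw [hdet, affineMat_inv_mul_mul]
  have key : ∀ (f : F) (i l : ℤ), v.1.valuation (t : F) ^ i * v.1.valuation f ≤
      v.1.valuation (t : F) ^ (i + l) ↔ v.1.valuation f ≤ v.1.valuation (t : F) ^ l := by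
    intro f i l
    rw [zpow_add₀ hpos.ne', mul_le_mul_iff_right₀ (zpow_pos hpos i)]
  have e1 : v.1.valuation ((t : F) ^ (-m) * γ.val.det * (t : F) ^ n) =
      v.1.valuation (t : F) ^ (2 * j) ↔ v.1.valuation γ.val.det * v.1.valuation (t : F) ^ n =
          v.1.valuation (t : F) ^ (m + 2 * j) := by
    rw [map_mul, map_mul, map_zpow₀, map_zpow₀, zpow_add₀ hpos.ne', mul_assoc, zpow_neg,
      inv_mul_eq_iff_eq_mul₀ (zpow_ne_zero _ hpos.ne')]
  rw [e1, and_comm]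
  refine and_congr_right fun _ => ?_
  simp only [Fin.forall_fin_two, Matrix.of_apply, Matrix.cons_val_zero, Matrix.cons_val_one,
    Matrix.cons_val', Matrix.cons_val_fin_one, map_mul, map_div₀, Units.val_zpow_eq_zpow_val,
    map_zpow₀]
  rw [← zpow_sub₀ hpos.ne', div_eq_inv_mul, ← zpow_neg]
  rw [← key _ (n - m) (m - n + j), ← key _ (-m) (m + j), ← key _ n (j - n)]
  rw [show n - m + (m - n + j) = j by ring, show -m + (m + j) = j by ring,
    show n + (j - n) = j by ring]
  tauto

end Place.IsUniformizer

end Toroidal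
end

open scoped RestrictedProduct

noncomputable section

namespace Toroidal

/-! ### The Hecke operator -/

namespace Place.IsUniformizer

variable {F : Type*} [Field F] {v : Place F} {t : Fˣ} (ht : v.IsUniformizer t)

theorem val_mul_le {g h : GL2 v.Completion} {a b : v.1.ValueGroup}
    (hg : ∀ r s, v.val (g r s) ≤ a) (hh : ∀ r s, v.val (h r s) ≤ b) (r s : Fin 2) :
    v.val ((g * h) r s) ≤ a * b := by
  rw [Units.val_mul, Matrix.mul_apply, Fin.sum_univ_two]
  refine v.val.map_add_le ?_ ?_ <;> rw [map_mul] <;> exact mul_le_mul' (hg _ _) (hh _ _)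

include ht in
theorem vertex_affineMat_eq {n : ℤ} {β β' : F}
    (h : v.1.valuation (β - β') ≤ v.1.valuation (t : F) ^ n) :
    vertex v (affineMat (t ^ n) β) = vertex v (affineMat (t ^ n) β') := by
  have := (ht.smul_vertex_eq_vertex_iff 1 n n β β').2 ⟨0, by simp, by simp, by simpa using h,
    by simp, by simp⟩
  rwa [map_one, one_smul] at this

variable {k : Type*} [Field k] [Fintype k] [Algebra k F]
  (hk : ∀ f, v.1.valuation f ≤ 1 → ∃ c : k, v.1.valuation (f - algebraMap k F c) < 1)

variable (v t k) in
/-- Representatives of the neighbours of the base point of the tree. -/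
def _root_.Toroidal.neighbour : Option k → GL2 F
  | none => affineMat t⁻¹ 0
  | some c => affineMat t (algebraMap k F c)

include ht in
theorem le_of_lt_one {f : F} (h : v.1.valuation f < 1) : v.1.valuation f ≤ v.1.valuation (t : F) := by
  by_cases hf : f = 0
  · simp [hf]
  obtain ⟨n, hn⟩ := ht.exists_zpow f hf
  rw [hn, ← zpow_zero (v.1.valuation (t : F)), ht.zpow_lt_iff] at h
  rw [hn, ← zpow_one (v.1.valuation (t : F)), ← zpow_mul, one_mul, ht.zpow_le_iff]
  omega

omit [Fintype k] in
include ht hk in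
-- In triangular form both diagonal exponents are at least j and their sum is 2j + 1. One
-- distribution gives the neighbour `none`; the other leaves the upper right entry free modulo the
-- uniformizer, that is, a constant.
theorem exists_eq_neighbour {h : GL2 v.Completion} {j : ℤ}
    (h1 : ∀ r s, v.val (h r s) ≤ v.1.valuation (t : F) ^ j)
    (h2 : v.val h.val.det = v.1.valuation (t : F) ^ (2 * j + 1)) :
    ∃ o : Option k, (QuotientGroup.mk h : TreeVertex v) = vertex v (neighbour t k o) := by
  have hpos := v.valuation_pos t
  obtain ⟨i, l, b, -, κ, hκ, rfl⟩ := ht.exists_upperMat_mul (B := Set.univ)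
    (fun f n => ⟨f, Set.mem_univ _, by simp⟩) h
  set U := upperMat (t ^ i) (t ^ l) b with hU
  have hv : (QuotientGroup.mk (toLocal v U * κ) : TreeVertex v) = vertex v U := by
    rw [vertex, eq_comm, QuotientGroup.eq, inv_mul_cancel_left]
    exact Subgroup.mem_sup_left hκ
  rw [hv]
  have hκ' := Place.mem_integralGL2_integers.1 (inv_mem hκ)
  have h3 : ∀ r s, v.1.valuation (U r s) ≤ v.1.valuation (t : F) ^ j := by
    intro r s
    have := val_mul_le h1 hκ'.1 r s
    rwa [mul_inv_cancel_right, mul_one, Place.toLocal_apply, Place.val_algebraMap] at this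
  have h4 : v.1.valuation (t : F) ^ (i + l) = v.1.valuation (t : F) ^ (2 * j + 1) := by
    have h5 : U.val.det = (t : F) ^ i * (t : F) ^ l := by
      rw [Matrix.det_fin_two]
      simp [hU, upperMat, Units.val_zpow_eq_zpow_val]
    rw [← h2, Units.val_mul, Matrix.det_mul, map_mul, (Place.mem_integralGL2_integers.1 hκ).2,
      mul_one, Place.det_toLocal, Place.val_algebraMap, h5, map_mul, map_zpow₀, map_zpow₀,
      zpow_add₀ hpos.ne']
  rw [ht.zpow_inj] at h4
  have hi : j ≤ i := by
    have := h3 0 0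
    rw [show U 0 0 = (t : F) ^ i from Units.val_zpow_eq_zpow_val t i, map_zpow₀,
      ht.zpow_le_iff] at this
    exact this
  have hl : j ≤ l := by
    have := h3 1 1
    rw [show U 1 1 = (t : F) ^ l from Units.val_zpow_eq_zpow_val t l, map_zpow₀,
      ht.zpow_le_iff] at this
    exact this
  have hb : v.1.valuation b ≤ v.1.valuation (t : F) ^ j := h3 0 1
  rw [hU, upperMat_eq_scalar_mul, vertex_mul_scalar, div_eq_mul_inv (t ^ i),
    ← zpow_sub]
  have hq : v.1.valuation (b / (t ^ l : Fˣ)) ≤ v.1.valuation (t : F) ^ (j - l) := by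
    rw [map_div₀, Units.val_zpow_eq_zpow_val, map_zpow₀, zpow_sub₀ hpos.ne']
    exact div_le_div_of_nonneg_right hb (zpow_pos hpos _).le
  rcases hi.eq_or_lt with rfl | hi
  · refine ⟨none, ?_⟩
    obtain rfl : l = j + 1 := by omega
    rw [show j - (j + 1) = -1 by ring] at *
    rw [ht.vertex_affineMat_eq (β' := 0) (by simpa using hq), neighbour, zpow_neg_one]
  · obtain rfl : l = j := by omega
    obtain rfl : i = l + 1 := by omega
    rw [sub_self, zpow_zero] at hq
    obtain ⟨c, hc⟩ := hk _ hq
    refine ⟨some c, ?_⟩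
    rw [show l + 1 - l = 1 by ring,
      ht.vertex_affineMat_eq (by rw [zpow_one]; exact ht.le_of_lt_one hc), neighbour, zpow_one]

theorem toLocal_affineMat (a : Fˣ) (b : F) : toLocal v (affineMat a b) =
    affineMat (Units.map (algebraMap F v.Completion : F →* _) a) (algebraMap F v.Completion b) := by
  ext r s
  rw [Place.toLocal_apply]
  fin_cases r <;> fin_cases s <;> simp [affineMat]

theorem det_affineMat {R : Type*} [CommRing R] (a : Rˣ) (b : R) :
    (affineMat a b).val.det = a := by
  rw [Matrix.det_fin_two]
  simp [affineMat]

include ht in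
theorem affineMat_bound (n : ℤ) {m : ℤ} (hm : m ≤ n) (hm' : m ≤ 0) {b : v.Completion}
    (hb : v.val b ≤ v.1.valuation (t : F) ^ m) (r s : Fin 2) :
    v.val (affineMat (Units.map (algebraMap F v.Completion : F →* _) (t ^ n)) b r s)
      ≤ v.1.valuation (t : F) ^ m := by
  have h1 : (1 : v.1.ValueGroup) ≤ v.1.valuation (t : F) ^ m := by
    rw [← zpow_zero (v.1.valuation (t : F)), ht.zpow_le_iff]
    exact hm'
  fin_cases r <;> fin_cases s
  · change v.val (algebraMap F v.Completion ((t ^ n : Fˣ) : F)) ≤ _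
    rw [Place.val_algebraMap, Units.val_zpow_eq_zpow_val, map_zpow₀, ht.zpow_le_iff]
    exact hm
  · exact hb
  · simp [affineMat]
  · simpa [affineMat] using h1

include ht hk in
/-- The neighbours of a vertex. -/
theorem treeAdj_iff (g : GL2 v.Completion) (y : TreeVertex v) :
    TreeAdj v t (QuotientGroup.mk g) y ↔
      ∃ o : Option k, QuotientGroup.mk (g * toLocal v (neighbour t k o)) = y := by
  have hpos := v.valuation_pos t
  constructor
  · rintro ⟨g₁, g₂, h₁, rfl, h⟩
    obtain ⟨s, hs, rfl⟩ : ∃ s ∈ integralGL2 v.integers.toSubring ⊔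
        Subgroup.center (GL2 v.Completion), g₁ = g * s :=
      ⟨g⁻¹ * g₁, QuotientGroup.eq.1 h₁.symm, by simp⟩
    obtain ⟨i, hs1, hs2⟩ := ht.mem_sup_center_iff.1 hs
    -- Both kinds of neighbours satisfy the same conditions on entries and determinant, and these
    -- survive left multiplication by an element of `K_v Z_v`. So the choice of `g₁` within its
    -- class does not matter.
    obtain ⟨h, hh, j, hj1, hj2⟩ : ∃ h : GL2 v.Completion,
        (QuotientGroup.mk ((g * s)⁻¹ * g₂) : TreeVertex v) = QuotientGroup.mk h ∧ ∃ j : ℤ,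
        (∀ r s, v.val (h r s) ≤ v.1.valuation (t : F) ^ j) ∧
        v.val h.val.det = v.1.valuation (t : F) ^ (2 * j + 1) := by
      rcases h with ⟨b, hb, h⟩ | h
      · refine ⟨_, h, 0, ?_, ?_⟩
        · simpa using ht.affineMat_bound 1 (m := 0) (by norm_num) le_rfl
            (by simpa using (Place.mem_integers v).1 hb)
        · rw [det_affineMat]
          simp [Place.val_algebraMap]
      · refine ⟨_, h, -1, ?_, ?_⟩
        · rw [toLocal_affineMat]
          simpa using ht.affineMat_bound (-1) (m := -1) le_rfl (by norm_num) (b := 0) (by simp)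
        · rw [toLocal_affineMat, det_affineMat]
          simp [Place.val_algebraMap]
    obtain ⟨o, ho⟩ := ht.exists_eq_neighbour hk (h := s * h) (j := i + j)
      (fun r s => by
        rw [zpow_add₀ hpos.ne']
        exact val_mul_le hs1 hj1 r s)
      (by
        rw [Units.val_mul, Matrix.det_mul, map_mul, hs2, hj2, ← zpow_add₀ hpos.ne']
        congr 1
        ring)
    refine ⟨o, ?_⟩
    have e1 : (QuotientGroup.mk g₂ : TreeVertex v) = (g * s) • QuotientGroup.mk ((g * s)⁻¹ * g₂) := by
      change _ = (QuotientGroup.mk ((g * s) * ((g * s)⁻¹ * g₂)) : TreeVertex v)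
      rw [mul_inv_cancel_left]
    have e2 : (QuotientGroup.mk (g * toLocal v (neighbour t k o)) : TreeVertex v)
      = g • vertex v (neighbour t k o) := rfl
    rw [e1, e2, ← ho, hh, mul_smul]
    rfl
  · rintro ⟨o, rfl⟩
    refine ⟨g, _, rfl, rfl, ?_⟩
    rw [inv_mul_cancel_left]
    cases o with
    | none => exact Or.inr rfl
    | some c =>
      refine Or.inl ⟨algebraMap F v.Completion (algebraMap k F c), ?_, ?_⟩
      · rw [Place.algebraMap_mem_integers]
        exact algebraMap_mem _ c
      · rw [neighbour, toLocal_affineMat]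

include ht in
theorem neighbour_injective :
    Function.Injective fun o : Option k => vertex v (neighbour t k o) := by
  have key : ∀ c d : k, vertex v (neighbour t k (some c)) = vertex v (neighbour t k (some d)) →
      c = d := by
    intro c d h
    have h' := (ht.smul_vertex_eq_vertex_iff 1 1 1 (algebraMap k F c) (algebraMap k F d)).1
      (by rw [map_one, one_smul, zpow_one]; exact h)
    obtain ⟨j, h1, -, h2, -⟩ := h'
    simp only [Units.val_one, Matrix.det_one, map_one, one_mul, ht.zpow_inj] at h1
    obtain rfl : j = 0 := by omega
    simp only [Units.val_one, Matrix.one_apply_eq, one_mul, ne_eq, zero_ne_one, not_false_eq_true,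
      Matrix.one_apply_ne, add_zero, one_ne_zero, zero_mul, zero_add, mul_one, zpow_one,
      ← map_sub] at h2
    by_contra hcd
    rw [valuation_algebraMap v.1 (sub_ne_zero.2 hcd)] at h2
    exact absurd h2 (not_le.2 ht.lt_one)
  have key' : ∀ c : k, vertex v (neighbour t k (some c)) ≠ vertex v (neighbour t k none) := by
    intro c h
    have h' := (ht.smul_vertex_eq_vertex_iff 1 1 (-1) (algebraMap k F c) 0).1
      (by rw [map_one, one_smul, zpow_one, zpow_neg_one]; exact h)
    obtain ⟨j, h1, -, -, -, h2⟩ := h'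
    simp only [Units.val_one, Matrix.det_one, map_one, one_mul, ht.zpow_inj] at h1
    obtain rfl : j = 1 := by omega
    simp only [Units.val_one, ne_eq, one_ne_zero, not_false_eq_true, Matrix.one_apply_ne, zero_mul,
      Matrix.one_apply_eq, zero_add, map_one, zpow_one] at h2
    exact absurd h2 (not_le.2 ht.lt_one)
  rintro (_ | c) (_ | d) h
  · rfl
  · exact absurd h.symm (key' d)
  · exact absurd h (key' c)
  · rw [key c d h]

include ht hk in
/-- The Hecke operator as a sum over representatives. -/
theorem heckeOp_mk (φ : TreeVertex v → ℂ) (g : GL2 v.Completion) :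
    heckeOp v t φ (QuotientGroup.mk g) =
      φ (QuotientGroup.mk (g * toLocal v (affineMat t⁻¹ 0))) +
      ∑ c : k, φ (QuotientGroup.mk (g * toLocal v (affineMat t (algebraMap k F c)))) := by
  set e : Option k → TreeVertex v := fun o => QuotientGroup.mk (g * toLocal v (neighbour t k o))
    with he
  have hinj : Function.Injective e := fun o o' h =>
    ht.neighbour_injective ((MulAction.injective g) h)
  have hset : {y | TreeAdj v t (QuotientGroup.mk g) y} = Set.range e := by
    ext y
    exact ht.treeAdj_iff hk g y
  have h1 : heckeOp v t φ (QuotientGroup.mk g) = ∑ᶠ y ∈ Set.range e, φ y := by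
    rw [← hset]
    rfl
  rw [h1, finsum_mem_range hinj, finsum_eq_sum_of_fintype, Fintype.sum_option]
  rfl

end Place.IsUniformizer

end Toroidal
end

open scoped RestrictedProduct

noncomputable section

namespace Toroidal

/-! ### The quotient graph -/

namespace PointlessCurve

variable {k F : Type*} [Field k] [Fintype k] [Field F] [Algebra k F] (C : PointlessCurve k F)
  {v : Place F} (hv : C.x ∉ v.1)

omit [Fintype k] in
theorem x_eq : C.x = C.t * C.y := C.t_mul_y.symm

omit [Fintype k] in
theorem inv_t_mul_x : (C.t : F)⁻¹ * C.x = C.y := by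
  have := C.t.ne_zero
  rw [x_eq, inv_mul_cancel_left₀ this]

include hv in
theorem one_le_zpow {n : ℤ} (hn : n ≤ 0) : 1 ≤ v.1.valuation (C.t : F) ^ n := by
  rw [← zpow_zero (v.1.valuation (C.t : F))]
  exact (C.zpow_t_le_iff hv).2 hn

include hv in
theorem valuation_const_le (c : k) {n : ℤ} (hn : n ≤ 0) :
    v.1.valuation (algebraMap k F c) ≤ v.1.valuation (C.t : F) ^ n :=
  (valuation_algebraMap_le v.1 c).trans (C.one_le_zpow hv hn)

theorem valuation_const_mul_le (c : k) {f : F} {g : v.1.ValueGroup} (h : v.1.valuation f ≤ g) :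
    v.1.valuation (algebraMap k F c * f) ≤ g := by
  rw [map_mul]
  exact (mul_le_of_le_one_left' (valuation_algebraMap_le v.1 c)).trans h

theorem eq_zero_of_const_lt_one {c : k} (h : v.1.valuation (algebraMap k F c) < 1) : c = 0 := by
  by_contra hc
  exact absurd (valuation_algebraMap v.1 hc) h.ne

include hv in
/-- There is no function in `A` with a simple pole. -/
theorem eq_zero_of_add_inv_t {g : F} (hg : g ∈ C.A) {e : k}
    (h : v.1.valuation (g + algebraMap k F e * (C.t : F)⁻¹) ≤ 1) :
    e = 0 ∧ ∃ c : k, g = algebraMap k F c := by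
  have ht1 : v.1.valuation (C.t : F)⁻¹ = v.1.valuation (C.t : F) ^ (-1 : ℤ) := by simp
  have h1 : v.1.valuation g ≤ v.1.valuation (C.t : F) ^ (-1 : ℤ) := by
    rw [show g = (g + algebraMap k F e * (C.t : F)⁻¹) - algebraMap k F e * (C.t : F)⁻¹ by ring]
    exact v.1.valuation.map_sub_le (h.trans (C.one_le_zpow hv (by norm_num)))
      (valuation_const_mul_le e ht1.le)
  obtain ⟨c, rfl⟩ := C.eq_const_of_mem hv hg h1
  refine ⟨?_, c, rfl⟩
  have h2 : v.1.valuation (algebraMap k F e * (C.t : F)⁻¹) ≤ 1 := by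
    rw [show algebraMap k F e * (C.t : F)⁻¹ = (algebraMap k F c + algebraMap k F e * (C.t : F)⁻¹)
      - algebraMap k F c by ring]
    exact v.1.valuation.map_sub_le h (valuation_algebraMap_le v.1 c)
  by_contra he
  rw [map_mul, valuation_algebraMap v.1 he, one_mul, ht1, ← zpow_zero (v.1.valuation (C.t : F)), C.zpow_t_le_iff hv] at h2
  omega

include hv in
-- The functions with at most a double pole at infinity are spanned by 1 and x, because a simple
-- pole is impossible.
theorem eq_linear_of_mem {g : F} (hg : g ∈ C.A) (h : v.1.valuation g ≤ v.1.valuation (C.t : F) ^ (-2 : ℤ)) :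
    ∃ c₁ c₀ : k, g = algebraMap k F c₁ * C.x + algebraMap k F c₀ := by
  have hc : ∃ c : k, v.1.valuation (g - algebraMap k F c * C.x) < v.1.valuation (C.t : F) ^ (-2 : ℤ) := by
    rcases h.lt_or_eq with h | h
    · exact ⟨0, by simpa using h⟩
    · rw [← C.valuation_x hv] at h ⊢
      exact C.exists_const_mul hv C.x_ne_zero h
  obtain ⟨c, hc⟩ := hc
  have hA : g - algebraMap k F c * C.x ∈ C.A := sub_mem hg (mul_mem (C.A.algebraMap_mem c) C.x_mem)
  have h1 : v.1.valuation (g - algebraMap k F c * C.x) ≤ v.1.valuation (C.t : F) ^ (-1 : ℤ) := by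
    by_cases h0 : g - algebraMap k F c * C.x = 0
    · simp [h0]
    obtain ⟨n, hn⟩ := C.exists_valuation_eq hv h0
    rw [hn, C.zpow_t_lt_iff hv] at hc
    rw [hn, C.zpow_t_le_iff hv]
    omega
  obtain ⟨d, hd⟩ := C.eq_const_of_mem hv hA h1
  exact ⟨c, d, by rw [← hd]; ring⟩

include hv in
/-- The expansion of `x` in terms of `t` begins with `t⁻²`. -/
theorem valuation_t_sq_mul_x_sub_one :
    v.1.valuation ((C.t : F) ^ 2 * C.x - 1) ≤ v.1.valuation (C.t : F) ^ (3 : ℤ) := by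
  have hpos := C.valuation_t_pos v.1
  have hy0 := C.y_ne_zero
  -- Since t²x = x³/y², this is the equation of the curve divided by y². The term a₃/y, of order t³,
  -- bounds the error.
  have e : (C.t : F) ^ 2 * C.x - 1 = (algebraMap k F C.a₃ * C.y - algebraMap k F C.a₄ * C.x
      - algebraMap k F C.a₆) / C.y ^ 2 := by
    rw [coe_t]
    field_simp
    linear_combination -C.equation
  rw [e, map_div₀, map_pow, C.valuation_y hv, div_le_iff₀ (pow_pos (zpow_pos hpos _) _),
    ← zpow_natCast, ← zpow_mul, ← zpow_add₀ hpos.ne',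
    show (3 : ℤ) + -3 * ((2 : ℕ) : ℤ) = -3 by norm_num]
  refine v.1.valuation.map_sub_le (v.1.valuation.map_sub_le ?_ ?_) ?_
  · exact valuation_const_mul_le _ (C.valuation_y hv).le
  · refine valuation_const_mul_le _ ((C.valuation_x hv).le.trans ?_)
    exact (C.zpow_t_le_iff hv).2 (by norm_num)
  · exact C.valuation_const_le hv _ (by norm_num)

/-- The parameter of the vertex `t_l`. -/
def tParam (l : k) : F := (C.t : F)⁻¹ + algebraMap k F l * C.t

include hv in
-- Use t⁻¹x = y and tx = t⁻¹ + O(t²). The term in t⁻¹ cannot come from `A`, so in the applications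
-- its coefficient must vanish.
theorem valuation_tParam_mul_sub (l c₁ c₀ : k) : v.1.valuation
    ((algebraMap k F c₁ * C.x + algebraMap k F c₀) * C.tParam l
      - (algebraMap k F c₁ * C.y + algebraMap k F (c₁ * l + c₀) * (C.t : F)⁻¹)) ≤ v.1.valuation (C.t : F) := by
  have hpos := C.valuation_t_pos v.1
  have ht := C.t.ne_zero
  have e : (algebraMap k F c₁ * C.x + algebraMap k F c₀) * C.tParam l
      - (algebraMap k F c₁ * C.y + algebraMap k F (c₁ * l + c₀) * (C.t : F)⁻¹)
      = algebraMap k F (c₁ * l) * ((C.t : F)⁻¹ * ((C.t : F) ^ 2 * C.x - 1))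
        + algebraMap k F (c₀ * l) * C.t := by
    rw [tParam, ← C.inv_t_mul_x]
    simp only [map_add, map_mul]
    field_simp
    ring
  rw [e]
  refine v.1.valuation.map_add_le (valuation_const_mul_le _ ?_) (valuation_const_mul_le _ le_rfl)
  rw [map_mul]
  calc _ ≤ v.1.valuation (C.t : F)⁻¹ * v.1.valuation (C.t : F) ^ (3 : ℤ) :=
        mul_le_mul_right (C.valuation_t_sq_mul_x_sub_one hv) _
    _ = v.1.valuation (C.t : F) ^ (2 : ℤ) := by
        rw [map_inv₀, ← zpow_neg_one, ← zpow_add₀ hpos.ne']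
        norm_num
    _ ≤ v.1.valuation (C.t : F) ^ (1 : ℤ) := (C.zpow_t_le_iff hv).2 (by norm_num)
    _ = v.1.valuation (C.t : F) := zpow_one _

/-- The conditions for a matrix to be a homomorphism from the bundle with parameters `n, β` to the
bundle with parameters `n, β'`. -/
structure IsHom (v : Place F) (n : ℤ) (β β' a b c d : F) : Prop where
  mem_a : a ∈ C.A
  mem_b : b ∈ C.A
  mem_c : c ∈ C.A
  mem_d : d ∈ C.A
  le_a : v.1.valuation (a - β' * c) ≤ 1
  le_b : v.1.valuation ((a * β + b) - β' * (c * β + d)) ≤ v.1.valuation (C.t : F) ^ n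
  le_c : v.1.valuation c ≤ v.1.valuation (C.t : F) ^ (-n)
  le_d : v.1.valuation (c * β + d) ≤ 1

variable {C}

include hv in
/-- Upper triangular homomorphisms between the bundles with parameters `t_l`. -/
theorem IsHom.eq_scalar {l l' : k} {a b c d : F}
    (h : C.IsHom v 2 (C.tParam l) (C.tParam l') a b c d) {c₀ : k} (hc : c = algebraMap k F c₀) :
    c = 0 ∧ b = 0 ∧ ∃ e : k, a = algebraMap k F e ∧ d = algebraMap k F e ∧ e * (l - l') = 0 := by
  have hpos := C.valuation_t_pos v.1
  have h1 := C.valuation_tParam_mul_sub hv l 0 c₀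
  simp only [map_zero, zero_mul, zero_add] at h1
  have hlt : ∀ {f : F}, v.1.valuation f ≤ v.1.valuation (C.t : F) → v.1.valuation f ≤ 1 :=
    fun h => h.trans (C.valuation_t_lt_one hv).le
  -- The bottom right condition shows a possible simple pole with coefficient c₀, which must be
  -- absent.
  have h2 : v.1.valuation (d + algebraMap k F c₀ * (C.t : F)⁻¹) ≤ 1 := by
    rw [show d + algebraMap k F c₀ * (C.t : F)⁻¹ = (c * C.tParam l + d)
      - (algebraMap k F c₀ * C.tParam l - algebraMap k F c₀ * (C.t : F)⁻¹) by rw [hc]; ring]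
    exact v.1.valuation.map_sub_le h.le_d (hlt h1)
  obtain ⟨rfl, d₀, hd⟩ := C.eq_zero_of_add_inv_t hv h.mem_d h2
  rw [map_zero] at hc
  have h3 := h.le_a
  rw [hc, mul_zero, sub_zero] at h3
  obtain ⟨-, a₀, ha⟩ := C.eq_zero_of_add_inv_t hv h.mem_a (e := 0) (by simpa using h3)
  have h4 := h.le_b
  -- With constants on the diagonal the remaining condition holds modulo t². The coefficient of t⁻¹
  -- makes the diagonal scalar, the constant term makes b zero, and the coefficient of t compares l
  -- with l'.
  have e4 : (a * C.tParam l + b) - C.tParam l' * (c * C.tParam l + d)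
      = (b + algebraMap k F (a₀ - d₀) * (C.t : F)⁻¹)
        + algebraMap k F (a₀ * l - d₀ * l') * C.t := by
    rw [hc, ha, hd, tParam, tParam]
    simp only [map_sub, map_mul]
    ring
  rw [e4] at h4
  have hτ2 : v.1.valuation (C.t : F) ^ (2 : ℤ) < v.1.valuation (C.t : F) := by
    nth_rw 2 [← zpow_one (v.1.valuation (C.t : F))]
    exact (C.zpow_t_lt_iff hv).2 (by norm_num)
  have h5 : v.1.valuation (b + algebraMap k F (a₀ - d₀) * (C.t : F)⁻¹) ≤ v.1.valuation (C.t : F) := by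
    have := v.1.valuation.map_sub_le (h4.trans hτ2.le)
      (valuation_const_mul_le (a₀ * l - d₀ * l') (le_refl (v.1.valuation (C.t : F))))
    simpa using this
  obtain ⟨h6, b₀, hb⟩ := C.eq_zero_of_add_inv_t hv h.mem_b (hlt h5)
  rw [h6, map_zero, zero_mul, add_zero, hb] at h5
  obtain rfl := eq_zero_of_const_lt_one (h5.trans_lt (C.valuation_t_lt_one hv))
  rw [map_zero] at hb
  obtain rfl := sub_eq_zero.1 h6
  rw [hb, h6, map_zero, zero_mul, add_zero, zero_add, ← mul_sub, map_mul] at h4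
  refine ⟨hc, hb, a₀, ha, hd, ?_⟩
  by_contra h0
  rw [valuation_algebraMap v.1 h0, one_mul] at h4
  exact absurd h4 (not_le.2 hτ2)

include hv in
-- The lower left entry has at most a double pole, and no simple pole may survive in either diagonal
-- condition. This gives one linear equation for each parameter.
theorem IsHom.eq_linear {l l' : k} {a b c d : F}
    (h : C.IsHom v 2 (C.tParam l) (C.tParam l') a b c d) :
    ∃ c₁ c₀ : k, c = algebraMap k F c₁ * C.x + algebraMap k F c₀ ∧
      c₁ * l + c₀ = 0 ∧ c₁ * l' + c₀ = 0 := by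
  have hlt : ∀ {f : F}, v.1.valuation f ≤ v.1.valuation (C.t : F) → v.1.valuation f ≤ 1 :=
    fun h => h.trans (C.valuation_t_lt_one hv).le
  obtain ⟨c₁, c₀, hc⟩ := C.eq_linear_of_mem hv h.mem_c h.le_c
  refine ⟨c₁, c₀, hc, ?_, ?_⟩
  · have h1 := C.valuation_tParam_mul_sub hv l c₁ c₀
    have h2 := v.1.valuation.map_sub_le h.le_d (hlt h1)
    rw [hc] at h2
    refine (C.eq_zero_of_add_inv_t hv (g := d + algebraMap k F c₁ * C.y)
      (add_mem h.mem_d (mul_mem (C.A.algebraMap_mem _) C.y_mem)) ?_).1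
    convert h2 using 2
    ring
  · have h1 := C.valuation_tParam_mul_sub hv l' c₁ c₀
    have h2 := v.1.valuation.map_add_le h.le_a (hlt h1)
    rw [hc, ← Valuation.map_neg] at h2
    refine (C.eq_zero_of_add_inv_t hv (g := algebraMap k F c₁ * C.y - a)
      (sub_mem (mul_mem (C.A.algebraMap_mem _) C.y_mem) h.mem_a) ?_).1
    convert h2 using 2
    ring

end PointlessCurve
end Toroidal
end

open scoped RestrictedProduct

noncomputable section

namespace Toroidal

/-! ### Explicit representatives for the vertices of `Γ \ 𝒯` -/

/-- Vertices of the tree with the same image in the quotient by `Γ`. -/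
def GammaRel {F : Type*} [Field F] (v : Place F) (x y : TreeVertex v) : Prop :=
  ∃ γ ∈ integralGL2 (holomorphicOutside v), toLocal v γ • x = y

namespace GammaRel

variable {F : Type*} [Field F] {v : Place F} {x y z : TreeVertex v}

theorem refl (x : TreeVertex v) : GammaRel v x x := ⟨1, one_mem _, by rw [map_one, one_smul]⟩

theorem symm (h : GammaRel v x y) : GammaRel v y x := by
  obtain ⟨γ, hγ, rfl⟩ := h
  exact ⟨γ⁻¹, inv_mem hγ, by rw [map_inv, inv_smul_smul]⟩

theorem trans (h : GammaRel v x y) (h' : GammaRel v y z) : GammaRel v x z := by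
  obtain ⟨γ, hγ, rfl⟩ := h
  obtain ⟨δ, hδ, rfl⟩ := h'
  exact ⟨δ * γ, mul_mem hδ hγ, by rw [map_mul, mul_smul]⟩

theorem apply_eq (h : GammaRel v x y) {φ : TreeVertex v → ℂ} (hφ : φ ∈ quotientGraphFunctions v) :
    φ x = φ y := by
  obtain ⟨γ, hγ, rfl⟩ := h
  exact (hφ γ hγ x).symm

end GammaRel

namespace PointlessCurve

variable {k F : Type*} [Field k] [Fintype k] [Field F] [Algebra k F] (C : PointlessCurve k F)
  {v : Place F} (hv : C.x ∉ v.1)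

variable (v) in
/-- The vertex with parameters `n` and `β`. -/
def pt (n : ℤ) (β : F) : TreeVertex v := vertex v (affineMat (C.t ^ n) β)

include hv in
theorem pt_eq_pt {n : ℤ} {β β' : F}
    (h : v.1.valuation (β - β') ≤ v.1.valuation (C.t : F) ^ n) : C.pt v n β = C.pt v n β' :=
  (C.isUniformizer_t hv).vertex_affineMat_eq h

include hv in
theorem exists_eq_pt (x : TreeVertex v) : ∃ (n : ℤ) (β : F), x = C.pt v n β :=
  (C.isUniformizer_t hv).exists_eq_vertex x

include hv in
-- The inverse does not vanish at infinity, so the unit has no pole there.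
theorem eq_algebraMap_of_isUnit {u : F} (hu : u ∈ C.A) (hu' : u⁻¹ ∈ C.A) (h0 : u ≠ 0) :
    ∃ e : k, e ≠ 0 ∧ u = algebraMap k F e := by
  have h1 : v.1.valuation u ≤ 1 := by
    have h2 : ¬ v.1.valuation u⁻¹ < 1 := fun h =>
      (inv_ne_zero h0) (C.eq_zero_of_mem hv hu' h)
    rw [not_lt, map_inv₀] at h2
    rwa [one_le_inv₀ (by simpa [zero_lt_iff] using h0)] at h2
  obtain ⟨e, rfl⟩ := C.eq_const_of_mem hv hu (h1.trans (C.one_le_zpow hv (by norm_num)))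
  exact ⟨e, by rintro rfl; simp at h0, rfl⟩

include hv in
theorem mem_integralGL2_holomorphicOutside_iff {γ : GL2 F} :
    γ ∈ integralGL2 (holomorphicOutside v) ↔ (∀ i j, γ i j ∈ C.A) ∧
      ∃ e : k, e ≠ 0 ∧ γ.val.det = algebraMap k F e := by
  rw [mem_integralGL2_iff]
  simp only [C.mem_holomorphicOutside_iff hv]
  refine and_congr_right fun h => ⟨fun h' => ?_, ?_⟩
  · refine C.eq_algebraMap_of_isUnit hv ?_ h' γ.det.ne_zero
    rw [Matrix.det_fin_two]
    exact sub_mem (mul_mem (h _ _) (h _ _)) (mul_mem (h _ _) (h _ _))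
  · rintro ⟨e, -, h'⟩
    rw [h', ← map_inv₀]
    exact C.A.algebraMap_mem _

include hv in
/-- The classification of vertices in terms of matrices over `A`. -/
theorem gammaRel_pt_iff {n m : ℤ} {β β' : F} : GammaRel v (C.pt v n β) (C.pt v m β') ↔
    ∃ a ∈ C.A, ∃ b ∈ C.A, ∃ c ∈ C.A, ∃ d ∈ C.A, ∃ e : k, e ≠ 0 ∧ a * d - b * c = algebraMap k F e ∧
      ∃ j : ℤ, n = m + 2 * j ∧
        v.1.valuation (a - β' * c) ≤ v.1.valuation (C.t : F) ^ (-j) ∧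
        v.1.valuation ((a * β + b) - β' * (c * β + d)) ≤ v.1.valuation (C.t : F) ^ (m + j) ∧
        v.1.valuation c ≤ v.1.valuation (C.t : F) ^ (j - n) ∧
        v.1.valuation (c * β + d) ≤ v.1.valuation (C.t : F) ^ j := by
  have ht := C.isUniformizer_t hv
  constructor
  · rintro ⟨γ, hγ, h⟩
    obtain ⟨h1, e, he, h2⟩ := (C.mem_integralGL2_holomorphicOutside_iff hv).1 hγ
    obtain ⟨j, h3, h4⟩ := (ht.smul_vertex_eq_vertex_iff γ n m β β').1 h
    rw [h2, valuation_algebraMap v.1 he, one_mul, ht.zpow_inj] at h3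
    refine ⟨_, h1 0 0, _, h1 0 1, _, h1 1 0, _, h1 1 1, e, he, ?_, j, h3, ?_⟩
    · rw [← h2, Matrix.det_fin_two]
    · rwa [show m - n + j = -j by omega] at h4
  · rintro ⟨a, ha, b, hb, c, hc, d, hd, e, he, hdet, j, hj, h4⟩
    have h0 : a * d - b * c ≠ 0 := by
      rw [hdet]
      simpa using he
    refine ⟨mat a b c d h0, (C.mem_integralGL2_holomorphicOutside_iff hv).2
      ⟨fun r s => ?_, e, he, ?_⟩, (ht.smul_vertex_eq_vertex_iff _ n m β β').2 ⟨j, ?_, ?_⟩⟩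
    · fin_cases r <;> fin_cases s <;> assumption
    · rw [val_mat, Matrix.det_fin_two_of, hdet]
    · rw [val_mat, Matrix.det_fin_two_of, hdet, valuation_algebraMap v.1 he, one_mul, hj]
    · rw [show m - n + j = -j by omega]
      exact h4

include hv in
theorem gammaRel_translate (n : ℤ) {g : F} (hg : g ∈ C.A) {β β' : F}
    (h : v.1.valuation (β + g - β') ≤ v.1.valuation (C.t : F) ^ n) :
    GammaRel v (C.pt v n β) (C.pt v n β') :=
  (C.gammaRel_pt_iff hv).2 ⟨1, one_mem _, g, hg, 0, zero_mem _, 1, one_mem _, 1, one_ne_zero,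
    by simp, 0, by ring, by simp, by simpa using h, by simp, by simp⟩

/-- Labels of the vertices of the quotient graph. -/
inductive _root_.Toroidal.Label (k : Type*)
  | c (n : ℕ)
  | z₀
  | z₁
  | t (l : k)

variable (k) in
/-- The degree of a labelled vertex. -/
def _root_.Toroidal.Label.deg : Label k → ℤ
  | .c n => -n
  | .z₀ => 0
  | .z₁ => 1
  | .t _ => 2

/-- The parameter of a labelled vertex. -/
def par : Label k → F
  | .c _ => 0
  | .z₀ => (C.t : F)⁻¹
  | .z₁ => (C.t : F)⁻¹
  | .t l => C.tParam l

variable (v) in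
/-- The vertex of a label. -/
def labelVertex (L : Label k) : TreeVertex v := C.pt v (L.deg k) (C.par L)

include hv in
-- A matrix of GL₂(k) exchanging the two ends does this: GL₂(k) acts transitively on the neighbours
-- of c_0.
theorem gammaRel_c₀ (u : k) : GammaRel v (C.pt v 1 (algebraMap k F u)) (C.labelVertex v (.c 1)) :=
  (C.gammaRel_pt_iff hv).2 ⟨0, zero_mem _, 1, one_mem _, 1, one_mem _, algebraMap k F (-u),
    C.A.algebraMap_mem _, -1, by simp, by simp, 1, by simp [Label.deg], by simp [par],
    by simp [Label.deg, par], by simp, by simp⟩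

include hv in
theorem gammaRel_c₁ {u : k} (hu : u ≠ 0) :
    GammaRel v (C.pt v 0 (algebraMap k F u * (C.t : F)⁻¹)) (C.labelVertex v .z₀) := by
  have : algebraMap k F u ≠ 0 := by simpa using hu
  refine (C.gammaRel_pt_iff hv).2 ⟨algebraMap k F u⁻¹, C.A.algebraMap_mem _, 0, zero_mem _, 0,
    zero_mem _, 1, one_mem _, u⁻¹, inv_ne_zero hu, by simp, 0, by simp [Label.deg], ?_, ?_, by simp,
    by simp⟩
  · simpa using valuation_algebraMap_le v.1 u⁻¹
  · simp [Label.deg, par, this]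

include hv in
-- Translation by an element of `A` of pole order n + 1 removes the parameter. For n = 0 there is no
-- such element, and this is why the graph branches at c_1.
theorem gammaRel_c {n : ℕ} (hn : n ≠ 0) (u : k) :
    GammaRel v (C.pt v (-n) (algebraMap k F u * (C.t : F) ^ (-((n + 1 : ℕ) : ℤ))))
      (C.labelVertex v (.c n)) := by
  have hpos := C.valuation_t_pos v.1
  have hn1 : n + 1 ≠ 1 := by omega
  have hm : C.mono (n + 1) ≠ 0 := by
    rw [← Valuation.ne_zero_iff v.1.valuation, C.valuation_mono hv hn1]
    exact zpow_ne_zero _ hpos.ne'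
  obtain ⟨e, he⟩ := C.exists_const_mul hv (z := (C.t : F) ^ (-((n + 1 : ℕ) : ℤ))) hm
    (by rw [map_zpow₀, C.valuation_mono hv hn1])
  rw [C.valuation_mono hv hn1] at he
  refine C.gammaRel_translate hv _ (g := algebraMap k F (-(u * e)) * C.mono (n + 1))
    (mul_mem (C.A.algebraMap_mem _) (C.mono_mem hn1)) ?_
  have e1 : algebraMap k F u * (C.t : F) ^ (-((n + 1 : ℕ) : ℤ))
      + algebraMap k F (-(u * e)) * C.mono (n + 1) - C.par (.c n)
      = algebraMap k F u * ((C.t : F) ^ (-((n + 1 : ℕ) : ℤ)) - algebraMap k F e * C.mono (n + 1)) := by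
    simp only [par, map_neg, map_mul]
    ring
  rw [e1]
  refine valuation_const_mul_le _ ?_
  generalize (C.t : F) ^ (-((n + 1 : ℕ) : ℤ)) - algebraMap k F e * C.mono (n + 1) = f at he
  by_cases hf : f = 0
  · simp [hf]
  obtain ⟨i, hi⟩ := C.exists_valuation_eq hv hf
  rw [hi, C.zpow_t_lt_iff hv] at he
  rw [hi, C.zpow_t_le_iff hv]
  push_cast at he
  omega

include hv in
theorem gammaRel_z₀ (u : k) :
    GammaRel v (C.pt v 1 ((C.t : F)⁻¹ + algebraMap k F u)) (C.labelVertex v .z₁) :=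
  C.gammaRel_translate hv 1 (g := algebraMap k F (-u)) (C.A.algebraMap_mem _) (by simp [par])

include hv in
theorem pt_tParam (l : k) : C.pt v 1 (C.tParam l) = C.labelVertex v .z₁ :=
  C.pt_eq_pt hv (by
    rw [tParam, par, add_sub_cancel_left, zpow_one]
    exact valuation_const_mul_le _ le_rfl)

/-- The cofactor of `x - l` in the difference of two values of the cubic polynomial. -/
def cofactor (l : k) : F :=
  C.x ^ 2 + algebraMap k F l * C.x + algebraMap k F (l ^ 2 + C.a₄)

omit [Fintype k] in
theorem cofactor_mem (l : k) : C.cofactor l ∈ C.A :=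
  add_mem (add_mem (pow_mem C.x_mem 2) (mul_mem (C.A.algebraMap_mem _) C.x_mem))
    (C.A.algebraMap_mem _)

omit [Fintype k] in
theorem cofactor_mul (l : k) : C.cofactor l * (C.x - algebraMap k F l) =
    C.y ^ 2 + algebraMap k F C.a₃ * C.y - algebraMap k F (l ^ 3 + C.a₄ * l + C.a₆) := by
  rw [C.equation, cofactor]
  simp only [map_add, map_mul, map_pow]
  ring

include hv in
-- The conjugating matrix has constant determinant, namely minus the defect of the curve equation's
-- left side at (l, -u) up to sign; it is nonzero because the curve has no points. So t_l is an end
-- of the quotient graph.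
theorem gammaRel_t (l u : k) :
    GammaRel v (C.pt v 3 (C.tParam l + algebraMap k F u * (C.t : F) ^ 2))
      (C.labelVertex v .z₁) := by
  have hpos := C.valuation_t_pos v.1
  have ht0 := C.t.ne_zero
  have hτ : ∀ {i j : ℤ}, j ≤ i → v.1.valuation (C.t : F) ^ i ≤ v.1.valuation (C.t : F) ^ j :=
    fun h => (C.zpow_t_le_iff hv).2 h
  refine GammaRel.symm ?_
  set β' := C.tParam l + algebraMap k F u * (C.t : F) ^ 2 with hβ'
  set a := C.y + algebraMap k F u with ha
  set c := C.x - algebraMap k F l with hc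
  set d := -C.y + algebraMap k F (u - C.a₃) with hd
  set e := u ^ 2 - C.a₃ * u - (l ^ 3 + C.a₄ * l + C.a₆) with he
  have hdet : a * d - -C.cofactor l * c = algebraMap k F e := by
    rw [neg_mul, sub_neg_eq_add, C.cofactor_mul]
    simp only [ha, hd, he, map_sub, map_add, map_mul, map_pow]
    ring
  have he0 : e ≠ 0 := by
    intro h
    refine C.no_point l (-u) ?_
    linear_combination h
  have vc : v.1.valuation c = v.1.valuation (C.t : F) ^ (-2 : ℤ) := by
    rw [hc, ← C.valuation_x hv, sub_eq_add_neg, ← map_neg]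
    refine Valuation.map_add_eq_of_lt_left _ ?_
    rw [C.valuation_x hv]
    refine (C.valuation_const_le hv (-l) (n := 0) le_rfl).trans_lt ?_
    exact (C.zpow_t_lt_iff hv).2 (by norm_num)
  have hc0 : c ≠ 0 := by
    rw [← Valuation.ne_zero_iff v.1.valuation, vc]
    exact zpow_ne_zero _ hpos.ne'
  have va : v.1.valuation (a - β' * c) ≤ v.1.valuation (C.t : F) ^ (1 : ℤ) := by
    have e1 : a - β' * c = -((C.x * C.tParam l + algebraMap k F (-l) * C.tParam l - C.y)
        + algebraMap k F u * ((C.t : F) ^ 2 * C.x - 1)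
        + algebraMap k F (-(u * l)) * (C.t : F) ^ (2 : ℤ)) := by
      simp only [ha, hβ', hc, map_neg, map_mul]
      rw [zpow_ofNat]
      ring
    rw [e1, Valuation.map_neg]
    refine v.1.valuation.map_add_le (v.1.valuation.map_add_le ?_ ?_) ?_
    · have := C.valuation_tParam_mul_sub hv l 1 (-l)
      simp only [map_one, one_mul, add_neg_cancel, map_zero, zero_mul, add_zero, add_mul] at this
      rwa [zpow_one]
    · exact valuation_const_mul_le _ ((C.valuation_t_sq_mul_x_sub_one hv).trans (hτ (by norm_num)))
    · refine valuation_const_mul_le _ ?_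
      rw [map_zpow₀]
      exact hτ (by norm_num)
  have vd : v.1.valuation (c * (C.t : F)⁻¹ + d) ≤ v.1.valuation (C.t : F) ^ (-1 : ℤ) := by
    have e1 : c * (C.t : F)⁻¹ + d
        = algebraMap k F (-l) * (C.t : F)⁻¹ + algebraMap k F (u - C.a₃) := by
      simp only [hc, hd, ← C.inv_t_mul_x, map_neg]
      ring
    rw [e1]
    refine v.1.valuation.map_add_le (valuation_const_mul_le _ (by simp))
      (C.valuation_const_le hv _ (by norm_num))
  refine (C.gammaRel_pt_iff hv).2 ⟨a, add_mem C.y_mem (C.A.algebraMap_mem _), -C.cofactor l,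
    neg_mem (C.cofactor_mem l), c, sub_mem C.x_mem (C.A.algebraMap_mem _), d,
    add_mem (neg_mem C.y_mem) (C.A.algebraMap_mem _), e, he0, hdet, -1, by simp [Label.deg],
    by simpa using va, ?_, vc.le.trans (hτ (by simp [Label.deg])), vd⟩
  -- The upper right entry is recovered from the other three and the determinant, so that its
  -- estimate follows from theirs.
  have e2 : a * C.par .z₁ + -C.cofactor l - β' * (c * C.par .z₁ + d)
      = ((a - β' * c) * (c * (C.t : F)⁻¹ + d) - algebraMap k F e) / c := by
    rw [← hdet, par, eq_div_iff hc0]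
    ring
  rw [e2, map_div₀, div_le_iff₀ (by rw [vc]; exact zpow_pos hpos _), vc, ← zpow_add₀ hpos.ne']
  refine v.1.valuation.map_sub_le ?_ ((C.valuation_const_le hv _ (n := 0) le_rfl).trans
    (hτ (by norm_num)))
  rw [map_mul]
  refine (mul_le_mul' va vd).trans ?_
  rw [← zpow_add₀ hpos.ne']
  exact hτ (by norm_num)

/-! ### The Hecke operator on the quotient graph -/

theorem affineMat_mul {R : Type*} [CommRing R] (a a' : Rˣ) (β β' : R) :
    affineMat a β * affineMat a' β' = affineMat (a * a') (a * β' + β) := by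
  ext r s
  fin_cases r <;> fin_cases s <;> simp [affineMat, Matrix.mul_apply, Fin.sum_univ_two]

omit [Fintype k] in
theorem toLocal_mul_neighbour_none (n : ℤ) (β : F) :
    (QuotientGroup.mk (toLocal v (affineMat (C.t ^ n) β) * toLocal v (affineMat C.t⁻¹ 0)) :
      TreeVertex v) = C.pt v (n - 1) β := by
  rw [← map_mul, affineMat_mul, mul_zero, zero_add, ← zpow_sub_one]
  rfl

omit [Fintype k] in
theorem toLocal_mul_neighbour_some (n : ℤ) (β : F) (u : k) :
    (QuotientGroup.mk (toLocal v (affineMat (C.t ^ n) β) *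
      toLocal v (affineMat C.t (algebraMap k F u))) : TreeVertex v)
      = C.pt v (n + 1) (β + algebraMap k F u * (C.t : F) ^ n) := by
  rw [← map_mul, affineMat_mul, ← zpow_add_one, mul_comm, add_comm β, Units.val_zpow_eq_zpow_val]
  rfl

include hv in
theorem heckeOp_pt (φ : TreeVertex v → ℂ) (n : ℤ) (β : F) : heckeOp v C.t φ (C.pt v n β) =
    φ (C.pt v (n - 1) β) + ∑ u : k, φ (C.pt v (n + 1) (β + algebraMap k F u * (C.t : F) ^ n)) := by
  rw [pt, vertex, (C.isUniformizer_t hv).heckeOp_mk (fun f hf => C.exists_const hv hf)]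
  simp only [toLocal_mul_neighbour_none, toLocal_mul_neighbour_some]

section Hecke

variable {φ : TreeVertex v → ℂ} (hφ : φ ∈ quotientGraphFunctions v)

include hv hφ

theorem heckeOp_c_zero : heckeOp v C.t φ (C.labelVertex v (.c 0)) =
    (Fintype.card k + 1) * φ (C.labelVertex v (.c 1)) := by
  have h : ∀ u : k, φ (C.pt v 1 (algebraMap k F u)) = φ (C.labelVertex v (.c 1)) :=
    fun u => (C.gammaRel_c₀ hv u).apply_eq hφ
  rw [labelVertex, C.heckeOp_pt hv]
  simp only [Label.deg, par, Nat.cast_zero, neg_zero, zpow_zero, mul_one, zero_add, h,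
    Finset.sum_const, Finset.card_univ, nsmul_eq_mul]
  simp only [labelVertex, Label.deg, par]
  push_cast
  ring

theorem heckeOp_c_one : heckeOp v C.t φ (C.labelVertex v (.c 1)) =
    φ (C.labelVertex v (.c 2)) + φ (C.labelVertex v (.c 0))
      + (Fintype.card k - 1) * φ (C.labelVertex v .z₀) := by
  classical
  have h : ∀ u : k, φ (C.pt v 0 (algebraMap k F u * (C.t : F)⁻¹)) =
      (if u = 0 then φ (C.labelVertex v (.c 0)) - φ (C.labelVertex v .z₀) else 0)
        + φ (C.labelVertex v .z₀) := by
    intro u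
    split_ifs with hu
    · simp [hu, labelVertex, Label.deg, par]
    · rw [(C.gammaRel_c₁ hv hu).apply_eq hφ, zero_add]
  rw [labelVertex, C.heckeOp_pt hv]
  simp only [Label.deg, par, Nat.cast_one, neg_add_cancel, zpow_neg_one, zero_add, h,
    Finset.sum_add_distrib, Finset.sum_ite_eq', Finset.mem_univ, if_true,
    Finset.sum_const, Finset.card_univ, nsmul_eq_mul]
  simp only [labelVertex, Label.deg, par]
  push_cast
  norm_num
  ring

theorem heckeOp_c {n : ℕ} (hn : n ≠ 0) : heckeOp v C.t φ (C.labelVertex v (.c (n + 1))) =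
    φ (C.labelVertex v (.c (n + 2))) + Fintype.card k * φ (C.labelVertex v (.c n)) := by
  have h := fun u : k => (C.gammaRel_c hv hn u).apply_eq hφ
  rw [labelVertex, C.heckeOp_pt hv]
  simp only [Label.deg, par]
  rw [show -((n + 1 : ℕ) : ℤ) + 1 = -n by push_cast; ring]
  simp only [zero_add, h, Finset.sum_const, Finset.card_univ, nsmul_eq_mul]
  simp only [labelVertex, Label.deg, par]
  push_cast
  ring_nf

theorem heckeOp_z₀ : heckeOp v C.t φ (C.labelVertex v .z₀) =
    φ (C.labelVertex v (.c 1)) + Fintype.card k * φ (C.labelVertex v .z₁) := by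
  have h := fun u : k => (C.gammaRel_z₀ hv u).apply_eq hφ
  rw [labelVertex, C.heckeOp_pt hv]
  simp only [Label.deg, par, zpow_zero, mul_one, zero_add, h, Finset.sum_const, Finset.card_univ,
    nsmul_eq_mul]
  rw [C.pt_eq_pt hv (β := (C.t : F)⁻¹) (β' := 0) (by simp)]
  simp only [labelVertex, Label.deg, par]
  push_cast
  rfl

omit hφ in
theorem heckeOp_z₁ : heckeOp v C.t φ (C.labelVertex v .z₁) =
    φ (C.labelVertex v .z₀) + ∑ l : k, φ (C.labelVertex v (.t l)) := by
  rw [labelVertex, C.heckeOp_pt hv]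
  simp only [Label.deg, par, zpow_one, labelVertex, tParam, sub_self, one_add_one_eq_two]

theorem heckeOp_t (l : k) : heckeOp v C.t φ (C.labelVertex v (.t l)) =
    (Fintype.card k + 1) * φ (C.labelVertex v .z₁) := by
  have h := fun u : k => (C.gammaRel_t hv l u).apply_eq hφ
  rw [labelVertex, C.heckeOp_pt hv]
  simp only [Label.deg, par]
  rw [show (2 : ℤ) - 1 = 1 by norm_num, show (2 : ℤ) + 1 = 3 by norm_num, C.pt_tParam hv]
  simp only [zpow_ofNat, h, Finset.sum_const,
    Finset.card_univ, nsmul_eq_mul]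
  ring

end Hecke

/-! ### The vertices of the quotient graph -/

include hv in
-- The labelled classes are closed under passing to a neighbour; connectedness of the tree does the
-- rest.
theorem gammaRel_neighbour (L : Label k) (o : Option k) : ∃ L' : Label k, GammaRel v
    (QuotientGroup.mk (toLocal v (affineMat (C.t ^ L.deg k) (C.par L)) *
      toLocal v (neighbour C.t k o))) (C.labelVertex v L') := by
  cases o with
  | none =>
    rw [neighbour, C.toLocal_mul_neighbour_none]
    cases L with
    | c n =>
      refine ⟨.c (n + 1), ?_⟩
      rw [Label.deg, labelVertex, Label.deg, show -(n : ℤ) - 1 = -((n + 1 : ℕ) : ℤ) by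
        push_cast; ring]
      exact .refl _
    | z₀ =>
      refine ⟨.c 1, ?_⟩
      simp only [Label.deg, par, zero_sub]
      rw [C.pt_eq_pt hv (β := (C.t : F)⁻¹) (β' := 0) (by simp)]
      exact .refl _
    | z₁ => exact ⟨.z₀, .refl _⟩
    | t l =>
      refine ⟨.z₁, ?_⟩
      simp only [Label.deg, par]
      rw [show (2 : ℤ) - 1 = 1 by norm_num, C.pt_tParam hv]
      exact .refl _
  | some u =>
    rw [neighbour, C.toLocal_mul_neighbour_some]
    cases L with
    | c n =>
      rw [par, zero_add, Label.deg]
      rcases n with _ | _ | n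
      · exact ⟨.c 1, by simpa using C.gammaRel_c₀ hv u⟩
      · by_cases hu : u = 0
        · exact ⟨.c 0, by simpa [hu, labelVertex, Label.deg, par] using GammaRel.refl _⟩
        · exact ⟨.z₀, by simpa using C.gammaRel_c₁ hv hu⟩
      · refine ⟨.c (n + 1), ?_⟩
        have := C.gammaRel_c hv n.succ_ne_zero u
        rwa [show -((n + 1 + 1 : ℕ) : ℤ) + 1 = -((n + 1 : ℕ) : ℤ) by push_cast; ring]
    | z₀ => exact ⟨.z₁, by simpa [Label.deg, par] using C.gammaRel_z₀ hv u⟩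
    | z₁ =>
      refine ⟨.t u, ?_⟩
      simp only [Label.deg, par, zpow_one]
      exact .refl _
    | t l =>
      refine ⟨.z₁, ?_⟩
      simp only [Label.deg, par, zpow_ofNat]
      exact C.gammaRel_t hv l u

include hv in
theorem exists_gammaRel_label (x : TreeVertex v) : ∃ L : Label k, GammaRel v x (C.labelVertex v L) := by
  have ht := C.isUniformizer_t hv
  have step : ∀ (n : ℤ) (β : F), (∃ L : Label k, GammaRel v (C.pt v n β) (C.labelVertex v L)) →
      ∃ L : Label k, GammaRel v (C.pt v (n + 1) β) (C.labelVertex v L) := by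
    rintro n β ⟨L, hL⟩
    obtain ⟨γ, hγ, h⟩ := hL.symm
    have h1 : TreeAdj v C.t (C.pt v n β) (C.pt v (n + 1) β) := by
      rw [pt, vertex, ht.treeAdj_iff (k := k) (fun f hf => C.exists_const hv hf)]
      refine ⟨some 0, ?_⟩
      rw [neighbour, C.toLocal_mul_neighbour_some]
      simp
    have h2 : C.pt v n β = QuotientGroup.mk (toLocal v γ *
      toLocal v (affineMat (C.t ^ L.deg k) (C.par L))) := h.symm
    rw [h2, ht.treeAdj_iff (k := k) (fun f hf => C.exists_const hv hf)] at h1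
    obtain ⟨o, ho⟩ := h1
    obtain ⟨L', hL'⟩ := C.gammaRel_neighbour hv L o
    refine ⟨L', GammaRel.trans (GammaRel.symm ⟨γ, hγ, ?_⟩) hL'⟩
    rw [← ho, mul_assoc]
    rfl
  obtain ⟨n, β, rfl⟩ := C.exists_eq_pt hv x
  -- For large N the parameter β is trivial at level -N, where the vertex is c_N. Increasing the
  -- level by one is a step to a neighbour.
  obtain ⟨N, hN1, hN2⟩ : ∃ N : ℕ, v.1.valuation β ≤ v.1.valuation (C.t : F) ^ (-(N : ℤ)) ∧
      -(N : ℤ) ≤ n := by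
    by_cases hβ : β = 0
    · exact ⟨n.natAbs, by simp [hβ], by omega⟩
    · obtain ⟨i, hi⟩ := C.exists_valuation_eq hv hβ
      refine ⟨n.natAbs + i.natAbs, ?_, by omega⟩
      rw [hi, C.zpow_t_le_iff hv]
      omega
  obtain ⟨i, rfl⟩ : ∃ i : ℕ, n = -(N : ℤ) + i := ⟨(n + N).toNat, by omega⟩
  clear hN2
  induction i with
  | zero =>
    refine ⟨.c N, ?_⟩
    rw [Nat.cast_zero, add_zero, C.pt_eq_pt hv (β' := 0) (by simpa using hN1)]
    exact .refl _
  | succ i ih =>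
    have := step _ _ ih
    rwa [add_assoc] at this

omit [Fintype k] in
theorem par_eq (L : Label k) : ∃ e l : k, C.par L = algebraMap k F e * (C.t : F)⁻¹
    + algebraMap k F l * C.t ∧ (e = 0 → L.deg k ≤ 0) := by
  cases L with
  | c n => exact ⟨0, 0, by simp [par], by simp [Label.deg]⟩
  | z₀ => exact ⟨1, 0, by simp [par], by simp⟩
  | z₁ => exact ⟨1, 0, by simp [par], by simp⟩
  | t l => exact ⟨1, l, by simp [par, tParam], by simp⟩

include hv in
-- If the degree dropped, the lower row would vanish: degrees are at most 2, so c is constant, the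
-- polar part of the parameter or the pole bound kills it, and then d vanishes at infinity.
theorem deg_le_of_gammaRel {L L' : Label k}
    (h : GammaRel v (C.labelVertex v L) (C.labelVertex v L')) : L.deg k ≤ L'.deg k := by
  obtain ⟨a, ha, b, hb, c, hc, d, hd, e, he, hdet, j, hj, -, -, h3, h4⟩ :=
    (C.gammaRel_pt_iff hv).1 h
  by_contra hlt
  have hj0 : 0 < j := by omega
  have hle : L.deg k ≤ 2 := by cases L <;> simp [Label.deg]
  obtain ⟨c₀, rfl⟩ := C.eq_const_of_mem hv hc (h3.trans ((C.zpow_t_le_iff hv).2 (by omega)))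
  have hj1 : v.1.valuation (C.t : F) ^ j < 1 := by
    rw [← zpow_zero (v.1.valuation (C.t : F)), C.zpow_t_lt_iff hv]
    exact hj0
  obtain ⟨e', l, hp, hp0⟩ := C.par_eq L
  have hc0 : c₀ = 0 := by
    by_cases h0 : e' = 0
    · refine eq_zero_of_const_lt_one (h3.trans_lt ?_)
      rw [← zpow_zero (v.1.valuation (C.t : F)), C.zpow_t_lt_iff hv]
      have := hp0 h0
      omega
    · have := (C.eq_zero_of_add_inv_t hv hd (e := c₀ * e') ?_).1
      · exact (mul_eq_zero.1 this).resolve_right h0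
      · have e1 : d + algebraMap k F (c₀ * e') * (C.t : F)⁻¹ = (algebraMap k F c₀ * C.par L + d)
            - algebraMap k F (c₀ * l) * C.t := by
          rw [hp, map_mul, map_mul]
          ring
        rw [e1]
        exact v.1.valuation.map_sub_le (h4.trans hj1.le)
          (valuation_const_mul_le _ (C.valuation_t_lt_one hv).le)
  rw [hc0, map_zero, zero_mul, zero_add] at h4
  rw [hc0, C.eq_zero_of_mem hv hd (h4.trans_lt hj1)] at hdet
  simp only [mul_zero, map_zero, sub_zero] at hdet
  exact he ((map_eq_zero _).1 hdet.symm)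

include hv in
/-- Different labels belong to different vertices of the quotient graph. -/
theorem eq_of_gammaRel {L L' : Label k}
    (h : GammaRel v (C.labelVertex v L) (C.labelVertex v L')) : L = L' := by
  have hdeg := le_antisymm (C.deg_le_of_gammaRel hv h) (C.deg_le_of_gammaRel hv h.symm)
  -- The degree separates all labels except c_0 from z_0 and the t_l from one another.
  have key : ¬ GammaRel v (C.labelVertex v (.c 0)) (C.labelVertex v (.z₀)) := by
    intro h
    obtain ⟨a, ha, b, hb, c, hc, d, hd, e, he, hdet, j, hj, h1, h2, h3, -⟩ :=
      (C.gammaRel_pt_iff hv).1 h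
    obtain rfl : j = 0 := by
      simp [Label.deg] at hj
      omega
    simp only [Label.deg, par, Nat.cast_zero, neg_zero, zpow_zero, sub_zero, mul_zero, zero_add,
      add_zero] at h1 h2 h3
    obtain ⟨c₀, rfl⟩ := C.eq_const_of_mem hv hc (h3.trans (C.one_le_zpow hv (by norm_num)))
    have hc0 := (C.eq_zero_of_add_inv_t hv ha (e := -c₀) (by
      rw [map_neg, neg_mul, ← sub_eq_add_neg, mul_comm]; exact h1)).1
    rw [neg_eq_zero] at hc0
    rw [hc0, map_zero, mul_zero, sub_zero] at h1
    rw [hc0, map_zero, mul_zero, sub_zero] at hdet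
    obtain ⟨d₀, rfl⟩ : ∃ d₀ : k, d = algebraMap k F d₀ := by
      refine C.eq_const_of_mem hv hd ?_
      obtain ⟨a₀, rfl⟩ := C.eq_const_of_mem hv ha (h1.trans (C.one_le_zpow hv (by norm_num)))
      have ha0 : a₀ ≠ 0 := by
        rintro rfl
        rw [map_zero, zero_mul] at hdet
        exact he ((map_eq_zero _).1 hdet.symm)
      have := congrArg v.1.valuation hdet
      rw [map_mul, valuation_algebraMap v.1 ha0, valuation_algebraMap v.1 he, one_mul] at this
      rw [this]
      exact C.one_le_zpow hv (by norm_num)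
    have hd0 := (C.eq_zero_of_add_inv_t hv hb (e := -d₀) (by
      rw [map_neg, neg_mul, ← sub_eq_add_neg, mul_comm]; exact h2)).1
    rw [neg_eq_zero] at hd0
    rw [hd0, map_zero, mul_zero] at hdet
    exact he ((map_eq_zero _).1 hdet.symm)
  have key' : ∀ l l' : k, GammaRel v (C.labelVertex v (.t l)) (C.labelVertex v (.t l')) →
      l = l' := by
    intro l l' h
    obtain ⟨a, ha, b, hb, c, hc, d, hd, e, he, hdet, j, hj, h1, h2, h3, h4⟩ :=
      (C.gammaRel_pt_iff hv).1 h
    obtain rfl : j = 0 := by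
      simp only [Label.deg] at hj
      omega
    have hh : C.IsHom v 2 (C.tParam l) (C.tParam l') a b c d :=
      ⟨ha, hb, hc, hd, by simpa [par] using h1,
        by simpa [par, Label.deg] using h2, by simpa [Label.deg] using h3, by simpa [par] using h4⟩
    obtain ⟨c₁, c₀, hcc, hl, hl'⟩ := hh.eq_linear hv
    by_cases hc1 : c₁ = 0
    · obtain ⟨hc', -, e', rfl, rfl, hee⟩ := hh.eq_scalar hv (c₀ := c₀) (by simp [hcc, hc1])
      have he0 : e' ≠ 0 := by
        rintro rfl
        rw [hc'] at hdet
        simp only [map_zero, mul_zero, sub_zero] at hdet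
        exact he ((map_eq_zero _).1 hdet.symm)
      exact sub_eq_zero.1 ((mul_eq_zero.1 hee).resolve_left he0)
    -- For c₁ ≠ 0 both l and l' are the zero of the same linear form.
    · exact mul_left_cancel₀ hc1 (by linear_combination hl - hl')
  cases L <;> cases L' <;> simp only [Label.deg] at hdeg <;> try omega
  · rename_i n m
    rw [show n = m by omega]
  · rename_i n
    obtain rfl : n = 0 := by omega
    exact absurd h key
  · rename_i n
    obtain rfl : n = 0 := by omega
    exact absurd h.symm key
  · rfl
  · rfl
  · rw [key' _ _ h]

end PointlessCurve
end Toroidal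
end

open scoped RestrictedProduct

noncomputable section

namespace Toroidal

/-! ### The finite-dimensional space of functions on the quotient graph -/

/-- The coefficients `(λ_n, μ_n, ν_n)`. -/
def coeff (q : ℂ) : ℕ → ℂ × ℂ × ℂ
  -- Each relation is the Hecke image of the one before, solved for the new value on the ray. The
  -- summand -q in the last component stems from C_1 + q Z_1 = -q Z_1.
  | 0 => (0, -2, 0)
  | 1 => (0, 0, -2 * q)
  | 2 => (1 - 3 * q, 2 - 2 * q, 0)
  | n + 3 =>
    ((coeff q (n + 2)).2.2 - q * (coeff q (n + 1)).1,
      (coeff q (n + 2)).2.2 - q * (coeff q (n + 1)).2.1,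
      -q * (coeff q (n + 2)).1 + q * (q + 1) * (coeff q (n + 2)).2.1 - q * (coeff q (n + 1)).2.2)

/-- The quotient graph is bipartite, so the recursion exchanges the pair (λ, μ) with ν. -/
theorem coeff_parity (q : ℂ) (n : ℕ) : (Even n → (coeff q n).2.2 = 0) ∧
    (Odd n → (coeff q n).1 = 0 ∧ (coeff q n).2.1 = 0) := by
  induction n using Nat.strong_induction_on with
  | _ n ih =>
    rcases n with _ | _ | _ | n
    · simp [coeff]
    · simp [coeff]
    · exact ⟨fun _ => rfl, fun h => absurd h (by decide)⟩
    · have h1 := ih (n + 1) (by omega)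
      have h2 := ih (n + 2) (by omega)
      constructor
      · intro h
        have e1 : Even (n + 1) := by simpa [Nat.even_add_one, parity_simps] using h
        have e2 : Odd (n + 2) := by simpa [Nat.even_add_one, parity_simps] using h
        simp [coeff, h1.1 e1, (h2.2 e2).1, (h2.2 e2).2]
      · intro h
        have e1 : Odd (n + 1) := by simpa [Nat.even_add_one, parity_simps] using h
        have e2 : Even (n + 2) := by simpa [Nat.even_add_one, parity_simps] using h
        simp [coeff, (h1.2 e1).1, (h1.2 e1).2, h2.1 e2]

namespace PointlessCurve

variable {k F : Type*} [Field k] [Fintype k] [Field F] [Algebra k F] (C : PointlessCurve k F)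
  {v : Place F} (hv : C.x ∉ v.1)

/-- The sum of the values at the vertices `t_l`. -/
def sumT (φ : TreeVertex v → ℂ) : ℂ := ∑ l : k, φ (C.labelVertex v (.t l))

/-- The relation between the values at the vertices of the quotient graph. -/
def CuspRelation (φ : TreeVertex v → ℂ) (n : ℕ) : Prop :=
  φ (C.labelVertex v (.c n)) = (coeff (Fintype.card k) n).1 * φ (C.labelVertex v .z₀) +
    (coeff (Fintype.card k) n).2.1 * C.sumT φ +
    (coeff (Fintype.card k) n).2.2 * φ (C.labelVertex v .z₁)

include hv in
theorem heckeOp_mem {φ : TreeVertex v → ℂ} (hφ : φ ∈ quotientGraphFunctions v) :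
    heckeOp v C.t φ ∈ quotientGraphFunctions v := by
  have ht := C.isUniformizer_t hv
  intro γ hγ x
  obtain ⟨g, rfl⟩ := QuotientGroup.mk_surjective x
  have e : ∀ h : GL2 v.Completion, (QuotientGroup.mk (toLocal v γ * g * h) : TreeVertex v) =
      toLocal v γ • QuotientGroup.mk (g * h) := fun h => by rw [mul_assoc]; rfl
  change heckeOp v C.t φ (QuotientGroup.mk (toLocal v γ * g)) = _
  rw [ht.heckeOp_mk (k := k) (fun f hf => C.exists_const hv hf),
    ht.heckeOp_mk (k := k) (fun f hf => C.exists_const hv hf)]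
  simp only [e, hφ γ hγ]

include hv in
theorem sumT_heckeOp {φ : TreeVertex v → ℂ} (hφ : φ ∈ quotientGraphFunctions v) :
    C.sumT (heckeOp v C.t φ) =
      Fintype.card k * (Fintype.card k + 1) * φ (C.labelVertex v .z₁) := by
  simp only [sumT, C.heckeOp_t hv hφ, Finset.sum_const, Finset.card_univ, nsmul_eq_mul]
  ring

include hv in
-- The relation of index n for the image is a combination of those of index n + 1, n - 1 and 1 for
-- the function; near the end of the ray fewer are needed.
theorem CuspRelation.heckeOp {φ : TreeVertex v → ℂ} (hφ : φ ∈ quotientGraphFunctions v)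
    (h : ∀ n, C.CuspRelation φ n) (n : ℕ) : C.CuspRelation (heckeOp v C.t φ) n := by
  unfold CuspRelation at h ⊢
  rw [C.sumT_heckeOp hv hφ, C.heckeOp_z₀ hv hφ, C.heckeOp_z₁ hv]
  change _ = _ * _ + _ + _ * (_ + C.sumT φ)
  have h0 := h 0
  have h1 := h 1
  rcases n with _ | _ | n
  · rw [C.heckeOp_c_zero hv hφ, h1]
    simp only [coeff]
    ring
  · rw [C.heckeOp_c_one hv hφ, h0, h 2]
    simp only [coeff]
    ring
  · rw [C.heckeOp_c hv hφ n.succ_ne_zero, h (n + 3), h (n + 1), h1]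
    simp only [coeff]
    ring

include hv in
/-- Functions all of whose images under powers of the Hecke operator satisfy the first relation
satisfy all relations. -/
theorem cuspRelation_of_forall {P : Set (TreeVertex v → ℂ)} (hP : P ⊆ quotientGraphFunctions v)
    (hP' : ∀ φ ∈ P, heckeOp v C.t φ ∈ P) (h : ∀ φ ∈ P, C.CuspRelation φ 0) (n : ℕ) :
    ∀ φ ∈ P, C.CuspRelation φ n := by
  induction n using Nat.strong_induction_on with
  | _ n ih =>
    rcases n with _ | _ | n
    · exact h
    · intro φ hφ
      have h' := h _ (hP' φ hφ)
      unfold CuspRelation at h' ⊢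
      rw [C.sumT_heckeOp hv (hP hφ), C.heckeOp_z₀ hv (hP hφ), C.heckeOp_z₁ hv,
        C.heckeOp_c_zero hv (hP hφ)] at h'
      simp only [coeff] at h' ⊢
      have hq : (Fintype.card k + 1 : ℂ) ≠ 0 := Nat.cast_add_one_ne_zero _
      refine mul_left_cancel₀ hq ?_
      linear_combination h'
    · intro φ hφ
      -- The relation of index n + 1, applied to the Hecke image, is the relation of index n + 2 for
      -- the function itself.
      have h' := ih (n + 1) (by omega) _ (hP' φ hφ)
      have h0 := h φ hφ
      have h1 := ih 1 (by omega) φ hφ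
      unfold CuspRelation at h' h0 h1 ⊢
      rw [C.sumT_heckeOp hv (hP hφ), C.heckeOp_z₀ hv (hP hφ), C.heckeOp_z₁ hv] at h'
      change _ = _ * _ + _ + _ * (_ + C.sumT φ) at h'
      rcases n with _ | n
      · rw [C.heckeOp_c_one hv (hP hφ)] at h'
        simp only [coeff] at h' h0 h1 ⊢
        linear_combination h' - h0
      · rw [C.heckeOp_c hv (hP hφ) n.succ_ne_zero] at h'
        have h2 := ih (n + 1) (by omega) φ hφ
        unfold CuspRelation at h2
        simp only [coeff] at h' h1 ⊢
        linear_combination h' - Fintype.card k * h2 + (coeff (Fintype.card k) (n + 2)).1 * h1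

/-- The values of a function at the label of each vertex. -/
def extend (hv : C.x ∉ v.1) (u : Label k → ℂ) (x : TreeVertex v) : ℂ :=
  u (C.exists_gammaRel_label hv x).choose

theorem extend_eq (u : Label k → ℂ) {x : TreeVertex v} {L : Label k}
    (h : GammaRel v x (C.labelVertex v L)) : C.extend hv u x = u L := by
  rw [extend, C.eq_of_gammaRel hv
    ((C.exists_gammaRel_label hv x).choose_spec.symm.trans h)]

theorem extend_mem (u : Label k → ℂ) : C.extend hv u ∈ quotientGraphFunctions v := by
  intro γ hγ x
  obtain ⟨L, hL⟩ := C.exists_gammaRel_label hv x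
  rw [C.extend_eq hv u hL,
    C.extend_eq hv u (x := toLocal v γ • x) ((GammaRel.symm ⟨γ, hγ, rfl⟩).trans hL)]

include hv in
-- The values at the t_l, z_0 and z_1 are free coordinates: the relations determine the values on
-- the ray, and functions may be prescribed on labels because these are distinct and exhaust the
-- quotient.
theorem rank_eq (V : Submodule ℂ (TreeVertex v → ℂ))
    (hV : ∀ φ, φ ∈ V ↔ φ ∈ quotientGraphFunctions v ∧ ∀ n, C.CuspRelation φ n) :
    Module.rank ℂ V = ((Fintype.card k + 2 : ℕ) : Cardinal) := by
  let M : V →ₗ[ℂ] (k → ℂ) × ℂ × ℂ :=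
    { toFun := fun φ => (fun l => φ.1 (C.labelVertex v (.t l)),
        φ.1 (C.labelVertex v .z₀), φ.1 (C.labelVertex v .z₁))
      map_add' := fun _ _ => rfl
      map_smul' := fun _ _ => rfl }
  have hM : Function.Bijective M := by
    constructor
    · intro φ ψ h
      obtain ⟨h1, h2, h3⟩ : (∀ l, φ.1 (C.labelVertex v (.t l)) = ψ.1 (C.labelVertex v (.t l))) ∧
          φ.1 (C.labelVertex v .z₀) = ψ.1 (C.labelVertex v .z₀) ∧
          φ.1 (C.labelVertex v .z₁) = ψ.1 (C.labelVertex v .z₁) :=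
        ⟨congrFun (congrArg Prod.fst h), congrArg (fun z => z.2.1) h, congrArg (fun z => z.2.2) h⟩
      obtain ⟨hφ, hφ'⟩ := (hV φ).1 φ.2
      obtain ⟨hψ, hψ'⟩ := (hV ψ).1 ψ.2
      refine Subtype.ext (funext fun x => ?_)
      obtain ⟨L, hL⟩ := C.exists_gammaRel_label hv x
      rw [hL.apply_eq hφ, hL.apply_eq hψ]
      cases L with
      | c n => rw [hφ' n, hψ' n, h2, h3, sumT, sumT, Finset.sum_congr rfl fun l _ => h1 l]
      | z₀ => exact h2
      | z₁ => exact h3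
      | t l => exact h1 l
    · rintro ⟨T, Z₀, Z₁⟩
      let u : Label k → ℂ
        | .c n => (coeff (Fintype.card k) n).1 * Z₀ + (coeff (Fintype.card k) n).2.1 * ∑ l, T l +
            (coeff (Fintype.card k) n).2.2 * Z₁
        | .z₀ => Z₀
        | .z₁ => Z₁
        | .t l => T l
      have hu : ∀ L, C.extend hv u (C.labelVertex v L) = u L :=
        fun L => C.extend_eq hv u (GammaRel.refl _)
      refine ⟨⟨C.extend hv u, (hV _).2 ⟨C.extend_mem hv u, fun n => ?_⟩⟩, ?_⟩
      · simp only [CuspRelation, sumT, hu, u]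
      · change (_, _, _) = _
        simp only [hu, u]
  have e := LinearEquiv.ofBijective M hM
  have := Module.Finite.equiv e.symm
  rw [← Module.finrank_eq_rank, e.finrank_eq, Module.finrank_prod, Module.finrank_prod,
    Module.finrank_fintype_fun_eq_card, Module.finrank_self]

end PointlessCurve
end Toroidal
end

open scoped RestrictedProduct

noncomputable section

namespace Toroidal

/-! ### Matrices over the adeles -/

section Adelic

variable {F : Type*} [Field F]

theorem mem_maxCompact {g : GL2 (Adele F)} :
    g ∈ maxCompact F ↔ ∀ w, component w g ∈ integralGL2 w.integers.toSubring := by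
  simp only [maxCompact, Subgroup.mem_iInf, Subgroup.mem_comap]

theorem mem_diagonal {H : Subgroup (GL2 F)} {g : GL2 (Adele F)} :
    g ∈ diagonal H ↔ ∃ γ ∈ H, ∀ w, toLocal w γ = component w g := by
  simp only [diagonal, Subgroup.mem_comap, Subgroup.mem_map, funext_iff]
  rfl

theorem adelicMatrix_mul_apply (M N : Matrix (Fin 2) (Fin 2) (Adele F)) (i j : Fin 2)
    (w : Place F) : (M * N) i j w = M i 0 w * N 0 j w + M i 1 w * N 1 j w := by
  rw [Matrix.mul_apply, Fin.sum_univ_two]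
  rfl

/-- The matrix over the adeles with given components. -/
def adelicMatrix (m : ∀ w : Place F, Matrix (Fin 2) (Fin 2) w.Completion)
    (hm : ∀ i j, {w : Place F | m w i j ∉ w.integers}.Finite) :
    Matrix (Fin 2) (Fin 2) (Adele F) :=
  fun i j => ⟨fun w => m w i j, hm i j⟩

theorem adelicMatrix_apply (m : ∀ w : Place F, Matrix (Fin 2) (Fin 2) w.Completion)
    (hm : ∀ i j, {w : Place F | m w i j ∉ w.integers}.Finite) (i j : Fin 2) (w : Place F) :
    adelicMatrix m hm i j w = m w i j := rfl

theorem adelicMatrix_mul_eq_one {m n : ∀ w : Place F, Matrix (Fin 2) (Fin 2) w.Completion}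
    (hm : ∀ i j, {w : Place F | m w i j ∉ w.integers}.Finite)
    (hn : ∀ i j, {w : Place F | n w i j ∉ w.integers}.Finite) (h : ∀ w, m w * n w = 1) :
    adelicMatrix m hm * adelicMatrix n hn = 1 := by
  ext i j w
  have h := congrArg (fun m : Matrix (Fin 2) (Fin 2) w.Completion => m i j) (h w)
  simp only [Matrix.mul_apply, Fin.sum_univ_two] at h
  rw [adelicMatrix_mul_apply]
  simp only [adelicMatrix_apply]
  rw [h]
  fin_cases i <;> fin_cases j <;> rfl

/-- The invertible matrix over the adeles with given components. -/
def mkAdelic (g : ∀ w : Place F, GL2 w.Completion)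
    (hg : {w : Place F | g w ∉ integralGL2 w.integers.toSubring}.Finite) : GL2 (Adele F) where
  val := adelicMatrix (fun w => (g w).val) fun i j => hg.subset fun _ hw h =>
    hw ((Place.mem_integralGL2_integers.1 h).1 i j)
  inv := adelicMatrix (fun w => (g w)⁻¹.val) fun i j => hg.subset fun _ hw h =>
    hw ((Place.mem_integralGL2_integers.1 (inv_mem h)).1 i j)
  val_inv := adelicMatrix_mul_eq_one _ _ fun w => congrArg Units.val (mul_inv_cancel (g w))
  inv_val := adelicMatrix_mul_eq_one _ _ fun w => congrArg Units.val (inv_mul_cancel (g w))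

@[simp]
theorem component_mkAdelic (g : ∀ w : Place F, GL2 w.Completion)
    (hg : {w : Place F | g w ∉ integralGL2 w.integers.toSubring}.Finite) (w : Place F) :
    component w (mkAdelic g hg) = g w := by
  ext i j
  have h : (mkAdelic g hg) i j w = (g w) i j :=
    adelicMatrix_apply (fun w => (g w).val) (fun i j => hg.subset fun _ hw h =>
      hw ((Place.mem_integralGL2_integers.1 h).1 i j)) i j w
  exact h

theorem finite_component_notMem (g : GL2 (Adele F)) :
    {w : Place F | component w g ∉ integralGL2 w.integers.toSubring}.Finite := by
  have h1 : ∀ a : Adele F, {w : Place F | ¬ a w ∈ w.integers}.Finite := fun a => a.2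
  refine (((Set.finite_iUnion fun i => Set.finite_iUnion fun j => h1 (g i j))).union
    (h1 (g⁻¹).val.det)).subset fun w hw => ?_
  by_contra hn
  simp only [Set.mem_union, Set.mem_iUnion, Set.mem_ofPred_eq, not_or, not_exists, not_not] at hn
  refine hw (mem_integralGL2_iff.2 ⟨hn.1, ?_⟩)
  have h2 : ((component w g).val.det)⁻¹ = (component w g⁻¹).val.det := by
    rw [map_inv, Matrix.coe_units_inv, Matrix.det_nonsing_inv, Ring.inverse_eq_inv']
  rw [h2]
  convert hn.2 using 1
  rw [Matrix.det_fin_two, Matrix.det_fin_two]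
  rfl

@[simp]
theorem component_fromLocal_same (v : Place F) (h : GL2 v.Completion) :
    component v (fromLocal v h) = h := by
  ext i j
  exact singleMatrix_apply_same v h.val i j

theorem component_fromLocal_ne {v w : Place F} (hw : w ≠ v) (h : GL2 v.Completion) :
    component w (fromLocal v h) = 1 := by
  ext i j
  exact singleMatrix_apply_ne v h.val i j hw

theorem fromLocal_mem_maxCompact {v : Place F} {κ : GL2 v.Completion}
    (hκ : κ ∈ integralGL2 v.integers.toSubring) : fromLocal v κ ∈ maxCompact F := by
  refine mem_maxCompact.2 fun w => ?_
  by_cases hw : w = v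
  · subst hw
    rwa [component_fromLocal_same]
  · rw [component_fromLocal_ne hw]
    exact one_mem _

theorem fromLocal_mem_center {v : Place F} {z : GL2 v.Completion}
    (hz : z ∈ Subgroup.center (GL2 v.Completion)) :
    fromLocal v z ∈ Subgroup.center (GL2 (Adele F)) := by
  refine Subgroup.mem_center_iff.2 fun g => component_injective fun w => ?_
  rw [map_mul, map_mul]
  by_cases hw : w = v
  · subst hw
    rw [component_fromLocal_same]
    exact Subgroup.mem_center_iff.1 hz _
  · rw [component_fromLocal_ne hw, mul_one, one_mul]

theorem mul_fromLocal_comm {v : Place F} {g : GL2 (Adele F)} (hg : component v g = 1)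
    (h : GL2 v.Completion) : g * fromLocal v h = fromLocal v h * g := by
  refine component_injective fun w => ?_
  rw [map_mul, map_mul]
  by_cases hw : w = v
  · subst hw
    rw [hg, one_mul, mul_one]
  · rw [component_fromLocal_ne hw, one_mul, mul_one]

section AutomorphicForms

variable {f : GL2 (Adele F) → ℂ} (hf : f ∈ automorphicForms F)

include hf

theorem apply_diagonal_mul {γ : GL2 (Adele F)} (hγ : γ ∈ diagonal (⊤ : Subgroup (GL2 F)))
    (g : GL2 (Adele F)) : f (γ * g) = f g := by
  simpa using hf γ hγ 1 (one_mem _) 1 (one_mem _) g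

theorem apply_mul_maxCompact {κ : GL2 (Adele F)} (hκ : κ ∈ maxCompact F)
    (g : GL2 (Adele F)) : f (g * κ) = f g := by
  simpa using hf 1 (one_mem _) κ hκ 1 (one_mem _) g

theorem apply_mul_center {z : GL2 (Adele F)} (hz : z ∈ Subgroup.center (GL2 (Adele F)))
    (g : GL2 (Adele F)) : f (g * z) = f g := by
  simpa using hf 1 (one_mem _) 1 (one_mem _) z hz g

theorem apply_mul_fromLocal_out (v : Place F) (g : GL2 (Adele F)) (h : GL2 v.Completion) :
    f (g * fromLocal v (Quotient.out (QuotientGroup.mk h : TreeVertex v))) =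
      f (g * fromLocal v h) := by
  obtain ⟨s, hs⟩ : ∃ s : GL2 v.Completion,
      Quotient.out (QuotientGroup.mk h : TreeVertex v) = h * s ∧ s ∈
      integralGL2 v.integers.toSubring ⊔ Subgroup.center (GL2 v.Completion) := by
    refine ⟨h⁻¹ * Quotient.out (QuotientGroup.mk h : TreeVertex v), by simp, ?_⟩
    rw [← QuotientGroup.eq]
    exact (Quotient.out_eq _).symm
  obtain ⟨κ, hκ, z, hz, rfl⟩ := Subgroup.mem_sup_of_normal_right.1 hs.2
  rw [hs.1, ← mul_assoc, map_mul, map_mul, ← mul_assoc, ← mul_assoc,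
    apply_mul_center hf (fromLocal_mem_center hz), apply_mul_maxCompact hf
      (fromLocal_mem_maxCompact hκ)]

theorem toTree_mk (v : Place F) (h : GL2 v.Completion) :
    toTree v f (QuotientGroup.mk h) = f (fromLocal v h) := by
  have := apply_mul_fromLocal_out hf v 1 h
  rw [one_mul, one_mul] at this
  exact this

end AutomorphicForms

end Adelic

namespace PointlessCurve

variable {k F : Type*} [Field k] [Fintype k] [Field F] [Algebra k F] (C : PointlessCurve k F)
  {v : Place F} (hv : C.x ∉ v.1)

include hv in
theorem finite_toLocal_notMem (γ : GL2 F) :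
    {w : Place F | toLocal w γ ∉ integralGL2 w.integers.toSubring}.Finite := by
  refine (((Set.finite_iUnion fun i => Set.finite_iUnion fun j => C.finite_poles hv (γ i j))).union
    (C.finite_poles hv (γ.val.det)⁻¹)).subset fun w hw => ?_
  by_contra hn
  simp only [Set.mem_union, Set.mem_iUnion, Set.mem_ofPred_eq, not_or, not_exists, not_not] at hn
  exact hw (Place.toLocal_mem_integralGL2_iff.2 (mem_integralGL2_iff.2 hn))

/-- The diagonal embedding. -/
def diag (hv : C.x ∉ v.1) (γ : GL2 F) : GL2 (Adele F) :=
  mkAdelic (fun w => toLocal w γ) (C.finite_toLocal_notMem hv γ)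

theorem component_diag (w : Place F) (γ : GL2 F) : component w (C.diag hv γ) = toLocal w γ :=
  component_mkAdelic _ _ _

theorem diag_mem {H : Subgroup (GL2 F)} {γ : GL2 F} (hγ : γ ∈ H) : C.diag hv γ ∈ diagonal H :=
  mem_diagonal.2 ⟨γ, hγ, fun w => (C.component_diag hv w γ).symm⟩

include hv in
-- A global matrix that makes `g` integral away from `v` moves it, up to `K`, into the factor at
-- `v`.
theorem apply_eq_toTree {f : GL2 (Adele F) → ℂ} (hf : f ∈ automorphicForms F)
    {g : GL2 (Adele F)} {ε : GL2 F}
    (h : ∀ w, w ≠ v → toLocal w ε * component w g ∈ integralGL2 w.integers.toSubring) :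
    f g = toTree v f (QuotientGroup.mk (toLocal v ε * component v g)) := by
  rw [toTree_mk hf, ← apply_diagonal_mul hf (C.diag_mem hv (Subgroup.mem_top ε)) g]
  rw [← apply_mul_maxCompact hf (g := fromLocal v (toLocal v ε * component v g))
    (κ := (fromLocal v (toLocal v ε * component v g))⁻¹ * (C.diag hv ε * g)), mul_inv_cancel_left]
  refine mem_maxCompact.2 fun w => ?_
  rw [map_mul, map_inv, map_mul (component w) (C.diag hv ε), component_diag]
  by_cases hw : w = v
  · subst hw
    rw [component_fromLocal_same, inv_mul_cancel]
    exact one_mem _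
  · rw [component_fromLocal_ne hw, inv_one, one_mul]
    exact h w hw

include hv in
theorem toTree_mem {f : GL2 (Adele F) → ℂ} (hf : f ∈ automorphicForms F) :
    toTree v f ∈ quotientGraphFunctions v := by
  intro γ hγ x
  obtain ⟨g, rfl⟩ := QuotientGroup.mk_surjective x
  rw [toTree_mk hf, C.apply_eq_toTree hv hf (g := fromLocal v g) (ε := γ) fun w hw => ?_,
    component_fromLocal_same]
  · rfl
  · rw [component_fromLocal_ne hw, mul_one, Place.toLocal_mem_integralGL2_iff]
    obtain ⟨h1, e, he, h2⟩ := (C.mem_integralGL2_holomorphicOutside_iff hv).1 hγ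
    refine mem_integralGL2_iff.2 ⟨fun i j => C.A_le hv hw (h1 i j), ?_⟩
    rw [h2, ← map_inv₀]
    exact algebraMap_mem w.1 _

include hv in
/-- Strong approximation. -/
theorem exists_toLocal_mul_mem (g : GL2 (Adele F)) : ∃ γ : GL2 F, ∀ w, w ≠ v →
    toLocal w γ * component w g ∈ integralGL2 w.integers.toSubring := by
  have key : ∀ s : Finset (Place F), ∀ g : GL2 (Adele F),
      (∀ w, w ≠ v → w ∉ s → component w g ∈ integralGL2 w.integers.toSubring) →
      ∃ γ : GL2 F, ∀ w, w ≠ v → toLocal w γ * component w g ∈ integralGL2 w.integers.toSubring := by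
    classical
    intro s
    induction s using Finset.induction_on with
    | empty => exact fun g hg => ⟨1, fun w hw => by simpa using hg w hw (by simp)⟩
    | insert u s hu ih =>
      intro g hg
      by_cases huv : u = v
      · subst huv
        exact ih g fun w hw hws => hg w hw (by simp [hw, hws])
      obtain ⟨ϖ, hϖ, hϖA, -, hϖ1, happ⟩ := C.exists_uniformizer hv huv
      obtain ⟨i, j, b, hb, κ, hκ, h⟩ := hϖ.exists_upperMat_mul
        (B := {b | ∃ m : ℤ, ∃ c ∈ C.A, b = (ϖ : F) ^ m * c}) (fun f n => by
          obtain ⟨m, c, hc, h, -⟩ := happ f n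
          exact ⟨_, ⟨m, c, hc, rfl⟩, h⟩) (component u g)
      obtain ⟨m, c, hc, rfl⟩ := hb
      set U := upperMat (ϖ ^ i) (ϖ ^ j) ((ϖ : F) ^ m * c) with hU
      -- The bad places are removed one at a time. The triangular matrix that repairs `u` has
      -- entries built from a uniformizer that is a unit elsewhere and from elements of `A`, so it
      -- spoils no other finite place.
      have hUw : ∀ w, w ≠ v → w ≠ u → toLocal w U ∈ integralGL2 w.integers.toSubring := by
        intro w hw hwu
        have h1 := hϖ1 w hw hwu
        rw [Place.toLocal_mem_integralGL2_iff, Place.mem_integralGL2_place]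
        refine ⟨fun r s => ?_, ?_⟩
        · fin_cases r <;> fin_cases s
          · simp [hU, upperMat, Units.val_zpow_eq_zpow_val, h1]
          · simpa [hU, upperMat, h1] using C.A_le hv hw hc
          · simp [hU, upperMat]
          · simp [hU, upperMat, Units.val_zpow_eq_zpow_val, h1]
        · rw [Matrix.det_fin_two]
          simp [hU, upperMat, Units.val_zpow_eq_zpow_val, h1]
      obtain ⟨γ, hγ⟩ := ih (C.diag hv U⁻¹ * g) fun w hw hws => by
        rw [map_mul, component_diag]
        by_cases hwu : w = u
        · subst hwu
          rwa [h, map_inv, inv_mul_cancel_left]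
        · rw [map_inv]
          exact mul_mem (inv_mem (hUw w hw hwu)) (hg w hw (by simp [hwu, hws]))
      refine ⟨γ * U⁻¹, fun w hw => ?_⟩
      rw [map_mul, mul_assoc]
      exact hγ w hw
  exact key (finite_component_notMem g).toFinset g fun w _ hw => by simpa using hw

include hv in
theorem toTree_injective {f f' : GL2 (Adele F) → ℂ} (hf : f ∈ automorphicForms F)
    (hf' : f' ∈ automorphicForms F) (h : toTree v f = toTree v f') : f = f' := by
  funext g
  obtain ⟨γ, hγ⟩ := C.exists_toLocal_mul_mem hv g
  rw [C.apply_eq_toTree hv hf hγ, C.apply_eq_toTree hv hf' hγ, h]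

/-! ### The Hecke operator on automorphic forms -/

variable (v) in
/-- The Hecke operator at the place at infinity. -/
def hecke (f : GL2 (Adele F) → ℂ) (g : GL2 (Adele F)) : ℂ :=
  heckeOp v C.t (fun y => f (g * fromLocal v (Quotient.out y))) (QuotientGroup.mk 1)

include hv in
theorem heckeOp_fun {f : GL2 (Adele F) → ℂ} (hf : f ∈ automorphicForms F) (g : GL2 (Adele F))
    (h : GL2 v.Completion) :
    heckeOp v C.t (fun y => f (g * fromLocal v (Quotient.out y))) (QuotientGroup.mk h) =
      f (g * fromLocal v (h * toLocal v (affineMat C.t⁻¹ 0))) +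
      ∑ c : k, f (g * fromLocal v (h * toLocal v (affineMat C.t (algebraMap k F c)))) := by
  rw [(C.isUniformizer_t hv).heckeOp_mk (k := k) (fun f hf => C.exists_const hv hf)]
  simp only [apply_mul_fromLocal_out hf]

include hv in
theorem hecke_apply {f : GL2 (Adele F) → ℂ} (hf : f ∈ automorphicForms F) (g : GL2 (Adele F)) :
    C.hecke v f g = f (g * fromLocal v (toLocal v (affineMat C.t⁻¹ 0))) +
      ∑ c : k, f (g * fromLocal v (toLocal v (affineMat C.t (algebraMap k F c)))) := by
  rw [hecke, C.heckeOp_fun hv hf]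
  simp only [one_mul]

include hv in
theorem toTree_hecke {f : GL2 (Adele F) → ℂ} (hf : f ∈ automorphicForms F) :
    toTree v (C.hecke v f) = heckeOp v C.t (toTree v f) := by
  funext x
  rw [toTree, C.hecke_apply hv hf]
  conv_rhs => rw [← Quotient.out_eq x]
  change _ = heckeOp v C.t (toTree v f) (QuotientGroup.mk _)
  rw [(C.isUniformizer_t hv).heckeOp_mk (k := k) (fun f hf => C.exists_const hv hf)]
  simp only [toTree_mk hf, map_mul]

include hv in
-- The component of `κ` at `v` permutes the neighbours of the base vertex, and the rest of `κ`
-- commutes with the factor at `v`.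
theorem hecke_mem {f : GL2 (Adele F) → ℂ} (hf : f ∈ automorphicForms F) :
    C.hecke v f ∈ automorphicForms F := by
  have hκ' : ∀ κ ∈ maxCompact F, ∀ (g : GL2 (Adele F)) (h : GL2 v.Completion),
      f (g * κ * fromLocal v h) = f (g * fromLocal v (component v κ * h)) := by
    intro κ hκ g h
    set κ' := (fromLocal v (component v κ))⁻¹ * κ with hκ'
    have hκ'' : κ' ∈ maxCompact F := mul_mem (inv_mem (fromLocal_mem_maxCompact
      (mem_maxCompact.1 hκ v))) hκ
    have hcomm : κ' * fromLocal v h = fromLocal v h * κ' := mul_fromLocal_comm (by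
      rw [hκ', map_mul, map_inv, component_fromLocal_same, inv_mul_cancel]) h
    have e : g * κ * fromLocal v h = g * fromLocal v (component v κ * h) * κ' := by
      rw [map_mul, mul_assoc, mul_assoc, mul_assoc, ← hcomm, hκ', mul_assoc, mul_inv_cancel_left]
    rw [e, apply_mul_maxCompact hf hκ'']
  intro γ hγ κ hκ z hz g
  have e1 : ∀ h : GL2 v.Completion, f (γ * g * (κ * z) * fromLocal v h) =
      f (g * fromLocal v (component v κ * h)) := by
    intro h
    have e2 : γ * g * (κ * z) * fromLocal v h = γ * (g * κ * fromLocal v h) * z := by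
      rw [← mul_assoc, mul_assoc _ z, ← Subgroup.mem_center_iff.1 hz]
      simp only [mul_assoc]
    rw [e2, apply_mul_center hf hz, apply_diagonal_mul hf hγ, hκ' κ hκ]
  rw [C.hecke_apply hv hf]
  simp only [e1]
  rw [← C.heckeOp_fun hv hf, hecke]
  congr 1
  rw [QuotientGroup.eq, mul_one]
  exact Subgroup.mem_sup_left (inv_mem (mem_maxCompact.1 hκ v))

include hv in
-- The operator is a finite sum of right translations, and the toroidal condition is imposed for all
-- translates.
theorem hecke_mem_toroidalFor {E : Type*} [Field E] [Algebra F E] {b : Module.Basis (Fin 2) F E}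
    {f : GL2 (Adele F) → ℂ} (hf : f ∈ toroidalFor b) : C.hecke v f ∈ toroidalFor b := by
  obtain ⟨hf, hf'⟩ := hf
  refine ⟨C.hecke_mem hv hf, fun g μ hμ => ?_⟩
  have e : toralTranslate b (C.hecke v f) g =
      toralTranslate b f (g * fromLocal v (toLocal v (affineMat C.t⁻¹ 0))) + ∑ c : k,
        toralTranslate b f (g * fromLocal v (toLocal v (affineMat C.t (algebraMap k F c)))) := by
    funext x
    rw [Pi.add_apply, Finset.sum_apply]
    simp only [toralTranslate, C.hecke_apply hv hf, mul_assoc]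
  have hs := MeasureTheory.integrable_finsetSum' (μ := μ) Finset.univ fun (c : k) _ =>
    (hf' (g * fromLocal v (toLocal v (affineMat C.t (algebraMap k F c)))) μ hμ).1
  rw [e]
  refine ⟨(hf' _ μ hμ).1.add hs, ?_⟩
  rw [MeasureTheory.integral_add' (hf' _ μ hμ).1 hs, (hf' _ μ hμ).2, zero_add]
  simp only [Finset.sum_apply]
  rw [MeasureTheory.integral_finsetSum _ fun (c : k) _ =>
    (hf' (g * fromLocal v (toLocal v (affineMat C.t (algebraMap k F c)))) μ hμ).1]
  exact Finset.sum_eq_zero fun c _ => (hf' _ μ hμ).2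

end PointlessCurve
end Toroidal
end

open scoped RestrictedProduct

noncomputable section

namespace Toroidal

/-! ### Quadratic endomorphisms of the vertices -/

namespace PointlessCurve

variable {k F : Type*} [Field k] [Fintype k] [Field F] [Algebra k F] (C : PointlessCurve k F)
  {v : Place F} (hv : C.x ∉ v.1)

variable {C} in
omit [Fintype k] in
theorem IsHom.sub {n : ℤ} {β β' a b c d a' b' c' d' : F} (h : C.IsHom v n β β' a b c d)
    (h' : C.IsHom v n β β' a' b' c' d') :
    C.IsHom v n β β' (a - a') (b - b') (c - c') (d - d') where
  mem_a := sub_mem h.mem_a h'.mem_a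
  mem_b := sub_mem h.mem_b h'.mem_b
  mem_c := sub_mem h.mem_c h'.mem_c
  mem_d := sub_mem h.mem_d h'.mem_d
  le_a := by
    convert v.1.valuation.map_sub_le h.le_a h'.le_a using 2
    ring
  le_b := by
    convert v.1.valuation.map_sub_le h.le_b h'.le_b using 2
    ring
  le_c := v.1.valuation.map_sub_le h.le_c h'.le_c
  le_d := by
    convert v.1.valuation.map_sub_le h.le_d h'.le_d using 2
    ring

variable {C} in
theorem IsHom.const_mul {n : ℤ} {β β' a b c d : F} (h : C.IsHom v n β β' a b c d) (e : k) :
    C.IsHom v n β β' (algebraMap k F e * a) (algebraMap k F e * b) (algebraMap k F e * c)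
      (algebraMap k F e * d) where
  mem_a := mul_mem (C.A.algebraMap_mem _) h.mem_a
  mem_b := mul_mem (C.A.algebraMap_mem _) h.mem_b
  mem_c := mul_mem (C.A.algebraMap_mem _) h.mem_c
  mem_d := mul_mem (C.A.algebraMap_mem _) h.mem_d
  le_a := by
    convert valuation_const_mul_le e h.le_a using 2
    ring
  le_b := by
    convert valuation_const_mul_le e h.le_b using 2
    ring
  le_c := valuation_const_mul_le e h.le_c
  le_d := by
    convert valuation_const_mul_le e h.le_d using 2
    ring

include hv in
theorem valuation_x_sub (l : k) :
    v.1.valuation (C.x - algebraMap k F l) = v.1.valuation (C.t : F) ^ (-2 : ℤ) := by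
  rw [← C.valuation_x hv, sub_eq_add_neg, ← map_neg]
  refine Valuation.map_add_eq_of_lt_left _ ?_
  rw [C.valuation_x hv]
  refine (C.valuation_const_le hv (-l) (n := 0) le_rfl).trans_lt ?_
  exact (C.zpow_t_lt_iff hv).2 (by norm_num)

include hv in
theorem x_sub_ne_zero (l : k) : C.x - algebraMap k F l ≠ 0 := by
  rw [← Valuation.ne_zero_iff v.1.valuation, C.valuation_x_sub hv]
  exact zpow_ne_zero _ (C.valuation_t_pos v.1).ne'

include hv in
theorem valuation_y_sub_le (l : k) :
    v.1.valuation (C.y - C.tParam l * (C.x - algebraMap k F l)) ≤ 1 := by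
  have h := C.valuation_tParam_mul_sub hv l 1 (-l)
  rw [← Valuation.map_neg]
  convert h.trans (C.valuation_t_lt_one hv).le using 2
  simp only [map_one, one_mul, add_neg_cancel, map_zero, zero_mul, add_zero, map_neg]
  ring

include hv in
/-- The basic endomorphism of the vertex `t_l`. -/
theorem isHom_t (l : k) : C.IsHom v 2 (C.tParam l) (C.tParam l) C.y (-C.cofactor l)
    (C.x - algebraMap k F l) (-C.y - algebraMap k F C.a₃) := by
  have hpos := C.valuation_t_pos v.1
  have hc0 := C.x_sub_ne_zero hv l
  have vd : v.1.valuation ((C.x - algebraMap k F l) * C.tParam l + (-C.y - algebraMap k F C.a₃))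
      ≤ 1 := by
    rw [← Valuation.map_neg]
    convert v.1.valuation.map_add_le (C.valuation_y_sub_le hv l) (valuation_algebraMap_le v.1 C.a₃)
      using 2
    ring
  refine ⟨C.y_mem, neg_mem (C.cofactor_mem l), sub_mem C.x_mem (C.A.algebraMap_mem _),
    sub_mem (neg_mem C.y_mem) (C.A.algebraMap_mem _), C.valuation_y_sub_le hv l, ?_,
    (C.valuation_x_sub hv l).le, vd⟩
  -- Again the last entry comes from the other three and the constant determinant, after division by
  -- x - l.
  have e : C.y * C.tParam l + -C.cofactor l - C.tParam l * ((C.x - algebraMap k F l) * C.tParam l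
      + (-C.y - algebraMap k F C.a₃)) = ((C.y - C.tParam l * (C.x - algebraMap k F l)) *
      ((C.x - algebraMap k F l) * C.tParam l + (-C.y - algebraMap k F C.a₃))
      + algebraMap k F (l ^ 3 + C.a₄ * l + C.a₆)) / (C.x - algebraMap k F l) := by
    rw [eq_div_iff hc0]
    linear_combination -C.cofactor_mul l
  rw [e, map_div₀, div_le_iff₀ (by rw [C.valuation_x_sub hv]; exact zpow_pos hpos _),
    C.valuation_x_sub hv, ← zpow_add₀ hpos.ne', show (2 : ℤ) + -2 = 0 by norm_num, zpow_zero]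
  refine v.1.valuation.map_add_le ?_ (valuation_algebraMap_le v.1 _)
  rw [map_mul]
  exact mul_le_one' (C.valuation_y_sub_le hv l) vd

include hv in
/-- The endomorphism ring of the vertex `t_l`. -/
theorem exists_of_isHom_t {l : k} {a b c d : F}
    (h : C.IsHom v 2 (C.tParam l) (C.tParam l) a b c d) : ∃ c₁ e : k,
      a = algebraMap k F c₁ * C.y + algebraMap k F e ∧ b = -(algebraMap k F c₁ * C.cofactor l) ∧
      c = algebraMap k F c₁ * (C.x - algebraMap k F l) ∧
      d = -(algebraMap k F c₁ * (C.y + algebraMap k F C.a₃)) + algebraMap k F e := by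
  obtain ⟨c₁, c₀, hc, hl, -⟩ := h.eq_linear hv
  -- Subtracting a constant multiple of the basic endomorphism clears the lower left entry, and what
  -- remains is scalar.
  have h1 := h.sub ((C.isHom_t hv l).const_mul c₁)
  have hc' : c - algebraMap k F c₁ * (C.x - algebraMap k F l) = algebraMap k F 0 := by
    have := congrArg (algebraMap k F) hl
    rw [map_add, map_mul] at this
    rw [hc]
    linear_combination this
  obtain ⟨h2, h3, e, h4, h5, -⟩ := h1.eq_scalar hv hc'
  exact ⟨c₁, e, by linear_combination h4, by linear_combination h3, by linear_combination h2,
    by linear_combination h5⟩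

include hv in
/-- The field of constants has no quadratic extension inside `F`. -/
theorem no_root (f : F) : f ^ 2 + algebraMap k F C.a₃ * f ≠ algebraMap k F C.a₆ := by
  intro h
  -- A root is integral over the constants, hence integral at every place and therefore constant. A
  -- constant root c would give the rational point (0, c).
  have hle : ∀ w : Place F, w.1.valuation f ≤ 1 := by
    intro w
    by_contra hlt
    rw [not_le] at hlt
    have h1 : w.1.valuation (f ^ 2 + algebraMap k F C.a₃ * f) = w.1.valuation (f ^ 2) := by
      refine Valuation.map_add_eq_of_lt_left _ ?_
      rw [map_pow, sq]
      refine (valuation_const_mul_le C.a₃ le_rfl).trans_lt ?_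
      exact lt_mul_of_one_lt_left (zero_lt_one.trans hlt) hlt
    rw [h, map_pow] at h1
    exact absurd (h1 ▸ valuation_algebraMap_le w.1 C.a₆) (not_le.2 (one_lt_pow₀ hlt two_ne_zero))
  have hA : f ∈ C.A := by
    rw [← C.mem_holomorphicOutside_iff hv, holomorphicOutside, Subring.mem_iInf]
    exact fun w => (w.1.1.valuation_le_one_iff f).1 (hle w.1)
  obtain ⟨c, rfl⟩ := C.eq_const_of_mem hv hA ((hle v).trans (C.one_le_zpow hv (by norm_num)))
  refine C.no_point 0 c ?_
  have : algebraMap k F (c ^ 2 + C.a₃ * c) = algebraMap k F C.a₆ := by rw [← h]; simp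
  rw [(algebraMap k F).injective this]
  ring

/-- The coefficients of the quadratic endomorphisms of a vertex `t_l` that are roots of a fixed
polynomial. -/
def rootCoeff (u : k) : Bool → k × k
  -- If J denotes the basic endomorphism of t_l, these are J + u and its conjugate -J - a₃ - u, the
  -- two roots of X² + a₃ X - a₆.
  | true => (1, u)
  | false => (-1, -C.a₃ - u)

omit [Fintype k] in
-- Comparison of discriminants: since 2u = 0, that of J equals a₃² + 4a₆, and that of c₁J + e is c₁²
-- times it, so c₁² = 1. The rest is the bookkeeping of signs, which collapse in characteristic 2.
theorem eq_rootCoeff {l u c₁ e : k} (hu : 2 * u = 0) (hu' : u ^ 2 + C.a₃ * u = l ^ 3 + C.a₄ * l)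
    (h1 : 2 * e - c₁ * C.a₃ = -C.a₃)
    (h2 : e ^ 2 - c₁ * C.a₃ * e - c₁ ^ 2 * (l ^ 3 + C.a₄ * l + C.a₆) = -C.a₆) :
    ∃ s, (c₁, e) = C.rootCoeff u s := by
  have hd : C.a₃ ^ 2 + 4 * C.a₆ ≠ 0 := by
    have := C.disc_ne_zero 0
    simpa using this
  have h3 : (c₁ - 1) * (c₁ + 1) = 0 := by
    have : (c₁ - 1) * (c₁ + 1) * (C.a₃ ^ 2 + 4 * C.a₆) = 0 := by
      linear_combination (2 * e - c₁ * C.a₃ - C.a₃) * h1 - 4 * h2 + 4 * c₁ ^ 2 * hu'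
        - 2 * c₁ ^ 2 * u * hu - 2 * c₁ ^ 2 * C.a₃ * hu
    exact (mul_eq_zero.1 this).resolve_right hd
  rcases mul_eq_zero.1 h3 with h | h
  · obtain rfl : c₁ = 1 := sub_eq_zero.1 h
    have h4 : (e - u) * (e + u - C.a₃) = 0 := by
      linear_combination h2 - hu' + C.a₃ * hu
    rcases mul_eq_zero.1 h4 with h | h
    · exact ⟨true, by rw [sub_eq_zero.1 h]; rfl⟩
    · have h5 : 2 * C.a₃ = 0 := by linear_combination h1 - 2 * h + hu
      rcases mul_eq_zero.1 h5 with h6 | h6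
      · refine ⟨false, Prod.ext ?_ ?_⟩
        · change (1 : k) = -1
          linear_combination h6
        · change e = -C.a₃ - u
          linear_combination h + C.a₃ * h6
      · refine ⟨true, Prod.ext rfl ?_⟩
        change e = u
        linear_combination h + h6 - hu
  · obtain rfl : c₁ = -1 := eq_neg_of_add_eq_zero_left h
    have h4 : (e - u) * (e + u + C.a₃) = 0 := by
      linear_combination h2 - hu'
    rcases mul_eq_zero.1 h4 with h | h
    · have h5 : 2 * C.a₃ = 0 := by linear_combination h1 - 2 * h - hu
      rcases mul_eq_zero.1 h5 with h6 | h6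
      · refine ⟨true, Prod.ext ?_ (sub_eq_zero.1 h)⟩
        change (-1 : k) = 1
        linear_combination -h6
      · refine ⟨false, Prod.ext rfl ?_⟩
        change e = -C.a₃ - u
        linear_combination h + h6 + hu
    · refine ⟨false, Prod.ext rfl ?_⟩
      change e = -C.a₃ - u
      linear_combination h

include hv in
/-- The vertices with a quadratic endomorphism of given trace and determinant. -/
theorem label_of_isHom {L : Label k} {a b c d : F} {u : k → k} (hu : ∀ l, 2 * u l = 0)
    (hu' : ∀ l, u l ^ 2 + C.a₃ * u l = l ^ 3 + C.a₄ * l)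
    (h : C.IsHom v (L.deg k) (C.par L) (C.par L) a b c d) (htr : a + d = -algebraMap k F C.a₃)
    (hdet : a * d - b * c = -algebraMap k F C.a₆) :
    (L = .c 0 ∧ ∃ a₀ b₀ c₀ d₀ : k, a = algebraMap k F a₀ ∧ b = algebraMap k F b₀ ∧
      c = algebraMap k F c₀ ∧ d = algebraMap k F d₀) ∨
    ∃ l, L = .t l ∧ ∃ s, a = algebraMap k F (C.rootCoeff (u l) s).1 * C.y
        + algebraMap k F (C.rootCoeff (u l) s).2 ∧
      c = algebraMap k F (C.rootCoeff (u l) s).1 * (C.x - algebraMap k F l) := by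
  have hconst : ∀ {f : F}, f ∈ C.A → v.1.valuation f ≤ 1 → ∃ c : k, f = algebraMap k F c :=
    fun hf h => C.eq_const_of_mem hv hf (h.trans (C.one_le_zpow hv (by norm_num)))
  -- A triangular matrix would have an eigenvalue in `F`.
  have hcon : c ≠ 0 := by
    rintro rfl
    refine C.no_root hv a ?_
    linear_combination a * htr - hdet
  -- At z_0 and z_1 the lower left entry is constant, and the simple pole of the parameter forces it
  -- to vanish. At c_n with n > 0 it vanishes at infinity.
  have hz : ∀ n : ℤ, C.IsHom v n (C.t : F)⁻¹ (C.t : F)⁻¹ a b c d → ¬ n ≤ 1 := by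
    intro n h hn
    obtain ⟨c₀, rfl⟩ := C.eq_const_of_mem hv h.mem_c
      (h.le_c.trans ((C.zpow_t_le_iff hv).2 (by omega)))
    have h1 := (C.eq_zero_of_add_inv_t hv h.mem_a (e := -c₀) (by
      rw [map_neg, neg_mul, ← sub_eq_add_neg, mul_comm]; exact h.le_a)).1
    rw [neg_eq_zero] at h1
    exact hcon (by rw [h1, map_zero])
  cases L with
  | c n =>
    have ha := h.le_a
    have hb := h.le_b
    have hc := h.le_c
    have hd := h.le_d
    simp only [par, Label.deg, mul_zero, zero_mul, sub_zero, zero_add, neg_neg] at ha hb hc hd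
    rcases n with _ | n
    · refine Or.inl ⟨rfl, ?_⟩
      simp only [Nat.cast_zero, neg_zero, zpow_zero] at hb hc
      obtain ⟨a₀, ha⟩ := hconst h.mem_a ha
      obtain ⟨b₀, hb⟩ := hconst h.mem_b hb
      obtain ⟨c₀, hc⟩ := hconst h.mem_c hc
      obtain ⟨d₀, hd⟩ := hconst h.mem_d hd
      exact ⟨a₀, b₀, c₀, d₀, ha, hb, hc, hd⟩
    · refine absurd (C.eq_zero_of_mem hv h.mem_c (hc.trans_lt ?_)) hcon
      rw [← zpow_zero (v.1.valuation (C.t : F)), C.zpow_t_lt_iff hv]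
      omega
  | z₀ => exact absurd (by simp [Label.deg]) (hz _ h)
  | z₁ => exact absurd (by simp [Label.deg]) (hz _ h)
  | t l =>
    obtain ⟨c₁, e, rfl, rfl, rfl, rfl⟩ := C.exists_of_isHom_t hv h
    refine Or.inr ⟨l, rfl, ?_⟩
    obtain ⟨s, hs⟩ := C.eq_rootCoeff (l := l) (u := u l) (c₁ := c₁) (e := e) (hu l) (hu' l)
      ((algebraMap k F).injective (by
        simp only [map_sub, map_mul, map_neg, map_ofNat]
        linear_combination htr))
      ((algebraMap k F).injective (by
        have := C.cofactor_mul l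
        simp only [map_sub, map_add, map_mul, map_neg, map_pow] at this ⊢
        linear_combination hdet - algebraMap k F c₁ ^ 2 * this))
    exact ⟨s, by rw [← hs], by rw [← hs]⟩

end PointlessCurve
end Toroidal
end

open scoped RestrictedProduct

noncomputable section

namespace Toroidal

/-! ### The classes of the torus -/

/-- The standard maximal compact subgroup at a place. -/
abbrev Place.maximalCompact {F : Type*} [Field F] (w : Place F) : Subgroup (GL2 w.Completion) :=
  integralGL2 w.integers.toSubring

theorem mul_companion_eq_iff {R : Type*} [CommRing R] (n a : R) (h : Matrix (Fin 2) (Fin 2) R) :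
    h * !![0, n; 1, -a] = !![0, n; 1, -a] * h ↔ h 0 1 = n * h 1 0 ∧ h 1 1 = h 0 0 - a * h 1 0 := by
  constructor
  · intro H
    have h1 := congrFun (congrFun H 0) 0
    have h2 := congrFun (congrFun H 1) 0
    simp [Matrix.mul_apply, Fin.sum_univ_two] at h1 h2
    exact ⟨h1, by linear_combination h2⟩
  · rintro ⟨h1, h2⟩
    ext i j
    fin_cases i <;> fin_cases j <;> simp [Matrix.mul_apply, Fin.sum_univ_two, h1, h2] <;> ring

namespace PointlessCurve

variable {k F : Type*} [Field k] [Field F] [Algebra k F] (C : PointlessCurve k F)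
  {v : Place F} (hv : C.x ∉ v.1)

theorem a₆_ne_zero : C.a₆ ≠ 0 := by
  intro h
  exact C.no_point 0 0 (by rw [h]; ring)

/-- The companion matrix of `X² + a₃ X - a₆`. -/
def companion : GL2 F := mat 0 (algebraMap k F C.a₆) 1 (-algebraMap k F C.a₃)
  (by simpa using C.a₆_ne_zero)

theorem val_companion :
    C.companion.val = !![0, algebraMap k F C.a₆; 1, -algebraMap k F C.a₃] := rfl

theorem commute_toLocal_companion_iff {w : Place F} {h : GL2 w.Completion} :
    Commute h (toLocal w C.companion) ↔
      h 0 1 = algebraMap F w.Completion (algebraMap k F C.a₆) * h 1 0 ∧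
      h 1 1 = h 0 0 - algebraMap F w.Completion (algebraMap k F C.a₃) * h 1 0 := by
  have e : (toLocal w C.companion).val = !![0, algebraMap F w.Completion (algebraMap k F C.a₆);
      1, -algebraMap F w.Completion (algebraMap k F C.a₃)] := by
    ext i j
    change algebraMap F w.Completion (C.companion i j) = _
    fin_cases i <;> fin_cases j <;> simp [companion, mat]
  rw [← mul_companion_eq_iff, ← e]
  exact Units.ext_iff

/-- The columns are the first basis vector and its image. In this cyclic basis the matrix becomes
the companion matrix, by Cayley-Hamilton. -/
theorem mat_mul_mat_eq {a b c d : F} (h : a * d - b * c ≠ 0) (hc : 1 * c - a * 0 ≠ 0)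
    (htr : a + d = -algebraMap k F C.a₃) (hdet : a * d - b * c = -algebraMap k F C.a₆) :
    mat a b c d h * mat 1 a 0 c hc = mat 1 a 0 c hc * C.companion := by
  apply Units.ext
  rw [Units.val_mul, Units.val_mul, val_mat, val_mat, val_companion]
  ext i j
  fin_cases i <;> fin_cases j <;> simp [Matrix.mul_apply, Fin.sum_univ_two]
  · linear_combination a * htr - hdet
  · linear_combination c * htr

theorem trace_det_of_mul_eq {θ ε : GL2 F} (h : θ * ε = ε * C.companion) :
    θ 0 0 + θ 1 1 = -algebraMap k F C.a₃ ∧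
      θ 0 0 * θ 1 1 - θ 0 1 * θ 1 0 = -algebraMap k F C.a₆ := by
  obtain rfl : θ = ε * C.companion * ε⁻¹ := by rw [← h, mul_inv_cancel_right]
  constructor
  · rw [← Matrix.trace_fin_two, Units.val_mul, Units.val_mul, Matrix.trace_units_conj,
      val_companion, Matrix.trace_fin_two_of]
    ring
  · rw [← Matrix.det_fin_two, Units.val_mul, Units.val_mul, Matrix.det_units_conj,
      val_companion, Matrix.det_fin_two_of]
    ring

variable [Fintype k]

theorem mem_maximalCompact_of_const {γ : GL2 F} (h : ∀ i j, ∃ c : k, γ i j = algebraMap k F c)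
    (w : Place F) : toLocal w γ ∈ w.maximalCompact := by
  rw [Place.toLocal_mem_integralGL2_iff, Place.mem_integralGL2_place]
  refine ⟨fun i j => ?_, ?_⟩
  · obtain ⟨c, hc⟩ := h i j
    rw [hc]
    exact valuation_algebraMap_le _ _
  · choose c hc using h
    have h1 : γ.val.det = algebraMap k F (c 0 0 * c 1 1 - c 0 1 * c 1 0) := by
      rw [Matrix.det_fin_two, hc, hc, hc, hc]
      simp
    rw [h1]
    refine valuation_algebraMap _ fun h0 => ?_
    rw [h0, map_zero] at h1
    exact γ.det.ne_zero h1

theorem companion_mem (w : Place F) : toLocal w C.companion ∈ w.maximalCompact := by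
  refine mem_maximalCompact_of_const (k := k) (fun i j => ?_) w
  fin_cases i <;> fin_cases j
  · exact ⟨0, (map_zero _).symm⟩
  · exact ⟨C.a₆, rfl⟩
  · exact ⟨1, (map_one _).symm⟩
  · exact ⟨-C.a₃, (map_neg _ _).symm⟩

include hv in
theorem exists_const_completion {α : v.Completion} (hα : v.val α ≤ 1) :
    ∃ c : k, v.val (α - algebraMap F v.Completion (algebraMap k F c)) < 1 := by
  obtain ⟨a, ha⟩ := v.exists_approx α C.t.ne_zero
  have ha1 := ha.trans_lt (C.valuation_t_lt_one hv)
  have ha' : v.1.valuation a ≤ 1 := by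
    rw [← Place.val_algebraMap,
      show algebraMap F v.Completion a = α - (α - algebraMap F v.Completion a) by ring]
    exact v.val.map_sub_le hα ha1.le
  obtain ⟨c, hc⟩ := C.exists_const hv ha'
  refine ⟨c, ?_⟩
  rw [show α - algebraMap F v.Completion (algebraMap k F c) = (α - algebraMap F v.Completion a) +
    algebraMap F v.Completion (a - algebraMap k F c) by rw [map_sub]; ring]
  exact v.val.map_add_lt ha1 (by rwa [Place.val_algebraMap])

include hv in
/-- The values of an anisotropic form over the constant field. -/
theorem val_quadratic_eq_one {α : v.Completion} (hα : v.val α ≤ 1) {n a b : k}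
    (h : ∀ c : k, n * c ^ 2 + a * c + b ≠ 0) :
    v.val (algebraMap F v.Completion (algebraMap k F n) * α ^ 2 +
      algebraMap F v.Completion (algebraMap k F a) * α +
      algebraMap F v.Completion (algebraMap k F b)) = 1 := by
  have hle : ∀ c : k, v.val (algebraMap F v.Completion (algebraMap k F c)) ≤ 1 := fun c => by
    rw [Place.val_algebraMap]
    exact valuation_algebraMap_le _ _
  obtain ⟨c, hc⟩ := C.exists_const_completion hv hα
  set ι := (algebraMap F v.Completion).comp (algebraMap k F) with hι
  change ∀ c : k, v.val (ι c) ≤ 1 at hle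
  change v.val (α - ι c) < 1 at hc
  change v.val (ι n * α ^ 2 + ι a * α + ι b) = 1
  -- Expansion around the residue of α: the constant term is a unit and all else is small.
  have e : ι n * α ^ 2 + ι a * α + ι b = ι (n * c ^ 2 + a * c + b) +
      (α - ι c) * (ι n * (α + ι c) + ι a) := by
    simp only [map_add, map_mul, map_pow]
    ring
  have h1 : v.val (ι (n * c ^ 2 + a * c + b)) = 1 := by
    rw [hι, RingHom.comp_apply, Place.val_algebraMap]
    exact valuation_algebraMap _ (h c)
  rw [e, ← h1]
  refine Valuation.map_add_eq_of_lt_left _ ?_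
  rw [h1, map_mul]
  refine mul_lt_one_of_lt_of_le hc (v.val.map_add_le ?_ (hle _))
  rw [map_mul]
  exact mul_le_one' (hle _) (v.val.map_add_le hα (hle _))

include hv in
/-- The torus is unramified and anisotropic modulo the center at the place at infinity. -/
theorem mem_sup_center_of_commute {h : GL2 v.Completion}
    (hh : Commute h (toLocal v C.companion)) :
    h ∈ v.maximalCompact ⊔ Subgroup.center (GL2 v.Completion) := by
  have ht := C.isUniformizer_t hv
  have hpos := C.valuation_t_pos v.1
  obtain ⟨h1, h2⟩ := C.commute_toLocal_companion_iff.1 hh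
  have hle : ∀ c : k, v.val (algebraMap F v.Completion (algebraMap k F c)) ≤ 1 := fun c => by
    rw [Place.val_algebraMap]
    exact valuation_algebraMap_le _ _
  have hdet0 : h.val.det ≠ 0 := h.det.ne_zero
  set p := h 0 0 with hp
  set s := h 1 0 with hs
  set A₃ := algebraMap F v.Completion (algebraMap k F C.a₃) with hA₃
  set A₆ := algebraMap F v.Completion (algebraMap k F C.a₆) with hA₆
  have hdet : h.val.det = p ^ 2 - A₃ * p * s - A₆ * s ^ 2 := by
    rw [Matrix.det_fin_two, h1, h2, ← hp, ← hs]
    ring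
  have key : ∃ j : ℤ, v.val p ≤ v.1.valuation (C.t : F) ^ j ∧
      v.val s ≤ v.1.valuation (C.t : F) ^ j ∧
      v.val h.val.det = v.1.valuation (C.t : F) ^ (2 * j) := by
    -- The determinant is a binary norm form without zeros over `k`, because a zero would be a
    -- rational point with x = 0. Dividing by the larger variable shows that its order is twice the
    -- smaller of the two orders.
    rcases le_total (v.val s) (v.val p) with hle' | hle'
    · have hp0 : p ≠ 0 := by
        intro h0
        rw [h0, map_zero, le_zero_iff, map_eq_zero] at hle'
        exact hdet0 (by rw [hdet, h0, hle']; ring)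
      obtain ⟨j, hj⟩ := ht.exists_val_eq hp0
      refine ⟨j, hj.le, hle'.trans hj.le, ?_⟩
      have hq : v.val (s / p) ≤ 1 := by
        rw [map_div₀]
        exact div_le_one_of_le₀ hle' zero_le
      have e : h.val.det = p ^ 2 * (algebraMap F v.Completion (algebraMap k F (-C.a₆)) * (s / p) ^ 2
          + algebraMap F v.Completion (algebraMap k F (-C.a₃)) * (s / p)
          + algebraMap F v.Completion (algebraMap k F 1)) := by
        rw [hdet]
        simp only [map_neg, map_one]
        field_simp
        ring
      rw [e, map_mul, C.val_quadratic_eq_one hv hq, map_pow, hj, mul_one, ← zpow_natCast,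
        ← zpow_mul, mul_comm]
      · rfl
      · intro c hc
        have hc0 : c ≠ 0 := by
          rintro rfl
          simp at hc
        refine C.no_point 0 (-c⁻¹) ?_
        field_simp
        linear_combination hc
    · have hs0 : s ≠ 0 := by
        intro h0
        rw [h0, map_zero, le_zero_iff, map_eq_zero] at hle'
        exact hdet0 (by rw [hdet, h0, hle']; ring)
      obtain ⟨j, hj⟩ := ht.exists_val_eq hs0
      refine ⟨j, hle'.trans hj.le, hj.le, ?_⟩
      have hq : v.val (p / s) ≤ 1 := by
        rw [map_div₀]
        exact div_le_one_of_le₀ hle' zero_le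
      have e : h.val.det = s ^ 2 * (algebraMap F v.Completion (algebraMap k F 1) * (p / s) ^ 2
          + algebraMap F v.Completion (algebraMap k F (-C.a₃)) * (p / s)
          + algebraMap F v.Completion (algebraMap k F (-C.a₆))) := by
        rw [hdet]
        simp only [map_neg, map_one]
        field_simp
        ring
      rw [e, map_mul, C.val_quadratic_eq_one hv hq, map_pow, hj, mul_one, ← zpow_natCast,
        ← zpow_mul, mul_comm]
      · rfl
      · intro c hc
        refine C.no_point 0 (-c) ?_
        linear_combination hc
  obtain ⟨j, hj1, hj2, hj3⟩ := key
  refine ht.mem_sup_center_iff.2 ⟨j, fun r i => ?_, hj3⟩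
  fin_cases r <;> fin_cases i
  · exact hj1
  · change v.val (h 0 1) ≤ _
    rw [h1, map_mul]
    exact (mul_le_of_le_one_left' (hle _)).trans hj2
  · exact hj2
  · change v.val (h 1 1) ≤ _
    rw [h2]
    refine v.val.map_sub_le hj1 ?_
    rw [map_mul]
    exact (mul_le_of_le_one_left' (hle _)).trans hj2

/-- Matrices with integral entries and the same characteristic polynomial as the companion matrix
are locally conjugate to it. -/
theorem exists_local_conj {w : Place F} {θ : GL2 F} (h0 : ∀ i j, w.1.valuation (θ i j) ≤ 1)
    (htr : θ 0 0 + θ 1 1 = -algebraMap k F C.a₃)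
    (hdet : θ 0 0 * θ 1 1 - θ 0 1 * θ 1 0 = -algebraMap k F C.a₆) :
    ∃ h ∈ integralGL2 w.1.toSubring, θ * h = h * C.companion := by
  set a := θ 0 0 with ha
  set b := θ 0 1 with hb
  set c := θ 1 0 with hc
  set d := θ 1 1 with hd
  -- A constant vector that is cyclic modulo the place is needed. If (1,0), (0,1) and (1,1) were all
  -- eigenvectors, the reduction would be scalar and the discriminant a₃² + 4a₆ would vanish.
  have key : ∃ p q : k, w.1.valuation (algebraMap k F p * (c * algebraMap k F p +
      d * algebraMap k F q) - (a * algebraMap k F p + b * algebraMap k F q) * algebraMap k F q)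
        = 1 := by
    by_contra! hne
    have hlt : ∀ p q : k, w.1.valuation (algebraMap k F p * (c * algebraMap k F p +
      d * algebraMap k F q) - (a * algebraMap k F p + b * algebraMap k F q) * algebraMap k F q)
        < 1 := by
      intro p q
      refine lt_of_le_of_ne ?_ (hne p q)
      have h1 : ∀ p q : k, ∀ i j i' j', w.1.valuation (θ i j * algebraMap k F p
          + θ i' j' * algebraMap k F q) ≤ 1 := by
        intro p q i j i' j'
        rw [mul_comm, mul_comm (θ i' j')]
        exact w.1.valuation.map_add_le (valuation_const_mul_le _ (h0 _ _))
          (valuation_const_mul_le _ (h0 _ _))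
      refine w.1.valuation.map_sub_le (valuation_const_mul_le _ (h1 _ _ _ _ _ _)) ?_
      rw [mul_comm]
      exact valuation_const_mul_le _ (h1 _ _ _ _ _ _)
    have h1 := hlt 1 0
    have h2 := hlt 0 1
    have h3 := hlt 1 1
    simp only [map_one, map_zero, mul_one, mul_zero, add_zero, zero_add, one_mul, zero_mul,
      sub_zero, zero_sub, Valuation.map_neg] at h1 h2 h3
    have h4 : w.1.valuation (d - a) < 1 := by
      rw [show d - a = (c + d - (a + b)) - (c - b) by ring]
      exact w.1.valuation.map_sub_lt h3 (w.1.valuation.map_sub_lt h1 h2)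
    have hdisc : C.a₃ ^ 2 + 4 * C.a₆ ≠ 0 := by
      have := C.disc_ne_zero 0
      simpa using this
    have h5 := valuation_algebraMap (F := F) w.1 hdisc
    have e : algebraMap k F (C.a₃ ^ 2 + 4 * C.a₆) =
        (d - a) * (d - a) + algebraMap k F 4 * (b * c) := by
      simp only [map_add, map_mul, map_pow, map_ofNat]
      linear_combination -(a + d - algebraMap k F C.a₃) * htr + 4 * hdet
    refine absurd h5 (ne_of_lt ?_)
    rw [e]
    refine w.1.valuation.map_add_lt ?_ ?_
    · rw [map_mul]
      exact mul_lt_one' h4 h4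
    · rw [map_mul, map_mul w.1.valuation b]
      exact (mul_le_of_le_one_left' (valuation_algebraMap_le _ _)).trans_lt
        ((mul_le_of_le_one_left' h2.le).trans_lt h1)
  obtain ⟨p, q, hpq⟩ := key
  have hne : algebraMap k F p * (c * algebraMap k F p + d * algebraMap k F q)
      - (a * algebraMap k F p + b * algebraMap k F q) * algebraMap k F q ≠ 0 := by
    intro h
    rw [h, map_zero] at hpq
    exact zero_ne_one hpq
  refine ⟨mat (algebraMap k F p) (a * algebraMap k F p + b * algebraMap k F q)
    (algebraMap k F q) (c * algebraMap k F p + d * algebraMap k F q) hne, ?_, ?_⟩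
  · rw [Place.mem_integralGL2_place]
    refine ⟨fun i j => ?_, ?_⟩
    · have h1 : ∀ i, w.1.valuation (θ i 0 * algebraMap k F p + θ i 1 * algebraMap k F q) ≤ 1 := by
        intro i
        rw [mul_comm, mul_comm (θ i 1)]
        exact w.1.valuation.map_add_le (valuation_const_mul_le _ (h0 _ _))
          (valuation_const_mul_le _ (h0 _ _))
      fin_cases i <;> fin_cases j
      · exact valuation_algebraMap_le _ _
      · exact h1 0
      · exact valuation_algebraMap_le _ _
      · exact h1 1
    · rw [val_mat, Matrix.det_fin_two_of]
      exact hpq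
  · apply Units.ext
    rw [Units.val_mul, Units.val_mul, val_mat, val_companion]
    ext i j
    fin_cases i <;> fin_cases j <;> simp [Matrix.mul_apply, Fin.sum_univ_two, ← ha, ← hb, ← hc, ← hd]
    · linear_combination (a * algebraMap k F p + b * algebraMap k F q) * htr
        - algebraMap k F p * hdet
    · linear_combination (c * algebraMap k F p + d * algebraMap k F q) * htr
        - algebraMap k F q * hdet

include hv in
/-- The adelic elements of the torus attached to its global embeddings. -/
theorem exists_adelic_rep {θ ε : GL2 F} (h : θ * ε = ε * C.companion)
    (hA : ∀ i j, θ i j ∈ C.A) : ∃ m : GL2 (Adele F), component v m = 1 ∧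
      (∀ w, Commute (component w m) (toLocal w C.companion)) ∧
      ∀ w, w ≠ v → toLocal w ε * component w m ∈ w.maximalCompact := by
  classical
  obtain ⟨htr, hdet⟩ := C.trace_det_of_mul_eq h
  -- The global conjugator ε is compared with integral local ones; at `v` it is compared with
  -- itself. The quotients commute with the companion matrix, so they form an adelic point of the
  -- torus.
  have h1 : ∀ w : Place F, ∃ g : GL2 F, (w ≠ v → g ∈ integralGL2 w.1.toSubring) ∧
      (w = v → g = ε) ∧ θ * g = g * C.companion := by
    intro w
    by_cases hw : w = v
    · exact ⟨ε, fun h => absurd hw h, fun _ => rfl, h⟩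
    · obtain ⟨g, hg, hg'⟩ := C.exists_local_conj (w := w)
        (fun i j => C.valuation_A_le hv hw (hA i j)) htr hdet
      exact ⟨g, fun _ => hg, fun h => absurd h hw, hg'⟩
  choose g hg hgv hg' using h1
  refine ⟨mkAdelic (fun w => toLocal w (ε⁻¹ * g w)) ?_, ?_, fun w => ?_, fun w hw => ?_⟩
  · refine ((C.finite_toLocal_notMem hv ε⁻¹).insert v).subset fun w hw => ?_
    by_contra hn
    rw [Set.mem_insert_iff, not_or, Set.mem_ofPred_eq, not_not] at hn
    refine hw ?_
    rw [map_mul]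
    exact mul_mem hn.2 (Place.toLocal_mem_integralGL2_iff.2 (hg w hn.1))
  · rw [component_mkAdelic, hgv v rfl, inv_mul_cancel, map_one]
  · rw [component_mkAdelic]
    refine Commute.map (?_ : Commute (ε⁻¹ * g w) C.companion) (toLocal w)
    have e : θ = ε * C.companion * ε⁻¹ := by rw [← h, mul_inv_cancel_right]
    have := hg' w
    rw [e] at this
    change ε⁻¹ * g w * C.companion = C.companion * (ε⁻¹ * g w)
    rw [mul_assoc, ← this]
    group
  · rw [component_mkAdelic, ← map_mul, mul_inv_cancel_left]
    exact Place.toLocal_mem_integralGL2_iff.2 (hg w hw)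

end PointlessCurve
end Toroidal
end

open scoped RestrictedProduct

noncomputable section

namespace Toroidal

namespace PointlessCurve

variable {k F : Type*} [Field k] [Fintype k] [Field F] [Algebra k F] (C : PointlessCurve k F)
  {v : Place F} (hv : C.x ∉ v.1)

/-! ### Classes of the adelic torus and quadratic endomorphisms of vertices -/

/-- Representatives of the classes of the adelic torus modulo the rational torus, the center and
the maximal compact subgroup, in terms of a matrix over `F`. -/
structure IsRep (v : Place F) (ε : GL2 F) (m : GL2 (Adele F)) : Prop where
  component_eq_one : component v m = 1
  commute : ∀ w, Commute (component w m) (toLocal w C.companion)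
  mem : ∀ w, w ≠ v → toLocal w ε * component w m ∈ w.maximalCompact

omit [Fintype k] in
theorem rootCoeff_fst_ne_zero (u : k) (s : Bool) : (C.rootCoeff u s).1 ≠ 0 := by
  cases s <;> simp [rootCoeff]

omit [Fintype k] in
-- A coincidence of the two conjugate roots would make the discriminant a₃² + 4a₆ zero.
theorem rootCoeff_injective {u : k} (hu : 2 * u = 0) : Function.Injective (C.rootCoeff u) := by
  have key : C.rootCoeff u true ≠ C.rootCoeff u false := by
    intro h
    have h1 : (1 : k) = -1 := congrArg Prod.fst h
    have h2 : u = -C.a₃ - u := congrArg Prod.snd h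
    refine C.disc_ne_zero 0 ?_
    linear_combination (C.a₃ - 2 * u) * h2 + 2 * u * hu + 2 * C.a₆ * h1
  rintro (_ | _) (_ | _) h
  · rfl
  · exact absurd h.symm key
  · exact absurd h key
  · rfl

include hv in
theorem eps_aux (u l : k) (s : Bool) (f : F) :
    1 * (algebraMap k F (C.rootCoeff u s).1 * (C.x - algebraMap k F l)) - f * 0 ≠ 0 := by
  rw [mul_zero, sub_zero, one_mul]
  exact mul_ne_zero (by simpa using C.rootCoeff_fst_ne_zero u s) (C.x_sub_ne_zero hv l)

/-- Matrices that conjugate the companion matrix to the quadratic endomorphisms. -/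
def eps (hv : C.x ∉ v.1) (u : k → k) : Option (k × Bool) → GL2 F
  | none => 1
  | some (l, s) => mat 1 (algebraMap k F (C.rootCoeff (u l) s).1 * C.y
      + algebraMap k F (C.rootCoeff (u l) s).2) 0
      (algebraMap k F (C.rootCoeff (u l) s).1 * (C.x - algebraMap k F l)) (C.eps_aux hv _ _ _ _)

/-- The vertices that belong to the classes of the torus. -/
def _root_.Toroidal.torusLabel : Option (k × Bool) → Label k
  | none => .c 0
  | some (l, _) => .t l

/-- After scaling, the matrix has diagonal entry of order t² and parameter close to y/(x - l), which
agrees with the parameter of t_l modulo t². -/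
theorem vertex_eps (u : k → k) (i : Option (k × Bool)) :
    vertex v (C.eps hv u i) = C.labelVertex v (torusLabel i) := by
  have hpos := C.valuation_t_pos v.1
  have ht := C.isUniformizer_t hv
  rcases i with _ | ⟨l, s⟩
  · rw [eps, labelVertex, torusLabel, Label.deg, par, pt]
    congr 1
    ext i j
    fin_cases i <;> fin_cases j <;> simp [affineMat]
  · rw [labelVertex, torusLabel, Label.deg, par, pt, eq_comm, ht.vertex_eq_vertex_iff]
    set e := (C.rootCoeff (u l) s).1 with he
    have hE := valuation_algebraMap (F := F) v.1 (C.rootCoeff_fst_ne_zero (u l) s)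
    rw [← he] at hE
    have hx := C.valuation_x_sub hv l
    have h1 := Place.IsUniformizer.affineMat_inv_mul_mul (F := F) 1 (C.t ^ (2 : ℤ)) 0 (C.tParam l)
      (C.eps hv u (some (l, s)))
    rw [show affineMat (1 : Fˣ) (0 : F) = 1 by
      ext i j
      fin_cases i <;> fin_cases j <;> simp [affineMat], mul_one] at h1
    have h00 : C.eps hv u (some (l, s)) 0 0 = 1 := rfl
    have h01 : C.eps hv u (some (l, s)) 0 1 = algebraMap k F e * C.y
      + algebraMap k F (C.rootCoeff (u l) s).2 := rfl
    have h10 : C.eps hv u (some (l, s)) 1 0 = 0 := rfl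
    have h11 : C.eps hv u (some (l, s)) 1 1 = algebraMap k F e * (C.x - algebraMap k F l) := rfl
    rw [h00, h01, h10, h11] at h1
    simp only [Units.val_one, mul_zero, sub_zero, mul_one, zero_add] at h1
    refine ⟨-2, fun i j => ?_, ?_⟩
    · rw [h1]
      have h2 : v.1.valuation ((algebraMap k F e * C.y + algebraMap k F (C.rootCoeff (u l) s).2)
          - C.tParam l * (algebraMap k F e * (C.x - algebraMap k F l))) ≤ 1 := by
        rw [show (algebraMap k F e * C.y + algebraMap k F (C.rootCoeff (u l) s).2)
          - C.tParam l * (algebraMap k F e * (C.x - algebraMap k F l)) =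
          algebraMap k F e * (C.y - C.tParam l * (C.x - algebraMap k F l))
            + algebraMap k F (C.rootCoeff (u l) s).2 by ring]
        exact v.1.valuation.map_add_le (valuation_const_mul_le _ (C.valuation_y_sub_le hv l))
          (valuation_algebraMap_le _ _)
      fin_cases i <;> fin_cases j
      · simp
      · simp only [Fin.zero_eta, Fin.mk_one, Matrix.of_apply, Matrix.cons_val', Matrix.cons_val_one,
          Matrix.cons_val_zero, Matrix.cons_val_fin_one]
        rw [map_div₀, Units.val_zpow_eq_zpow_val, map_zpow₀, div_eq_mul_inv, ← zpow_neg]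
        exact mul_le_of_le_one_left' h2
      · simp
      · change v.1.valuation (algebraMap k F e * (C.x - algebraMap k F l)) ≤ _
        rw [map_mul, hE, one_mul, hx]
    · rw [h1, Matrix.det_fin_two_of, mul_zero, sub_zero, map_mul, map_mul, hE, hx, one_mul,
        map_div₀, map_one, Units.val_zpow_eq_zpow_val, map_zpow₀, one_div, ← zpow_neg,
        ← zpow_add₀ hpos.ne']
      norm_num

section Reps

variable {u : k → k} (hu : ∀ l, 2 * u l = 0) (hu' : ∀ l, u l ^ 2 + C.a₃ * u l = l ^ 3 + C.a₄ * l)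

include hu hu' in
-- The endomorphism c₁J + e with the chosen coefficients has the trace and determinant of the
-- companion matrix, and `eps` is built from its cyclic basis.
theorem exists_mul_eps (i : Option (k × Bool)) : ∃ θ : GL2 F,
    θ * C.eps hv u i = C.eps hv u i * C.companion ∧ ∀ r s, θ r s ∈ C.A := by
  rcases i with _ | ⟨l, s⟩
  · refine ⟨C.companion, by simp [eps], fun r s => ?_⟩
    fin_cases r <;> fin_cases s
    · exact zero_mem _
    · exact C.A.algebraMap_mem _
    · exact one_mem _
    · exact neg_mem (C.A.algebraMap_mem _)
  · obtain ⟨c₁, e, he, h1, h2⟩ : ∃ c₁ e : k, C.rootCoeff (u l) s = (c₁, e) ∧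
        2 * e - c₁ * C.a₃ = -C.a₃ ∧
        e ^ 2 - c₁ * C.a₃ * e - c₁ ^ 2 * (l ^ 3 + C.a₄ * l + C.a₆) = -C.a₆ := by
      cases s
      · refine ⟨-1, -C.a₃ - u l, rfl, by linear_combination -hu l, ?_⟩
        linear_combination hu' l
      · refine ⟨1, u l, rfl, by linear_combination hu l, ?_⟩
        linear_combination hu' l - C.a₃ * hu l
    have h1' := congrArg (algebraMap k F) h1
    have h2' := congrArg (algebraMap k F) h2
    simp only [map_sub, map_mul, map_neg, map_ofNat, map_add, map_pow] at h1' h2'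
    have hcof := C.cofactor_mul l
    simp only [map_add, map_mul, map_pow] at hcof
    have hdet : (algebraMap k F c₁ * C.y + algebraMap k F e) *
        (-(algebraMap k F c₁ * (C.y + algebraMap k F C.a₃)) + algebraMap k F e)
        - -(algebraMap k F c₁ * C.cofactor l) *
          (algebraMap k F c₁ * (C.x - algebraMap k F l)) = -algebraMap k F C.a₆ := by
      linear_combination h2' + algebraMap k F c₁ ^ 2 * hcof
    have hne : (algebraMap k F c₁ * C.y + algebraMap k F e) *
        (-(algebraMap k F c₁ * (C.y + algebraMap k F C.a₃)) + algebraMap k F e)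
        - -(algebraMap k F c₁ * C.cofactor l) *
          (algebraMap k F c₁ * (C.x - algebraMap k F l)) ≠ 0 := by
      rw [hdet]
      simpa using C.a₆_ne_zero
    refine ⟨mat _ _ _ _ hne, ?_, fun r s => ?_⟩
    · have h3 := C.eps_aux hv (u l) l s (algebraMap k F c₁ * C.y + algebraMap k F e)
      rw [he] at h3
      have := C.mat_mul_mat_eq hne h3 (by linear_combination h1') hdet
      simpa only [eps, he] using this
    · fin_cases r <;> fin_cases s
      · exact add_mem (mul_mem (C.A.algebraMap_mem _) C.y_mem) (C.A.algebraMap_mem _)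
      · exact neg_mem (mul_mem (C.A.algebraMap_mem _) (C.cofactor_mem l))
      · exact mul_mem (C.A.algebraMap_mem _) (sub_mem C.x_mem (C.A.algebraMap_mem _))
      · exact add_mem (neg_mem (mul_mem (C.A.algebraMap_mem _)
          (add_mem C.y_mem (C.A.algebraMap_mem _)))) (C.A.algebraMap_mem _)

include hu hu' in
theorem exists_isRep (i : Option (k × Bool)) : ∃ m, C.IsRep v (C.eps hv u i) m := by
  obtain ⟨θ, h, hA⟩ := C.exists_mul_eps hv hu hu' i
  obtain ⟨m, h1, h2, h3⟩ := C.exists_adelic_rep hv h hA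
  exact ⟨m, h1, h2, h3⟩

include hv in
theorem mem_A_of_toLocal_mem {θ : GL2 F} (h : ∀ w, w ≠ v → toLocal w θ ∈ w.maximalCompact)
    (i j : Fin 2) : θ i j ∈ C.A := by
  rw [← C.mem_holomorphicOutside_iff hv, holomorphicOutside, Subring.mem_iInf]
  intro w
  have := (Place.mem_integralGL2_place.1 (Place.toLocal_mem_integralGL2_iff.1 (h w.1 w.2))).1 i j
  exact (w.1.1.valuation_le_one_iff _).1 this

include hv in
theorem mem_integralGL2_of_toLocal_mem {θ : GL2 F}
    (h : ∀ w, w ≠ v → toLocal w θ ∈ w.maximalCompact) :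
    θ ∈ integralGL2 (holomorphicOutside v) := by
  refine mem_integralGL2_iff.2 ⟨fun i j => ?_, ?_⟩
  · exact (C.mem_holomorphicOutside_iff hv).2 (C.mem_A_of_toLocal_mem hv h i j)
  · rw [holomorphicOutside, Subring.mem_iInf]
    intro w
    exact (mem_integralGL2_iff.1 (Place.toLocal_mem_integralGL2_iff.1 (h w.1 w.2))).2

include hv in
theorem toLocal_mem_of_mem_integralGL2 {γ : GL2 F}
    (h : γ ∈ integralGL2 (holomorphicOutside v)) {w : Place F} (hw : w ≠ v) :
    toLocal w γ ∈ w.maximalCompact := by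
  rw [Place.toLocal_mem_integralGL2_iff]
  obtain ⟨h1, e, he, h2⟩ := (C.mem_integralGL2_holomorphicOutside_iff hv).1 h
  refine mem_integralGL2_iff.2 ⟨fun i j => C.A_le hv hw (h1 i j), ?_⟩
  rw [h2, ← map_inv₀]
  exact algebraMap_mem w.1 _

include hv in
-- A constant determinant excludes a change of scale, so the vertex is fixed with j = 0.
theorem isHom_of_smul_eq {θ : GL2 F} (hA : ∀ i j, θ i j ∈ C.A) {e : k} (he : e ≠ 0)
    (hdet : θ.val.det = algebraMap k F e) {L : Label k}
    (h : toLocal v θ • C.labelVertex v L = C.labelVertex v L) :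
    C.IsHom v (L.deg k) (C.par L) (C.par L) (θ 0 0) (θ 0 1) (θ 1 0) (θ 1 1) := by
  have ht := C.isUniformizer_t hv
  obtain ⟨j, h1, h2, h3, h4, h5⟩ := (ht.smul_vertex_eq_vertex_iff θ _ _ _ _).1 h
  rw [hdet, valuation_algebraMap v.1 he, one_mul, ht.zpow_inj] at h1
  obtain rfl : j = 0 := by omega
  exact ⟨hA _ _, hA _ _, hA _ _, hA _ _, by simpa using h2, by simpa using h3, by simpa using h4,
    by simpa using h5⟩

include hu hu' in
/-- Global elements with the integrality properties of a torus element belong to a class. -/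
theorem exists_class_of_conj {γ : GL2 F} {L : Label k}
    (h : ∀ w, w ≠ v → toLocal w (γ * C.companion * γ⁻¹) ∈ w.maximalCompact)
    (hL : vertex v γ = C.labelVertex v L) : ∃ (i : Option (k × Bool)) (δ : GL2 F),
      (∀ w, w ≠ v → toLocal w δ ∈ w.maximalCompact) ∧
      Commute (γ⁻¹ * δ * C.eps hv u i) C.companion := by
  set θ := γ * C.companion * γ⁻¹ with hθ
  have hmul : θ * γ = γ * C.companion := by rw [hθ, inv_mul_cancel_right]
  obtain ⟨htr, hdet⟩ := C.trace_det_of_mul_eq hmul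
  have hA := C.mem_A_of_toLocal_mem hv h
  -- The companion matrix is integral at `v`, so its conjugate by γ fixes the vertex of γ and is an
  -- endomorphism there.
  have hsmul : toLocal v θ • C.labelVertex v L = C.labelVertex v L := by
    rw [← hL, toLocal_smul_vertex, hmul]
    exact vertex_mul_integral _ (Place.toLocal_mem_integralGL2_iff.1 (C.companion_mem v))
  -- Two matrices conjugating the companion matrix to θ differ by its centralizer, the rational
  -- torus.
  have hcomm : ∀ η : GL2 F, θ * η = η * C.companion → Commute (γ⁻¹ * η) C.companion := by
    intro η hη
    rw [hθ] at hη
    change γ⁻¹ * η * C.companion = C.companion * (γ⁻¹ * η)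
    rw [mul_assoc, ← hη]
    group
  have hHom := C.isHom_of_smul_eq hv hA (e := -C.a₆) (neg_ne_zero.2 C.a₆_ne_zero)
    (by rw [Matrix.det_fin_two, hdet, map_neg]) hsmul
  have hmat : ∀ h, θ = mat (θ 0 0) (θ 0 1) (θ 1 0) (θ 1 1) h := by
    intro h
    ext i j
    fin_cases i <;> fin_cases j <;> rfl
  have hne : θ 0 0 * θ 1 1 - θ 0 1 * θ 1 0 ≠ 0 := by
    rw [hdet]
    simpa using C.a₆_ne_zero
  rcases C.label_of_isHom hv hu hu' hHom htr hdet with ⟨-, a₀, b₀, c₀, d₀, ha, hb, hc, hd⟩ |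
    ⟨l, -, s, ha, hc⟩
  -- At c_0 the endomorphism has constant entries and is conjugate to the companion matrix by a
  -- constant matrix, so a single class arises.
  · have hc0 : 1 * θ 1 0 - θ 0 0 * 0 ≠ 0 := by
      intro h0
      refine C.no_root hv (θ 0 0) ?_
      linear_combination θ 0 0 * htr - hdet - θ 0 1 * h0
    refine ⟨none, mat 1 (θ 0 0) 0 (θ 1 0) hc0, fun w _ => ?_, ?_⟩
    · refine mem_maximalCompact_of_const (k := k) (fun i j => ?_) w
      fin_cases i <;> fin_cases j
      · exact ⟨1, (map_one _).symm⟩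
      · exact ⟨a₀, ha⟩
      · exact ⟨0, (map_zero _).symm⟩
      · exact ⟨c₀, hc⟩
    · rw [eps, mul_one]
      refine hcomm _ ?_
      have := C.mat_mul_mat_eq hne hc0 htr hdet
      rwa [← hmat hne] at this
  · refine ⟨some (l, s), 1, fun w _ => by rw [map_one]; exact one_mem _, ?_⟩
    rw [mul_one]
    refine hcomm _ ?_
    have h3 := C.eps_aux hv (u l) l s (θ 0 0)
    rw [← hc] at h3
    have := C.mat_mul_mat_eq hne h3 htr hdet
    rw [← hmat hne] at this
    simp only [eps, ← ha, ← hc]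
    exact this

include hu hu' in
/-- The representatives meet every class. -/
theorem exists_class {M : Option (k × Bool) → GL2 (Adele F)}
    (hM : ∀ i, C.IsRep v (C.eps hv u i) (M i)) {m : GL2 (Adele F)}
    (hm : ∀ w, Commute (component w m) (toLocal w C.companion)) :
    ∃ (i : Option (k × Bool)) (τ : GL2 F), Commute τ C.companion ∧
      ∃ z ∈ Subgroup.center (GL2 (Adele F)), (C.diag hv τ * M i * z)⁻¹ * m ∈ maxCompact F := by
  obtain ⟨γ₁, hγ₁⟩ := C.exists_toLocal_mul_mem hv m
  obtain ⟨L, γ₀, hγ₀, hL⟩ := C.exists_gammaRel_label hv (vertex v γ₁)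
  rw [toLocal_smul_vertex] at hL
  have hγ : ∀ w, w ≠ v → toLocal w (γ₀ * γ₁) * component w m ∈ w.maximalCompact := by
    intro w hw
    rw [map_mul, mul_assoc]
    exact mul_mem (C.toLocal_mem_of_mem_integralGL2 hv hγ₀ hw) (hγ₁ w hw)
  set γ := γ₀ * γ₁ with hγdef
  -- Since the companion matrix is integral and commutes with `m`, its conjugate by γ is also its
  -- conjugate by γm, which is integral away from `v`.
  obtain ⟨i, δ, hδ, hcomm⟩ := C.exists_class_of_conj hv hu hu' (γ := γ) (L := L) (fun w hw => by
    have e : toLocal w (γ * C.companion * γ⁻¹) = (toLocal w γ * component w m) *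
        toLocal w C.companion * (toLocal w γ * component w m)⁻¹ := by
      rw [mul_assoc (toLocal w γ), (hm w).eq, map_mul, map_mul, map_inv]
      group
    rw [e]
    exact mul_mem (mul_mem (hγ w hw) (C.companion_mem w)) (inv_mem (hγ w hw))) hL
  refine ⟨i, γ⁻¹ * δ * C.eps hv u i, hcomm, ?_⟩
  -- Away from `v` the integrality is already arranged; at `v` the torus lies in `K_v Z_v`, and the
  -- central part is absorbed in `z`.
  have h1 : Commute ((toLocal v (γ⁻¹ * δ * C.eps hv u i))⁻¹ * component v m)
      (toLocal v C.companion) := ((hcomm.map (toLocal v)).inv_left).mul_left (hm v)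
  obtain ⟨κ, hκ, z, hz, hκz⟩ := Subgroup.mem_sup_of_normal_right.1
    (C.mem_sup_center_of_commute hv h1)
  refine ⟨fromLocal v z, fromLocal_mem_center hz, mem_maxCompact.2 fun w => ?_⟩
  rw [map_mul, map_inv, map_mul (component w) (C.diag hv _ * M i), map_mul (component w)
    (C.diag hv _), component_diag]
  by_cases hw : w = v
  · subst hw
    rw [(hM i).component_eq_one, component_fromLocal_same, mul_one, mul_inv_rev, mul_assoc, ← hκz,
      Subgroup.mem_center_iff.1 hz, inv_mul_cancel_left]
    exact hκ
  · rw [component_fromLocal_ne hw, mul_one]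
    have e : (toLocal w (γ⁻¹ * δ * C.eps hv u i) * component w (M i))⁻¹ * component w m =
        (toLocal w (C.eps hv u i) * component w (M i))⁻¹ * (toLocal w δ)⁻¹ *
          (toLocal w γ * component w m) := by
      rw [map_mul, map_mul, map_inv]
      group
    rw [e]
    exact mul_mem (mul_mem (inv_mem ((hM i).mem w hw)) (inv_mem (hδ w hw))) (hγ w hw)

include hv in
/-- Every idele differs from a unit away from `v` by an element of `F`. -/
theorem exists_mul_val_eq_one {ζ : ∀ w : Place F, w.Completion} (hζ : ∀ w, ζ w ≠ 0)
    (hfin : {w : Place F | w.val (ζ w) ≠ 1}.Finite) :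
    ∃ a : Fˣ, ∀ w, w ≠ v → w.val (algebraMap F w.Completion a * ζ w) = 1 := by
  have key : ∀ s : Finset (Place F), ∀ b : Fˣ,
      (∀ w, w ≠ v → w ∉ s → w.val (algebraMap F w.Completion b * ζ w) = 1) →
      ∃ a : Fˣ, ∀ w, w ≠ v → w.val (algebraMap F w.Completion a * ζ w) = 1 := by
    classical
    intro s
    induction s using Finset.induction_on with
    | empty => exact fun b hb => ⟨b, fun w hw => hb w hw (by simp)⟩
    | insert i s hi ih =>
      intro b hb
      by_cases hiv : i = v
      · subst hiv
        exact ih b fun w hw hws => hb w hw (by simp [hw, hws])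
      obtain ⟨ϖ, hϖ, -, -, hϖ1, -⟩ := C.exists_uniformizer hv hiv
      obtain ⟨n, hn⟩ := hϖ.exists_val_eq (α := algebraMap F i.Completion b * ζ i)
        (mul_ne_zero (by simp) (hζ i))
      refine ih (ϖ ^ (-n) * b) fun w hw hws => ?_
      rw [Units.val_mul, map_mul (algebraMap F w.Completion), mul_assoc, map_mul, Place.val_algebraMap,
        Units.val_zpow_eq_zpow_val, map_zpow₀]
      by_cases hwi : w = i
      · subst hwi
        rw [hn, ← zpow_add₀ (w.valuation_pos ϖ).ne', neg_add_cancel, zpow_zero]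
      · rw [hϖ1 w hw hwi, one_zpow, one_mul]
        exact hb w hw (by simp [hwi, hws])
  refine key hfin.toFinset 1 fun w _ hw => ?_
  simpa using hw

include hv in
theorem exists_scalar_mul_mem {z : GL2 (Adele F)} (hz : z ∈ Subgroup.center (GL2 (Adele F))) :
    ∃ a : Fˣ, ∀ w, w ≠ v → toLocal w (Matrix.GeneralLinearGroup.scalar (Fin 2) a) *
      component w z ∈ w.maximalCompact := by
  rw [Matrix.GeneralLinearGroup.center_eq_range_scalar] at hz
  obtain ⟨ζ, rfl⟩ := hz
  let ξ : ∀ w : Place F, w.Completionˣ := fun w => ⟨(ζ : Adele F) w, ((ζ⁻¹ : (Adele F)ˣ) : Adele F) w,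
    congrArg (fun a : Adele F => a w) ζ.mul_inv, congrArg (fun a : Adele F => a w) ζ.inv_mul⟩
  have hcomp : ∀ w : Place F, component w (Matrix.GeneralLinearGroup.scalar (Fin 2) ζ) =
      Matrix.GeneralLinearGroup.scalar (Fin 2) (ξ w) := by
    intro w
    ext i j
    fin_cases i <;> fin_cases j <;> rfl
  have hdet : ∀ (w : Place F) (c : w.Completionˣ),
      (Matrix.GeneralLinearGroup.scalar (Fin 2) c).val.det = (c : w.Completion) ^ 2 := by
    intro w c
    simp
  have h1 : {w : Place F | w.val (ξ w : w.Completion) ≠ 1}.Finite := by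
    refine (finite_component_notMem (Matrix.GeneralLinearGroup.scalar (Fin 2) ζ)).subset
      fun w hw hmem => hw ?_
    rw [hcomp w] at hmem
    have := (Place.mem_integralGL2_integers.1 hmem).2
    rw [hdet, map_pow] at this
    exact (pow_eq_one_iff_of_nonneg zero_le two_ne_zero).1 this
  obtain ⟨a, ha⟩ := C.exists_mul_val_eq_one hv (ζ := fun w => (ξ w : w.Completion))
    (fun w => (ξ w).ne_zero) h1
  refine ⟨a, fun w hw => ?_⟩
  have e : toLocal w (Matrix.GeneralLinearGroup.scalar (Fin 2) a) =
      Matrix.GeneralLinearGroup.scalar (Fin 2) (Units.map (algebraMap F w.Completion : F →* _) a) := by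
    ext i j
    rw [Place.toLocal_apply]
    fin_cases i <;> fin_cases j <;> simp [Matrix.GeneralLinearGroup.scalar]
  have h2 := ha w hw
  rw [hcomp w, e, ← map_mul, Place.mem_integralGL2_integers]
  refine ⟨fun i j => ?_, ?_⟩
  · fin_cases i <;> fin_cases j
    · exact h2.le
    · change w.val 0 ≤ 1
      simp
    · change w.val 0 ≤ 1
      simp
    · exact h2.le
  · rw [hdet, map_pow]
    change w.val (algebraMap F w.Completion a * ξ w) ^ 2 = 1
    rw [h2, one_pow]

include hu hu' in
/-- The representatives belong to different classes. -/
theorem eq_of_class {M : Option (k × Bool) → GL2 (Adele F)}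
    (hM : ∀ i, C.IsRep v (C.eps hv u i) (M i)) {i j : Option (k × Bool)} {τ : GL2 F}
    (hτ : Commute τ C.companion) {z : GL2 (Adele F)}
    (hz : z ∈ Subgroup.center (GL2 (Adele F)))
    (h : (C.diag hv τ * M i * z)⁻¹ * M j ∈ maxCompact F) : i = j := by
  obtain ⟨a, ha⟩ := C.exists_scalar_mul_mem hv hz
  -- If two representatives lie in one class, this matrix lies in `Γ` and carries the vertex of `j`
  -- to that of `i`. So their labels agree, and only the two conjugate embeddings at one t_l remain
  -- to be separated.
  obtain ⟨g, hg⟩ : ∃ g, g = Matrix.GeneralLinearGroup.scalar (Fin 2) a *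
    (C.eps hv u i * τ⁻¹ * (C.eps hv u j)⁻¹) := ⟨_, rfl⟩
  have hgΓ : g ∈ integralGL2 (holomorphicOutside v) := by
    refine C.mem_integralGL2_of_toLocal_mem hv fun w hw => ?_
    have hX := mem_maxCompact.1 h w
    rw [map_mul, map_inv, map_mul (component w) (C.diag hv _ * M i), map_mul (component w)
      (C.diag hv _), component_diag] at hX
    have hzw : component w z * (toLocal w (C.eps hv u i) * component w (M i)) =
        (toLocal w (C.eps hv u i) * component w (M i)) * component w z := by
      have h1 := Subgroup.mem_center_iff.1 hz (C.diag hv (C.eps hv u i) * M i)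
      have h2 := congrArg (component w) h1
      rw [map_mul, map_mul (component w) z, map_mul, component_diag] at h2
      exact h2.symm
    have e : toLocal w g = (toLocal w (Matrix.GeneralLinearGroup.scalar (Fin 2) a) *
        component w z) * (toLocal w (C.eps hv u i) * component w (M i)) *
        ((toLocal w τ * component w (M i) * component w z)⁻¹ * component w (M j)) *
        (toLocal w (C.eps hv u j) * component w (M j))⁻¹ := by
      rw [mul_assoc _ (component w z), hzw, hg, map_mul, map_mul, map_mul, map_inv, map_inv]
      group
    rw [e]
    exact mul_mem (mul_mem (mul_mem (ha w hw) ((hM i).mem w hw)) hX) (inv_mem ((hM j).mem w hw))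
  have hsmul : toLocal v g • vertex v (C.eps hv u j) = vertex v (C.eps hv u i) := by
    rw [toLocal_smul_vertex, hg, mul_assoc, inv_mul_cancel_right, vertex_mul_scalar, vertex, vertex,
      QuotientGroup.eq, map_mul, mul_inv_rev, inv_mul_cancel_right, map_inv, inv_inv]
    exact C.mem_sup_center_of_commute hv (hτ.map (toLocal v))
  rw [C.vertex_eps, C.vertex_eps] at hsmul
  have hlab := C.eq_of_gammaRel hv ⟨g, hgΓ, hsmul⟩
  rcases i with _ | ⟨l, s⟩ <;> rcases j with _ | ⟨l', s'⟩
  · rfl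
  · cases hlab
  · cases hlab
  · cases hlab
    by_contra hne
    have hss : s ≠ s' := fun h => hne (by rw [h])
    obtain ⟨hgA, e, he, hdet⟩ := (C.mem_integralGL2_holomorphicOutside_iff hv).1 hgΓ
    have hform : ∀ θ : GL2 F, (∀ r s, θ r s ∈ C.A) → (∃ e : k, e ≠ 0 ∧ θ.val.det = algebraMap k F e) →
        toLocal v θ • C.labelVertex v (.t l) = C.labelVertex v (.t l) → ∃ c₁ e : k, θ.val =
          !![algebraMap k F c₁ * C.y + algebraMap k F e, -(algebraMap k F c₁ * C.cofactor l);
            algebraMap k F c₁ * (C.x - algebraMap k F l),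
            -(algebraMap k F c₁ * (C.y + algebraMap k F C.a₃)) + algebraMap k F e] := by
      rintro θ hθA ⟨e, he, hdet⟩ hθ
      obtain ⟨c₁, c₀, h1, h2, h3, h4⟩ :=
        C.exists_of_isHom_t hv (C.isHom_of_smul_eq hv hθA he hdet hθ)
      refine ⟨c₁, c₀, ?_⟩
      ext r s
      fin_cases r <;> fin_cases s
      exacts [h1, h2, h3, h4]
    have hrep : ∀ s, ∃ θ : GL2 F, θ * C.eps hv u (some (l, s)) =
        C.eps hv u (some (l, s)) * C.companion ∧ Commute g θ ∧
        θ 0 0 = C.eps hv u (some (l, s)) 0 1 ∧ θ 1 0 = C.eps hv u (some (l, s)) 1 1 := by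
      intro s
      obtain ⟨θ, hθ, hθA⟩ := C.exists_mul_eps hv hu hu' (some (l, s))
      obtain ⟨-, hθdet⟩ := C.trace_det_of_mul_eq hθ
      have hθv : toLocal v θ • C.labelVertex v (.t l) = C.labelVertex v (.t l) := by
        change toLocal v θ • C.labelVertex v (torusLabel (some (l, s))) =
          C.labelVertex v (torusLabel (some (l, s)))
        rw [← C.vertex_eps hv u, toLocal_smul_vertex, hθ]
        exact vertex_mul_integral _ (Place.toLocal_mem_integralGL2_iff.1 (C.companion_mem v))
      refine ⟨θ, hθ, ?_, ?_, ?_⟩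
      · obtain ⟨c₁, c₀, h1⟩ := hform g hgA ⟨e, he, hdet⟩ hsmul
        obtain ⟨c₁', c₀', h1'⟩ := hform θ hθA ⟨-C.a₆, neg_ne_zero.2 C.a₆_ne_zero, by
          rw [Matrix.det_fin_two, hθdet, map_neg]⟩ hθv
        apply Units.ext
        rw [Units.val_mul, Units.val_mul, h1, h1']
        ext r s
        fin_cases r <;> fin_cases s <;> simp [Matrix.mul_apply, Fin.sum_univ_two] <;> ring
      all_goals
        have h1 := congrArg Units.val hθ
        rw [Units.val_mul, Units.val_mul, val_companion] at h1
      · have h2 := congrFun (congrFun h1 0) 0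
        simpa [Matrix.mul_apply, Fin.sum_univ_two, eps, mat] using h2
      · have h2 := congrFun (congrFun h1 1) 0
        simpa [Matrix.mul_apply, Fin.sum_univ_two, eps, mat] using h2
    obtain ⟨θ, hθ, hθg, hθ0, hθ1⟩ := hrep s
    obtain ⟨θ', hθ', hθg', hθ0', hθ1'⟩ := hrep s'
    -- The matrix `g` conjugates θ' to θ, yet it commutes with θ because the endomorphisms of t_l
    -- form a commutative algebra.
    have hθθ : θ = θ' := by
      have e1 : θ = C.eps hv u (some (l, s)) * C.companion * (C.eps hv u (some (l, s)))⁻¹ := by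
        rw [← hθ, mul_inv_cancel_right]
      have e2 : θ' = C.eps hv u (some (l, s')) * C.companion * (C.eps hv u (some (l, s')))⁻¹ := by
        rw [← hθ', mul_inv_cancel_right]
      have e3 : g * θ' = θ * g := by
        have hτ' : τ⁻¹ * C.companion = C.companion * τ⁻¹ := hτ.inv_left
        rw [e2, hg, scalar_mul_comm]
        calc _ = C.eps hv u (some (l, s)) * (τ⁻¹ * C.companion) *
              (C.eps hv u (some (l, s')))⁻¹ * Matrix.GeneralLinearGroup.scalar (Fin 2) a := by
              rw [mul_assoc _ (Matrix.GeneralLinearGroup.scalar (Fin 2) a), scalar_mul_comm]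
              group
          _ = _ := by
              rw [hτ', e1]
              group
      exact (mul_left_cancel (e3.trans hθg.eq.symm)).symm
    rw [← hθθ, hθ0] at hθ0'
    rw [← hθθ, hθ1] at hθ1'
    have h1 : (C.rootCoeff (u l) s).1 = (C.rootCoeff (u l) s').1 :=
      (algebraMap k F).injective (mul_right_cancel₀ (C.x_sub_ne_zero hv l) hθ1')
    refine hss (C.rootCoeff_injective (hu l) (Prod.ext h1 ((algebraMap k F).injective ?_)))
    have h2 : algebraMap k F (C.rootCoeff (u l) s).1 * C.y + algebraMap k F (C.rootCoeff (u l) s).2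
      = algebraMap k F (C.rootCoeff (u l) s').1 * C.y + algebraMap k F (C.rootCoeff (u l) s').2 :=
      hθ0'
    rw [h1] at h2
    exact add_left_cancel h2

end Reps

end PointlessCurve
end Toroidal
end

open scoped RestrictedProduct

noncomputable section

namespace Toroidal

/-! ### Haar measure and finite sums -/

section Haar

open MeasureTheory Topology
open scoped Pointwise

variable {G : Type*} [Group G] [TopologicalSpace G] [IsTopologicalGroup G] (N : Subgroup G)
  [N.Normal] {U : Subgroup G} (hUo : IsOpen (U : Set G)) (hUc : IsCompact (U : Set G))
  [MeasurableSpace (G ⧸ N)] [BorelSpace (G ⧸ N)] {ι : Type*} [Fintype ι] {s : ι → G}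

include hUo hUc in
/-- The integral of a function on a quotient group, invariant under a compact open subgroup with
finitely many cosets, is a sum over representatives of the cosets. -/
theorem exists_haar_integral_eq_sum
    (hs : ∀ g, ∃ i, ∃ n ∈ N, ∃ u ∈ U, g = s i * n * u)
    (hs' : ∀ i j, ∀ n ∈ N, ∀ u ∈ U, s j = s i * n * u → i = j) {φ : G ⧸ N → ℂ}
    (hφ : ∀ g, ∀ u ∈ U, φ (QuotientGroup.mk (g * u)) = φ (QuotientGroup.mk g)) :
    ∃ μ : Measure (G ⧸ N), μ.IsHaarMeasure ∧ ∃ c : ℂ, c ≠ 0 ∧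
      ∫ x, φ x ∂μ = c * ∑ i, φ (QuotientGroup.mk (s i)) := by
  classical
  set V : Set (G ⧸ N) := QuotientGroup.mk '' (U : Set G) with hV
  have hVo : IsOpen V := QuotientGroup.isOpenMap_coe _ hUo
  have hVc : IsCompact V := hUc.image QuotientGroup.continuous_mk
  have h1V : (1 : G ⧸ N) ∈ V := ⟨1, one_mem U, rfl⟩
  -- The image of `U` is a compact open neighbourhood of the identity, so Haar measure exists and
  -- gives all its translates the same finite positive volume.
  have : LocallyCompactSpace (G ⧸ N) := hVc.locallyCompactSpace_of_mem_nhds_of_group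
    (hVo.mem_nhds h1V)
  set μ : Measure (G ⧸ N) := Measure.haar with hμ
  have hVi : ∀ i, MeasurableSet ((QuotientGroup.mk (s i) : G ⧸ N) • V) :=
    fun i => (hVo.smul _).measurableSet
  have hμV : ∀ i, μ ((QuotientGroup.mk (s i) : G ⧸ N) • V) = μ V := fun i => measure_smul _ _ _
  have hcov : ∀ x : G ⧸ N, ∃ i, x ∈ (QuotientGroup.mk (s i) : G ⧸ N) • V ∧
      φ x = φ (QuotientGroup.mk (s i)) := by
    intro x
    obtain ⟨g, rfl⟩ := QuotientGroup.mk_surjective x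
    obtain ⟨i, n, hn, u, hu, rfl⟩ := hs g
    have e : (QuotientGroup.mk (s i * n) : G ⧸ N) = QuotientGroup.mk (s i) := by
      rw [QuotientGroup.eq, mul_inv_rev, inv_mul_cancel_right]
      exact inv_mem hn
    refine ⟨i, ⟨QuotientGroup.mk u, ⟨u, hu, rfl⟩, ?_⟩, by rw [hφ _ u hu, e]⟩
    change (QuotientGroup.mk (s i) : G ⧸ N) * QuotientGroup.mk u = _
    rw [QuotientGroup.mk_mul, e]
  have hdisj : ∀ i j, ∀ x ∈ (QuotientGroup.mk (s i) : G ⧸ N) • V,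
      x ∈ (QuotientGroup.mk (s j) : G ⧸ N) • V → i = j := by
    rintro i j x ⟨-, ⟨u, hu, rfl⟩, rfl⟩ ⟨-, ⟨u', hu', rfl⟩, h⟩
    have h1 : (QuotientGroup.mk (s j * u') : G ⧸ N) = QuotientGroup.mk (s i * u) := h
    have h2 : (QuotientGroup.mk (s i) : G ⧸ N) = QuotientGroup.mk (s j * (u' * u⁻¹)) := by
      rw [← mul_assoc, QuotientGroup.mk_mul, h1, ← QuotientGroup.mk_mul, mul_inv_cancel_right]
    rw [QuotientGroup.eq] at h2
    exact hs' i j _ h2 (u' * u⁻¹)⁻¹ (inv_mem (mul_mem hu' (inv_mem hu))) (by group)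
  -- The translates partition the quotient and the function is constant on each of them.
  have hsum : φ = fun x => ∑ i, ((QuotientGroup.mk (s i) : G ⧸ N) • V).indicator
      (fun _ => φ (QuotientGroup.mk (s i))) x := by
    funext x
    obtain ⟨i, hi, hx⟩ := hcov x
    rw [Finset.sum_eq_single i, Set.indicator_of_mem hi, hx]
    · intro j _ hj
      exact Set.indicator_of_notMem (fun hj' => hj (hdisj j i x hj' hi)) _
    · simp
  have hfin : μ V ≠ ⊤ := hVc.measure_lt_top.ne
  refine ⟨μ, inferInstance, (μ.real V : ℂ), ?_, ?_⟩
  · rw [Complex.ofReal_ne_zero, measureReal_ne_zero_iff hfin]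
    exact (hVo.measure_pos μ ⟨1, h1V⟩).ne'
  · conv_lhs => rw [hsum]
    rw [integral_finsetSum, Finset.mul_sum]
    · refine Finset.sum_congr rfl fun i _ => ?_
      rw [integral_indicator_const _ (hVi i), Measure.real, hμV, Complex.real_smul]
      rfl
    · intro i _
      exact (integrable_indicator_iff (hVi i)).2
        (integrableOn_const (by rw [hμV]; exact hfin))

end Haar

/-! ### The topology of the adelic groups -/

section Topology

variable {F : Type*} [Field F]

instance fact_isOpen_integers :
    Fact (∀ w : Place F, IsOpen (w.integers : Set w.Completion)) := ⟨fun w => w.isOpen_integers⟩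

/-- The matrices with integral entries. -/
def integralMatrices (F : Type*) [Field F] : Set (Matrix (Fin 2) (Fin 2) (Adele F)) :=
  {m | ∀ i j w, m i j w ∈ w.integers}

theorem mem_maxCompact_iff_val {g : GL2 (Adele F)} :
    g ∈ maxCompact F ↔ g.val ∈ integralMatrices F ∧ g⁻¹.val ∈ integralMatrices F := by
  rw [mem_maxCompact]
  constructor
  · intro h
    refine ⟨fun i j w => (Place.mem_integralGL2_integers.1 (h w)).1 i j, fun i j w => ?_⟩
    have := h w
    rw [← inv_mem_iff, ← map_inv] at this
    exact (Place.mem_integralGL2_integers.1 this).1 i j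
  · rintro ⟨h1, h2⟩ w
    refine mem_integralGL2_iff.2 ⟨fun i j => h1 i j w, ?_⟩
    have h3 : ((component w g).val.det)⁻¹ = (component w g⁻¹).val.det := by
      rw [map_inv, Matrix.coe_units_inv, Matrix.det_nonsing_inv, Ring.inverse_eq_inv']
    rw [h3, Matrix.det_fin_two]
    exact sub_mem (mul_mem (h2 0 0 w) (h2 1 1 w)) (mul_mem (h2 0 1 w) (h2 1 0 w))

theorem isOpen_maxCompact : IsOpen (maxCompact F : Set (GL2 (Adele F))) := by
  have h1 : IsOpen {a : Adele F | ∀ w, a w ∈ w.integers} :=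
    RestrictedProduct.isOpen_forall_mem fun w => Place.isOpen_integers w
  have h2 : IsOpen (integralMatrices F) := by
    have e : integralMatrices F = ⋂ i, ⋂ j, {m | ∀ w, m i j w ∈ w.integers} := by
      ext m
      simp [integralMatrices]
    rw [e]
    refine isOpen_iInter_of_finite fun i => isOpen_iInter_of_finite fun j => ?_
    exact h1.preimage (continuous_id.matrix_elem i j)
  have e : (maxCompact F : Set (GL2 (Adele F))) =
      (fun g : GL2 (Adele F) => g.val) ⁻¹' integralMatrices F ∩
        (fun g : GL2 (Adele F) => g⁻¹.val) ⁻¹' integralMatrices F := by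
    ext g
    exact mem_maxCompact_iff_val
  rw [e]
  exact (h2.preimage Units.continuous_val).inter (h2.preimage Units.continuous_coe_inv)

/-- Tychonoff for the product of the rings of integers, together with the closed embedding of the
unit group by pairs of an element and its inverse. -/
theorem isCompact_maxCompact (hF : ∀ w : Place F, IsCompact (w.integers : Set w.Completion)) :
    IsCompact (maxCompact F : Set (GL2 (Adele F))) := by
  have h0 : ∀ w : Place F, CompactSpace w.integers := fun w => isCompact_iff_compactSpace.1 (hF w)
  have h1 : IsCompact {a : Adele F | ∀ w, a w ∈ w.integers} := by
    have e : {a : Adele F | ∀ w, a w ∈ w.integers} = Set.range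
        (RestrictedProduct.structureMap (fun w : Place F => w.Completion)
          (fun w => (w.integers : Set w.Completion)) Filter.cofinite) :=
      (RestrictedProduct.range_structureMap _ _).symm
    rw [e]
    exact isCompact_range RestrictedProduct.isEmbedding_structureMap.continuous
  have h2 : IsCompact (integralMatrices F) := by
    have e : integralMatrices F = (Set.univ.pi fun _ : Fin 2 => Set.univ.pi fun _ : Fin 2 =>
        {a : Adele F | ∀ w, a w ∈ w.integers} : Set (Fin 2 → Fin 2 → Adele F)) := by
      ext m
      exact ⟨fun h i _ j _ => h i j, fun h i j => h i trivial j trivial⟩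
    rw [e]
    exact isCompact_univ_pi fun _ => isCompact_univ_pi fun _ => h1
  have e : (maxCompact F : Set (GL2 (Adele F))) = Units.embedProduct _ ⁻¹'
      (integralMatrices F ×ˢ (MulOpposite.unop ⁻¹' integralMatrices F)) := by
    ext g
    exact mem_maxCompact_iff_val
  rw [e]
  refine Units.isClosedEmbedding_embedProduct.isCompact_preimage (h2.prod ?_)
  exact MulOpposite.opHomeomorph.symm.isClosedEmbedding.isCompact_preimage h2

theorem continuous_component (w : Place F) : Continuous (component w) := by
  refine Continuous.units_map _ ?_
  exact continuous_id.matrix_map (RestrictedProduct.continuous_eval w)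

end Topology

namespace PointlessCurve

variable {k F : Type*} [Field k] [Fintype k] [Field F] [Algebra k F] (C : PointlessCurve k F)
  {v : Place F} (hv : C.x ∉ v.1)

include hv in
theorem isCompact_integers (w : Place F) : IsCompact (w.integers : Set w.Completion) := by
  by_cases hw : w = v
  · subst hw
    refine (C.isUniformizer_t hv).isCompact_integers (s := Set.range (algebraMap k F))
      (Set.finite_range _) fun f hf => ?_
    obtain ⟨c, hc⟩ := C.exists_const hv hf
    exact ⟨_, ⟨c, rfl⟩, hc⟩
  · obtain ⟨ϖ, hϖ, -⟩ := C.exists_uniformizer hv hw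
    obtain ⟨s, hs, -, h⟩ := C.exists_residue_reps hv hw
    exact hϖ.isCompact_integers hs h

end PointlessCurve
end Toroidal
end

open scoped RestrictedProduct

noncomputable section

namespace Toroidal

/-! ### Quadratic tori -/

section Torus

variable {F E : Type*} [Field F] [Field E] [Algebra F E] (b : Module.Basis (Fin 2) F E)

/-- For a nonscalar matrix of size two the first basis vector is cyclic here, so a commuting matrix
is determined by its first column. -/
theorem exists_eq_of_commute {K : Type*} [Field K] {M B : Matrix (Fin 2) (Fin 2) K}
    (hB : B 1 0 ≠ 0) (h : M * B = B * M) : ∃ α β : K, M = α • 1 + β • B := by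
  have h1 := congrFun (congrFun h 0) 0
  have h2 := congrFun (congrFun h 1) 0
  simp only [Matrix.mul_apply, Fin.sum_univ_two] at h1 h2
  refine ⟨M 0 0 - M 1 0 / B 1 0 * B 0 0, M 1 0 / B 1 0, ?_⟩
  ext i j
  fin_cases i <;> fin_cases j <;> simp <;> field_simp
  · linear_combination h1
  · linear_combination h2

theorem leftMulMatrix_basis_tmul {K : Type*} [Field K] [Algebra F K] (a : K) (e : E) :
    Algebra.leftMulMatrix (Algebra.TensorProduct.basis K b) (a ⊗ₜ[F] e) =
      a • (Algebra.leftMulMatrix b e).map (algebraMap F K) := by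
  ext i j
  rw [Algebra.leftMulMatrix_eq_repr_mul, Algebra.TensorProduct.basis_apply,
    Algebra.TensorProduct.tmul_mul_tmul, mul_one, Algebra.TensorProduct.basis_repr_tmul,
    Matrix.smul_apply, Matrix.map_apply, Algebra.leftMulMatrix_eq_repr_mul]
  rfl

/-- The torus is the centralizer of one nonscalar element. In this form the tensor product algebras
at the places can be avoided. -/
theorem mem_range_units_map {K S : Type*} [Field K] [CommRing S] [Algebra K S]
    (B : Module.Basis (Fin 2) K S) {θ : S} (hθ : Algebra.leftMulMatrix B θ 1 0 ≠ 0)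
    {h : GL2 K} : h ∈ (Units.map (Algebra.leftMulMatrix B : S →* Matrix (Fin 2) (Fin 2) K)).range ↔
      h.val * Algebra.leftMulMatrix B θ = Algebra.leftMulMatrix B θ * h.val := by
  have hlin : ∀ M : Matrix (Fin 2) (Fin 2) K,
      M * Algebra.leftMulMatrix B θ = Algebra.leftMulMatrix B θ * M →
      ∃ x, Algebra.leftMulMatrix B x = M := by
    intro M hM
    obtain ⟨α, β, rfl⟩ := exists_eq_of_commute hθ hM
    exact ⟨α • 1 + β • θ, by simp⟩
  constructor
  · rintro ⟨x, rfl⟩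
    change Algebra.leftMulMatrix B x.val * _ = _ * Algebra.leftMulMatrix B x.val
    rw [← map_mul, ← map_mul, mul_comm]
  · intro hh
    obtain ⟨x, hx⟩ := hlin _ hh
    obtain ⟨y, hy⟩ := hlin h⁻¹.val (by
      have h1 : h⁻¹.val * h.val = 1 := Units.inv_mul h
      have h2 : h.val * h⁻¹.val = 1 := Units.mul_inv h
      calc _ = h⁻¹.val * (Algebra.leftMulMatrix B θ * h.val) * h⁻¹.val := by
            rw [mul_assoc, mul_assoc, h2, mul_one]
        _ = _ := by rw [← hh, ← mul_assoc, h1, one_mul])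
    have hxy : x * y = 1 := Algebra.leftMulMatrix_injective B (by
      rw [map_mul, hx, hy, map_one]
      exact Units.mul_inv h)
    exact ⟨⟨x, y, hxy, by rw [mul_comm, hxy]⟩, Units.ext hx⟩

variable {θ : E} {Θ : GL2 F} (hΘ : Θ.val = Algebra.leftMulMatrix b θ) (hΘ0 : Θ 1 0 ≠ 0)

include hΘ hΘ0

theorem mem_rationalTorus_iff {γ : GL2 F} : γ ∈ rationalTorus b ↔ Commute γ Θ := by
  rw [rationalTorus, mem_range_units_map b (θ := θ) (by rwa [← hΘ]), ← hΘ]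
  exact (Units.ext_iff (u := γ * Θ) (v := Θ * γ)).symm

theorem mem_localTorus_iff {w : Place F} {h : GL2 w.Completion} :
    h ∈ localTorus b w ↔ Commute h (toLocal w Θ) := by
  have e : Algebra.leftMulMatrix (Algebra.TensorProduct.basis w.Completion b) (1 ⊗ₜ[F] θ) =
      (toLocal w Θ).val := by
    rw [leftMulMatrix_basis_tmul, one_smul, ← hΘ]
    rfl
  rw [localTorus, mem_range_units_map (Algebra.TensorProduct.basis w.Completion b)
    (θ := 1 ⊗ₜ[F] θ), e]
  · exact (Units.ext_iff (u := h * toLocal w Θ) (v := toLocal w Θ * h)).symm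
  · rw [e]
    change algebraMap F w.Completion (Θ 1 0) ≠ 0
    simpa using hΘ0

theorem mem_adelicTorus_iff {s : GL2 (Adele F)} :
    s ∈ adelicTorus b ↔ ∀ w, Commute (component w s) (toLocal w Θ) := by
  simp only [adelicTorus, Subgroup.mem_iInf, Subgroup.mem_comap, mem_localTorus_iff b hΘ hΘ0]

theorem isClosed_adelicTorus : IsClosed (adelicTorus b : Set (GL2 (Adele F))) := by
  have e : (adelicTorus b : Set (GL2 (Adele F))) = ⋂ w : Place F,
      {s | component w s * toLocal w Θ = toLocal w Θ * component w s} := by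
    ext s
    simp only [SetLike.mem_coe, mem_adelicTorus_iff b hΘ hΘ0, Set.mem_iInter]
    rfl
  rw [e]
  refine isClosed_iInter fun w => isClosed_eq ?_ ?_
  · exact (continuous_component w).mul continuous_const
  · exact continuous_const.mul (continuous_component w)

omit hΘ hΘ0 in
-- The torus is commutative, so the ambiguity of the representative is a rational factor on the left
-- and a central one.
theorem toralTranslate_mk {f : GL2 (Adele F) → ℂ} (hf : f ∈ automorphicForms F)
    (g : GL2 (Adele F)) (s : adelicTorus b) :
    toralTranslate b f g (QuotientGroup.mk s : adelicTorus b ⧸ toralPeriods b) = f (s * g) := by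
  obtain ⟨p, hp, h⟩ : ∃ p ∈ toralPeriods b, Quotient.out (s := QuotientGroup.leftRel
      (toralPeriods b)) (QuotientGroup.mk s : adelicTorus b ⧸ toralPeriods b) = p * s := by
    refine ⟨s⁻¹ * Quotient.out (s := QuotientGroup.leftRel
      (toralPeriods b)) (QuotientGroup.mk s : adelicTorus b ⧸ toralPeriods b), ?_, ?_⟩
    · rw [← QuotientGroup.eq]
      exact (Quotient.out_eq _).symm
    · rw [adelicTorus_comm b _ s, mul_inv_cancel_left]
  obtain ⟨d, ⟨γ, hγ, hd⟩, z, hz, hdz⟩ := Subgroup.mem_sup_of_normal_right.1 hp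
  have e : ((p * s : adelicTorus b) : GL2 (Adele F)) * g = d * (s * g) * z := by
    have h1 : z * (s * g) = s * g * z := (Subgroup.mem_center_iff.1 hz _).symm
    rw [Subgroup.coe_mul, ← show d * z = p from hdz, mul_assoc d (s * g) z, ← h1]
    simp only [mul_assoc]
  change f ((Quotient.out (s := QuotientGroup.leftRel (toralPeriods b)) (QuotientGroup.mk s :
    adelicTorus b ⧸ toralPeriods b) : adelicTorus b) * g) = _
  rw [h, e, apply_mul_center hf hz]
  exact apply_diagonal_mul hf (mem_diagonal.2 ⟨γ, Subgroup.mem_top _, fun w => congrFun hd w⟩) _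

end Torus

namespace PointlessCurve

variable {k F E : Type*} [Field k] [Fintype k] [Field F] [Algebra k F] (C : PointlessCurve k F)
  {v : Place F} (hv : C.x ∉ v.1) [Field E] [Algebra F E]

include hv in
/-- The relation that a toroidal form for the quadratic constant extension satisfies. -/
theorem cuspRelation_zero (b : Module.Basis (Fin 2) F E) {θ : E}
    (hθ : θ ^ 2 + algebraMap F E (algebraMap k F C.a₃) * θ = algebraMap F E (algebraMap k F C.a₆))
    {u : k → k} (hu : ∀ l, 2 * u l = 0) (hu' : ∀ l, u l ^ 2 + C.a₃ * u l = l ^ 3 + C.a₄ * l)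
    {f : GL2 (Adele F) → ℂ} (hf : f ∈ toroidalFor b) : C.CuspRelation (toTree v f) 0 := by
  have hB := congrArg (Algebra.leftMulMatrix b) hθ
  rw [map_add, map_mul, map_pow, AlgHom.commutes, AlgHom.commutes] at hB
  set B := Algebra.leftMulMatrix b θ with hBdef
  have h00 := congrFun (congrFun hB 0) 0
  have h10 := congrFun (congrFun hB 1) 0
  simp [sq, Matrix.mul_apply, Fin.sum_univ_two, Matrix.algebraMap_matrix_apply] at h00 h10
  -- Otherwise an entry of the matrix would be a root of X² + a₃ X - a₆ in `F`.
  have hc : B 1 0 ≠ 0 := by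
    intro h0
    refine C.no_root hv (B 0 0) ?_
    rw [h0] at h00
    linear_combination h00
  have htr : B 0 0 + B 1 1 = -algebraMap k F C.a₃ := by
    refine mul_left_cancel₀ hc ?_
    linear_combination h10
  have hdet : B 0 0 * B 1 1 - B 0 1 * B 1 0 = -algebraMap k F C.a₆ := by
    linear_combination B 0 0 * htr - h00
  have hdet0 : B 0 0 * B 1 1 - B 0 1 * B 1 0 ≠ 0 := by
    rw [hdet]
    simpa using C.a₆_ne_zero
  have hP0 : 1 * B 1 0 - B 0 0 * 0 ≠ 0 := by simpa using hc
  have hΘP := C.mat_mul_mat_eq hdet0 hP0 htr hdet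
  obtain ⟨Θ, hΘdef⟩ : ∃ Θ, Θ = mat (B 0 0) (B 0 1) (B 1 0) (B 1 1) hdet0 := ⟨_, rfl⟩
  obtain ⟨P, hPdef⟩ : ∃ P, P = mat 1 (B 0 0) 0 (B 1 0) hP0 := ⟨_, rfl⟩
  rw [← hΘdef, ← hPdef] at hΘP
  have hΘ : Θ.val = Algebra.leftMulMatrix b θ := by
    rw [hΘdef, ← hBdef]
    ext i j
    fin_cases i <;> fin_cases j <;> rfl
  have hΘ0 : Θ 1 0 ≠ 0 := by rwa [hΘ]
  -- The period is taken at the translate by R, which conjugates the torus to the centralizer of the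
  -- companion matrix, whose classes are known.
  set R := C.diag hv P with hR
  have hRc : ∀ w, component w R = toLocal w P := fun w => C.component_diag hv w P
  have hconj : ∀ {w : Place F} {m : GL2 w.Completion}, Commute m (toLocal w C.companion) ↔
      Commute (toLocal w P * m * (toLocal w P)⁻¹) (toLocal w Θ) := by
    intro w m
    have e : toLocal w Θ = toLocal w P * toLocal w C.companion * (toLocal w P)⁻¹ := by
      rw [← map_mul, ← hΘP, map_mul, mul_inv_cancel_right]
    rw [e]
    exact (Commute.conj_iff (toLocal w P)).symm
  have hT : ∀ {m : GL2 (Adele F)}, R * m * R⁻¹ ∈ adelicTorus b ↔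
      ∀ w, Commute (component w m) (toLocal w C.companion) := by
    intro m
    rw [mem_adelicTorus_iff b hΘ hΘ0]
    refine forall_congr' fun w => ?_
    rw [map_mul, map_mul, map_inv, hRc, ← hconj]
  have hγ : ∀ {τ : GL2 F}, Commute τ C.companion ↔ P * τ * P⁻¹ ∈ rationalTorus b := by
    intro τ
    rw [mem_rationalTorus_iff b hΘ hΘ0, show Θ = P * C.companion * P⁻¹ by
      rw [← hΘP, mul_inv_cancel_right]]
    exact (Commute.conj_iff P).symm
  choose M hM using C.exists_isRep hv hu hu'
  let S : Option (k × Bool) → adelicTorus b := fun i => ⟨R * M i * R⁻¹, hT.2 (hM i).commute⟩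
  -- The stabilizer under which the translated form is invariant: the intersection of the torus with
  -- R K R⁻¹.
  let U : Subgroup (adelicTorus b) :=
    (maxCompact F).comap ((MulAut.conj R⁻¹).toMonoidHom.comp (adelicTorus b).subtype)
  have hU : ∀ s : adelicTorus b, s ∈ U ↔ R⁻¹ * s * R ∈ maxCompact F := by
    intro s
    change R⁻¹ * s * R⁻¹⁻¹ ∈ maxCompact F ↔ _
    rw [inv_inv]
  have hemb : Topology.IsClosedEmbedding fun s : adelicTorus b => R⁻¹ * s * R :=
    (Homeomorph.mulRight R).isClosedEmbedding.comp
      ((Homeomorph.mulLeft R⁻¹).isClosedEmbedding.comp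
        (isClosed_adelicTorus b hΘ hΘ0).isClosedEmbedding_subtypeVal)
  have hUset : (U : Set (adelicTorus b)) = (fun s : adelicTorus b => R⁻¹ * s * R) ⁻¹'
      (maxCompact F : Set (GL2 (Adele F))) := by
    ext s
    exact hU s
  have hUo : IsOpen (U : Set (adelicTorus b)) := by
    rw [hUset]
    exact isOpen_maxCompact.preimage hemb.continuous
  have hUc : IsCompact (U : Set (adelicTorus b)) := by
    rw [hUset]
    exact hemb.isCompact_preimage (isCompact_maxCompact (C.isCompact_integers hv))
  have hzc : ∀ {z : GL2 (Adele F)}, z ∈ Subgroup.center (GL2 (Adele F)) → ∀ g, z * g = g * z :=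
    fun hz g => (Subgroup.mem_center_iff.1 hz g).symm
  have hdiagτ : ∀ τ : GL2 F, C.diag hv (P * τ * P⁻¹) = R * C.diag hv τ * R⁻¹ := by
    intro τ
    refine component_injective fun w => ?_
    rw [component_diag, map_mul, map_mul, map_mul, map_mul, map_inv, map_inv, hRc, component_diag]
  have hcls : ∀ (i : Option (k × Bool)) (τ : GL2 F) (s : GL2 (Adele F)) {z : GL2 (Adele F)},
      z ∈ Subgroup.center (GL2 (Adele F)) →
      R⁻¹ * ((R * M i * R⁻¹ * (C.diag hv (P * τ * P⁻¹) * z))⁻¹ * s) * R =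
        (M i * C.diag hv τ * z)⁻¹ * (R⁻¹ * s * R) := by
    intro i τ s z hz
    have e : R * C.diag hv τ * R⁻¹ * z = R * (C.diag hv τ * z) * R⁻¹ := by
      rw [mul_assoc _ R⁻¹ z, ← hzc hz R⁻¹]
      group
    rw [hdiagτ, e]
    group
  have hcomm : ∀ (i : Option (k × Bool)) {τ : GL2 F}, Commute τ C.companion →
      M i * C.diag hv τ = C.diag hv τ * M i := by
    intro i τ hτ
    have h1 : R * C.diag hv τ * R⁻¹ ∈ adelicTorus b := hT.2 fun w => by
      rw [component_diag]
      exact hτ.map (toLocal w)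
    have h2 : R * M i * R⁻¹ * (R * C.diag hv τ * R⁻¹) = R * C.diag hv τ * R⁻¹ * (R * M i * R⁻¹) :=
      congrArg Subtype.val (adelicTorus_comm b (S i) ⟨_, h1⟩)
    calc M i * C.diag hv τ = R⁻¹ * (R * M i * R⁻¹ * (R * C.diag hv τ * R⁻¹)) * R := by group
      _ = _ := by
        rw [h2]
        group
  let : MeasurableSpace (adelicTorus b ⧸ toralPeriods b) := borel _
  have : BorelSpace (adelicTorus b ⧸ toralPeriods b) := ⟨rfl⟩
  have hint := exists_haar_integral_eq_sum (toralPeriods b) hUo hUc (s := S)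
    (φ := toralTranslate b f R) ?_ ?_ ?_
  · obtain ⟨μ, hμ, c, hc0, hsum⟩ := hint
    have h0 := (hf.2 R μ hμ).2
    have h1 := (mul_eq_zero.1 (hsum.symm.trans h0)).resolve_left hc0
    have h2 : ∀ i, toralTranslate b f R (QuotientGroup.mk (S i) : adelicTorus b ⧸ toralPeriods b) =
        toTree v f (C.labelVertex v (torusLabel i)) := by
      intro i
      rw [toralTranslate_mk b hf.1]
      change f (R * M i * R⁻¹ * R) = _
      rw [inv_mul_cancel_right, apply_diagonal_mul hf.1 (C.diag_mem hv (Subgroup.mem_top P)),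
        C.apply_eq_toTree hv hf.1 (hM i).mem, (hM i).component_eq_one, mul_one,
        ← C.vertex_eps hv u i]
      rfl
    -- The sum has one term for c_0 and two equal terms for each t_l, which is the relation C_0 =
    -- -2(T_1 + ... + T_q).
    simp only [h2, Fintype.sum_option, Fintype.sum_prod_type, Fintype.sum_bool, torusLabel] at h1
    unfold CuspRelation
    simp only [coeff, sumT]
    rw [Finset.sum_add_distrib] at h1
    linear_combination h1
  · intro s
    obtain ⟨i, τ, hτ, z, hz, hκ⟩ := C.exists_class hv hu hu' hM (m := R⁻¹ * s * R) (by
      rw [← hT]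
      convert s.2 using 1
      group)
    have hzT : z ∈ adelicTorus b := by
      refine (mem_adelicTorus_iff b hΘ hΘ0).2 fun w => ?_
      have h1 := congrArg (component w) (hzc hz (C.diag hv Θ))
      rw [map_mul (component w) z, map_mul (component w) _ z, component_diag] at h1
      exact h1
    have hdT : C.diag hv (P * τ * P⁻¹) ∈ adelicTorus b := by
      rw [hdiagτ]
      refine hT.2 fun w => ?_
      rw [component_diag]
      exact hτ.map (toLocal w)
    refine ⟨i, ⟨_, mul_mem hdT hzT⟩, Subgroup.mem_subgroupOf.2 (Subgroup.mul_mem_sup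
      (C.diag_mem hv (hγ.1 hτ)) hz), (S i * ⟨_, mul_mem hdT hzT⟩)⁻¹ * s, ?_,
      (mul_inv_cancel_left _ _).symm⟩
    rw [hU]
    change R⁻¹ * ((R * M i * R⁻¹ * (C.diag hv (P * τ * P⁻¹) * z))⁻¹ * s) * R ∈ maxCompact F
    rw [hcls i τ s hz, hcomm i hτ]
    exact hκ
  · intro i j n hn x hx hij
    obtain ⟨d, ⟨γ, hγT, hd⟩, z, hz, hdz⟩ := Subgroup.mem_sup_of_normal_right.1 hn
    have hdγ : d = C.diag hv (P * (P⁻¹ * γ * P) * P⁻¹) := by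
      refine component_injective fun w => ?_
      rw [component_diag, show P * (P⁻¹ * γ * P) * P⁻¹ = γ by group]
      exact (congrFun hd w).symm
    have hτ : Commute (P⁻¹ * γ * P) C.companion := hγ.2 (by
      rwa [show P * (P⁻¹ * γ * P) * P⁻¹ = γ by group])
    have hx' : x = (S i * n)⁻¹ * S j := by rw [hij, inv_mul_cancel_left]
    have hx1 := (hU x).1 hx
    rw [hx', Subgroup.coe_mul, Subgroup.coe_inv, Subgroup.coe_mul,
      ← show d * z = n from hdz, hdγ] at hx1
    change R⁻¹ * ((R * M i * R⁻¹ * (C.diag hv (P * (P⁻¹ * γ * P) * P⁻¹) * z))⁻¹ *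
      (R * M j * R⁻¹)) * R ∈ maxCompact F at hx1
    rw [hcls i _ _ hz, hcomm i hτ, show R⁻¹ * (R * M j * R⁻¹) * R = M j by group] at hx1
    exact C.eq_of_class hv hu hu' hM hτ hz hx1
  · intro s x hx
    rw [toralTranslate_mk b hf.1, toralTranslate_mk b hf.1]
    have e : ((s * x : adelicTorus b) : GL2 (Adele F)) * R = s * R * (R⁻¹ * x * R) := by
      rw [Subgroup.coe_mul]
      group
    rw [e, apply_mul_maxCompact hf.1 ((hU x).1 hx)]

end PointlessCurve
end Toroidal
end

open scoped RestrictedProduct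

noncomputable section

namespace Toroidal

/-! ### Toroidal forms of the quadratic constant extension -/

open Polynomial in
/-- A field of `q²` elements contains the roots of quadratic polynomials over a field of `q`
elements. -/
theorem exists_quadratic_root {k E : Type*} [Field k] [Fintype k] [Field E] [Algebra k E]
    (κ : Subfield E) (hκ : Nat.card κ = Fintype.card k ^ 2) (a c : k) :
    ∃ θ : E, θ ^ 2 + algebraMap k E a * θ = algebraMap k E c := by
  have : Finite κ := Nat.finite_of_card_ne_zero (by
    rw [hκ]
    exact pow_ne_zero 2 Fintype.card_ne_zero)
  have := Fintype.ofFinite κ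
  let L := AlgebraicClosure E
  obtain ⟨θ, hθ⟩ := IsAlgClosed.exists_root (X ^ 2 + C (algebraMap k L a) * X - C (algebraMap k L c))
    (by
      rw [show (X ^ 2 + C (algebraMap k L a) * X - C (algebraMap k L c) : L[X]) =
        C 1 * X ^ 2 + C (algebraMap k L a) * X + C (-algebraMap k L c) by simp; ring,
        degree_quadratic one_ne_zero]
      decide)
  replace hθ : θ ^ 2 + algebraMap k L a * θ = algebraMap k L c := by
    simpa [IsRoot, sub_eq_zero] using hθ
  have hfrob : (θ ^ Fintype.card k) ^ 2 + algebraMap k L a * θ ^ Fintype.card k =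
      algebraMap k L c := by
    have h := congrArg (FiniteField.frobeniusAlgHom k L) hθ
    simpa only [map_add, map_mul, map_pow, AlgHom.commutes,
      FiniteField.frobeniusAlgHom_apply] using h
  -- Frobenius permutes the roots θ and -a - θ, so its square fixes θ.
  have hpow : θ ^ Fintype.card k ^ 2 = θ := by
    rw [sq, pow_mul]
    have h : (θ ^ Fintype.card k - θ) * (θ ^ Fintype.card k + algebraMap k L a + θ) = 0 := by
      linear_combination hfrob - hθ
    rcases mul_eq_zero.1 h with h | h
    · rw [sub_eq_zero.1 h, sub_eq_zero.1 h]
    · have h2 := congrArg (FiniteField.frobeniusAlgHom k L) h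
      simp only [map_add, map_zero, AlgHom.commutes, FiniteField.frobeniusAlgHom_apply] at h2
      linear_combination h2 - h
  -- The elements of κ already exhaust the roots of X^(q²) - X.
  obtain ⟨z, hz⟩ : ∃ z : κ, algebraMap E L z = θ := by
    by_contra! hne
    have hinj : Function.Injective fun z : κ => algebraMap E L z :=
      (algebraMap E L).injective.comp Subtype.val_injective
    classical
    have h1 : 1 < Fintype.card k ^ 2 := Nat.one_lt_pow two_ne_zero Fintype.one_lt_card
    have hcard : Fintype.card κ = Fintype.card k ^ 2 := by rw [← hκ, Nat.card_eq_fintype_card]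
    have h2 := card_le_degree_of_subset_roots
      (p := X ^ Fintype.card k ^ 2 - X) (Z := insert θ (Finset.univ.image fun z : κ => algebraMap E L z))
      (fun r hr => by
        rw [mem_roots (FiniteField.X_pow_card_sub_X_ne_zero L h1), IsRoot, eval_sub, eval_pow,
          eval_X, sub_eq_zero]
        rcases Finset.mem_insert.1 hr with rfl | hr
        · exact hpow
        · obtain ⟨z, -, rfl⟩ := Finset.mem_image.1 hr
          have h := FiniteField.pow_card z
          rw [hcard] at h
          rw [← map_pow, ← SubmonoidClass.coe_pow, h])
    rw [Finset.card_insert_of_notMem (by simpa using fun a ha => hne ⟨a, ha⟩),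
      Finset.card_image_of_injective _ hinj, Finset.card_univ, hcard,
      FiniteField.X_pow_card_sub_X_natDegree_eq L h1] at h2
    omega
  refine ⟨z, (algebraMap E L).injective ?_⟩
  rw [map_add, map_mul, map_pow, hz, ← IsScalarTower.algebraMap_apply,
    ← IsScalarTower.algebraMap_apply, hθ]

namespace PointlessCurve

variable {k F E : Type*} [Field k] [Fintype k] [Field F] [Algebra k F] (C : PointlessCurve k F)
  {v : Place F} (hv : C.x ∉ v.1) [Field E] [Algebra F E]

include hv in
-- The restrictions of toroidal forms are a Hecke-stable set satisfying the first relation, and so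
-- all relations follow.
theorem cuspRelation_toTree (b : Module.Basis (Fin 2) F E) {θ : E}
    (hθ : θ ^ 2 + algebraMap F E (algebraMap k F C.a₃) * θ = algebraMap F E (algebraMap k F C.a₆))
    {u : k → k} (hu : ∀ l, 2 * u l = 0) (hu' : ∀ l, u l ^ 2 + C.a₃ * u l = l ^ 3 + C.a₄ * l)
    {f : GL2 (Adele F) → ℂ} (hf : f ∈ toroidalFor b) (n : ℕ) : C.CuspRelation (toTree v f) n := by
  refine C.cuspRelation_of_forall hv (P := toTree v '' (toroidalFor b : Set (GL2 (Adele F) → ℂ)))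
    ?_ ?_ ?_ n _ ⟨f, hf, rfl⟩
  · rintro _ ⟨f, hf, rfl⟩
    exact C.toTree_mem hv hf.1
  · rintro _ ⟨f, hf, rfl⟩
    exact ⟨_, C.hecke_mem_toroidalFor hv hf, C.toTree_hecke hv hf.1⟩
  · rintro _ ⟨f, hf, rfl⟩
    exact C.cuspRelation_zero hv b hθ hu hu' hf

include hv in
theorem rank_toroidalFor_le (b : Module.Basis (Fin 2) F E) {θ : E}
    (hθ : θ ^ 2 + algebraMap F E (algebraMap k F C.a₃) * θ = algebraMap F E (algebraMap k F C.a₆))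
    {u : k → k} (hu : ∀ l, 2 * u l = 0) (hu' : ∀ l, u l ^ 2 + C.a₃ * u l = l ^ 3 + C.a₄ * l)
    (V : Submodule ℂ (TreeVertex v → ℂ))
    (hV : ∀ φ, φ ∈ V ↔ φ ∈ quotientGraphFunctions v ∧ ∀ n, C.CuspRelation φ n) :
    Module.rank ℂ (toroidalFor b) ≤ ((Fintype.card k + 2 : ℕ) : Cardinal) := by
  rw [← C.rank_eq hv V hV]
  have hmem : ∀ f ∈ toroidalFor b, toTree v f ∈ V := fun f hf =>
    (hV _).2 ⟨C.toTree_mem hv hf.1, C.cuspRelation_toTree hv b hθ hu hu' hf⟩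
  let L : toroidalFor b →ₗ[ℂ] V :=
    { toFun := fun f => ⟨toTree v f.1, hmem _ f.2⟩
      map_add' := fun _ _ => rfl
      map_smul' := fun _ _ => rfl }
  refine L.rank_le_of_injective fun f f' h => Subtype.ext ?_
  exact C.toTree_injective hv f.2.1 f'.2.1 (congrArg Subtype.val h)

open Polynomial in
/-- The field `F` has a quadratic constant extension. -/
theorem exists_quadratic_extension {F : Type} [Field F] [Algebra k F] (C : PointlessCurve k F)
    {v : Place F} (hv : C.x ∉ v.1) : ∃ (E : Type) (_ : Field E) (_ : Algebra F E) (θ : E),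
      Algebra.IsSeparable F E ∧ Nonempty (Module.Basis (Fin 2) F E) ∧
      θ ^ 2 + algebraMap F E (algebraMap k F C.a₃) * θ = algebraMap F E (algebraMap k F C.a₆) := by
  obtain ⟨p, hp⟩ : ∃ p, p = X ^ 2 + Polynomial.C (algebraMap k F C.a₃) * X -
    Polynomial.C (algebraMap k F C.a₆) := ⟨_, rfl⟩
  have hp' : p = Polynomial.C 1 * X ^ 2 + Polynomial.C (algebraMap k F C.a₃) * X +
      Polynomial.C (-algebraMap k F C.a₆) := by
    rw [hp]
    simp
    ring
  have hdeg : p.natDegree = 2 := by rw [hp', natDegree_quadratic one_ne_zero]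
  have hmonic : p.Monic := by rw [Monic, hp', leadingCoeff_quadratic one_ne_zero]
  have hirr : Irreducible p := by
    refine irreducible_of_degree_le_three_of_not_isRoot (by simp [hdeg]) fun f hf => ?_
    refine C.no_root hv f ?_
    rw [hp] at hf
    simpa [IsRoot, sub_eq_zero] using hf
  have hsep : p.Separable := by
    obtain ⟨d, hd⟩ : ∃ d, d = algebraMap k F C.a₃ ^ 2 + 4 * algebraMap k F C.a₆ :=
      ⟨_, rfl⟩
    have hd0 : d ≠ 0 := by
      rw [hd, ← map_pow, show (4 : F) = algebraMap k F 4 from (map_ofNat _ 4).symm, ← map_mul,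
        ← map_add]
      exact (_root_.map_ne_zero _).2 (by simpa using C.disc_ne_zero 0)
    have hdC : Polynomial.C d⁻¹ * Polynomial.C d = 1 := by
      rw [← Polynomial.C_mul, inv_mul_cancel₀ hd0, Polynomial.C_1]
    -- These Bézout coefficients express that the square of the derivative minus 4p is the
    -- discriminant d.
    refine ⟨-4 * Polynomial.C d⁻¹, Polynomial.C d⁻¹ * derivative p, ?_⟩
    have hder : derivative p = 2 * X + Polynomial.C (algebraMap k F C.a₃) := by
      rw [hp]
      simp [one_add_one_eq_two, Polynomial.C_ofNat]
    have hdC' : Polynomial.C d = Polynomial.C (algebraMap k F C.a₃) ^ 2 +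
        4 * Polynomial.C (algebraMap k F C.a₆) := by
      rw [hd]
      simp [Polynomial.C_ofNat]
    rw [hder, ← hdC, hp]
    linear_combination -Polynomial.C d⁻¹ * hdC'
  obtain ⟨θ, hθ⟩ := IsAlgClosed.exists_aeval_eq_zero (AlgebraicClosure F) p
    (by rw [degree_eq_natDegree hmonic.ne_zero, hdeg]; decide)
  have hint : IsIntegral F θ := ⟨p, hmonic, hθ⟩
  have hmin : p = minpoly F θ := minpoly.eq_of_irreducible_of_monic hirr hθ hmonic
  refine ⟨IntermediateField.adjoin F {θ}, inferInstance, inferInstance,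
    IntermediateField.AdjoinSimple.gen F θ, ?_, ?_, ?_⟩
  · rw [IntermediateField.isSeparable_adjoin_simple_iff_isSeparable, IsSeparable, ← hmin]
    exact hsep
  · have : Module.Finite F (IntermediateField.adjoin F {θ}) :=
      IntermediateField.adjoin.finiteDimensional hint
    exact ⟨Module.finBasisOfFinrankEq _ _ (by
      rw [IntermediateField.adjoin.finrank hint, ← hmin, hdeg])⟩
  · apply Subtype.ext
    rw [hp] at hθ
    simpa [sub_eq_zero] using hθ

end PointlessCurve

/-! ### The special curves -/

section Special

variable {k : Type*} [Field k]

open WeierstrassCurve.Affine Polynomial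

theorem equation_xFun_yFun (W : WeierstrassCurve.Affine k) :
    yFun W ^ 2 + algebraMap k W.FunctionField W.a₁ * xFun W * yFun W +
      algebraMap k W.FunctionField W.a₃ * yFun W = xFun W ^ 3 +
      algebraMap k W.FunctionField W.a₂ * xFun W ^ 2 + algebraMap k W.FunctionField W.a₄ * xFun W +
      algebraMap k W.FunctionField W.a₆ := by
  have h := congrArg (algebraMap W.CoordinateRing W.FunctionField)
    (AdjoinRoot.mk_self (f := W.polynomial))
  have hk : ∀ c : k, algebraMap W.CoordinateRing W.FunctionField
      (CoordinateRing.mk W (Polynomial.C (Polynomial.C c))) = algebraMap k W.FunctionField c :=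
    fun c => (IsScalarTower.algebraMap_apply k W.CoordinateRing W.FunctionField c).symm
  change algebraMap W.CoordinateRing W.FunctionField (CoordinateRing.mk W W.polynomial) =
    algebraMap W.CoordinateRing W.FunctionField 0 at h
  simp only [WeierstrassCurve.Affine.polynomial, map_sub, map_add, map_mul, map_pow, hk,
    map_zero] at h
  change yFun W ^ 2 + (_ * xFun W + _) * yFun W - (xFun W ^ 3 + _ * xFun W ^ 2 + _ * xFun W + _) = 0
    at h
  linear_combination h

theorem algebraMap_mem_adjoin (W : WeierstrassCurve.Affine k) (z : W.CoordinateRing) :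
    algebraMap W.CoordinateRing W.FunctionField z ∈ Algebra.adjoin k {xFun W, yFun W} := by
  have hx : xFun W ∈ Algebra.adjoin k {xFun W, yFun W} := Algebra.subset_adjoin (Or.inl rfl)
  have hy : yFun W ∈ Algebra.adjoin k {xFun W, yFun W} := Algebra.subset_adjoin (Or.inr rfl)
  have hp : ∀ p : k[X], algebraMap W.CoordinateRing W.FunctionField
      (CoordinateRing.mk W (Polynomial.C p)) ∈ Algebra.adjoin k {xFun W, yFun W} := by
    intro p
    induction p using Polynomial.induction_on' with
    | add p q hp hq =>
      rw [Polynomial.C_add, map_add, map_add]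
      exact add_mem hp hq
    | monomial n a =>
      rw [← Polynomial.C_mul_X_pow_eq_monomial, Polynomial.C_mul, Polynomial.C_pow, map_mul,
        map_mul, map_pow, map_pow]
      refine mul_mem ?_ (pow_mem hx n)
      exact Subalgebra.algebraMap_mem _ a
  obtain ⟨p, q, rfl⟩ := CoordinateRing.exists_smul_basis_eq z
  rw [CoordinateRing.smul, CoordinateRing.smul, mul_one, map_add, map_mul]
  exact add_mem (hp p) (mul_mem (hp q) hy)

/-- The function field of a Weierstrass curve without affine rational points. -/
def PointlessCurve.ofWeierstrass (W : WeierstrassCurve.Affine k) (h₁ : W.a₁ = 0) (h₂ : W.a₂ = 0)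
    (hW : ∀ r s : k, s ^ 2 + W.a₃ * s ≠ r ^ 3 + W.a₄ * r + W.a₆)
    (hW' : ∀ r : k, W.a₃ ^ 2 + 4 * (r ^ 3 + W.a₄ * r + W.a₆) ≠ 0) :
    PointlessCurve k W.FunctionField where
  x := xFun W
  y := yFun W
  a₃ := W.a₃
  a₄ := W.a₄
  a₆ := W.a₆
  x_ne_zero := xFun_ne_zero W
  y_ne_zero := yFun_ne_zero W
  equation := by simpa [h₁, h₂] using equation_xFun_yFun W
  no_point := hW
  disc_ne_zero := hW'
  exists_div f := by
    obtain ⟨a, b, hb, rfl⟩ := IsFractionRing.div_surjective (A := W.CoordinateRing) f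
    refine ⟨_, algebraMap_mem_adjoin W a, _, algebraMap_mem_adjoin W b, fun h => ?_, rfl⟩
    exact nonZeroDivisors.ne_zero hb ((IsFractionRing.injective W.CoordinateRing W.FunctionField)
      (h.trans (map_zero _).symm))

/-- Everything follows from l^q = l. For q = 2 and q = 3 the polynomial l³ + a₄ l vanishes on `k`,
so u = 0 works. -/
theorem IsSpecialCurve.two_or_three_or_four [Fintype k] {q : ℕ} {W : WeierstrassCurve.Affine k}
    (h : IsSpecialCurve q W) : Fintype.card k = q ∧ W.a₁ = 0 ∧ W.a₂ = 0 ∧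
      (∀ r s : k, s ^ 2 + W.a₃ * s ≠ r ^ 3 + W.a₄ * r + W.a₆) ∧
      (∀ r : k, W.a₃ ^ 2 + 4 * (r ^ 3 + W.a₄ * r + W.a₆) ≠ 0) ∧
      ∃ u : k → k, (∀ l, 2 * u l = 0) ∧ ∀ l, u l ^ 2 + W.a₃ * u l = l ^ 3 + W.a₄ * l := by
  have hF : ∀ l : k, l ^ Fintype.card k = l := FiniteField.pow_card
  have hc : ((Fintype.card k : ℕ) : k) = 0 := Nat.cast_card_eq_zero k
  rcases h with h | h | ⟨h, α, h₀, h₁⟩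
  all_goals
    rw [Nat.card_eq_fintype_card] at h
    rw [h] at hF hc
    refine ⟨h, rfl, rfl, ?_⟩
  · have h2 : (2 : k) = 0 := by exact_mod_cast hc
    refine ⟨fun r s hrs => one_ne_zero (α := k) ?_, fun r h0 => one_ne_zero (α := k) ?_, 0, ?_, ?_⟩
    · linear_combination (-1 : k) * hrs + hF s - (r + 1) * hF r + (s - r) * h2
    · linear_combination h0 - 2 * (r ^ 3 + 1 * r + 1) * h2
    · intro l
      simp
    · intro l
      simp only [Pi.zero_apply]
      linear_combination -(l + 1) * hF l - l * h2
  · have h3 : (3 : k) = 0 := by exact_mod_cast hc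
    refine ⟨fun r s hrs => one_ne_zero (α := k) ?_, fun r h0 => one_ne_zero (α := k) ?_, 0, ?_, ?_⟩
    -- Over the field of three elements a point would make -1 a square.
    · have h1 : s ^ 2 = -1 := by linear_combination hrs + hF r
      have h4 : s = 0 := by linear_combination s * h3 - s * h1 + hF s
      rw [h4] at h1
      linear_combination h1
    · linear_combination -h0 + 4 * hF r - h3
    · intro l
      simp
    · intro l
      simp only [Pi.zero_apply]
      linear_combination -hF l
  · have h4 : (2 : k) * 2 = 0 := by
      norm_num
      exact_mod_cast hc
    have h2 : (2 : k) = 0 := mul_self_eq_zero.1 h4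
    have h01 : ∀ z : k, z ^ 2 = z → z = 0 ∨ z = 1 := by
      intro z hz
      have h : z * (z - 1) = 0 := by linear_combination hz
      exact (mul_eq_zero.1 h).imp id sub_eq_zero.1
    -- Over the field of four elements both s² + s and r³ take only the values 0 and 1, so a point
    -- would put α among them.
    have hs : ∀ s : k, s ^ 2 + s = 0 ∨ s ^ 2 + s = 1 := by
      intro s
      refine h01 _ ?_
      linear_combination hF s + s ^ 3 * h2
    have hr : ∀ r : k, r = 0 ∨ r ^ 3 = 1 := by
      intro r
      have h : r * (r ^ 3 - 1) = 0 := by linear_combination hF r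
      exact (mul_eq_zero.1 h).imp id sub_eq_zero.1
    have hα : α ^ 2 + α = 1 := by
      refine (hs α).resolve_left fun h => ?_
      have h' : α * (α + 1) = 0 := by linear_combination h
      rcases mul_eq_zero.1 h' with h' | h'
      · exact h₀ h'
      · exact h₁ (by linear_combination h' - h2)
    -- Since l³ is 0 or 1 and α² + α = 1, the choice u(l) = l³α solves u² + u = l³.
    refine ⟨fun r s hrs => ?_, fun r h0 => one_ne_zero (α := k) ?_, fun l => l ^ 3 * α,
      ?_, ?_⟩
    · rcases hr r with hr | hr <;> rcases hs s with hs | hs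
      · exact h₀ (by rw [hr] at hrs; linear_combination hs - hrs)
      · exact h₁ (by rw [hr] at hrs; linear_combination hs - hrs)
      · exact h₁ (by linear_combination hs - hrs - hr - h2)
      · exact h₀ (by linear_combination hs - hrs - hr)
    · linear_combination h0 - 2 * (r ^ 3 + 0 * r + α) * h2
    · intro l
      rw [h2, zero_mul]
    · intro l
      rcases hr l with hl | hl
      · simp [hl]
      · simp only [hl]
        linear_combination hα

end Special

end Toroidal
end

/-! ### The main theorem -/

open Toroidal in
theorem mainTheorem4 (q : ℕ) (hq : q = 2 ∨ q = 3 ∨ q = 4) :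
    ∃ lam mu nu : ℕ → ℂ,
      ∀ (k : Type) [Field k] [Fintype k] (W : WeierstrassCurve.Affine k)
        (_ : Toroidal.IsSpecialCurve q W)
        (v : Toroidal.Place W.FunctionField) (_ : Toroidal.xFun W ∉ v.1),
        (∀ φ ∈ Toroidal.spaceS W v lam mu nu,
          Toroidal.heckeOp v (Toroidal.unif W) φ ∈ Toroidal.spaceS W v lam mu nu) ∧
        Module.rank ℂ (Toroidal.spaceS W v lam mu nu) = ((q + 2 : ℕ) : Cardinal) ∧
        (∀ (E : Type) [Field E] [Algebra W.FunctionField E],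
          Toroidal.IsQuadraticConstantExtension W.FunctionField E q →
          ∀ b : Module.Basis (Fin 2) W.FunctionField E,
            (∀ f ∈ Toroidal.toroidalFor b,
              Toroidal.toTree v f ∈ Toroidal.spaceS W v lam mu nu) ∧
            Module.rank ℂ (Toroidal.toroidalFor b) ≤ ((q + 2 : ℕ) : Cardinal)) ∧
        Module.Finite ℂ (Toroidal.toroidalForms W.FunctionField) := by
  refine ⟨fun n => (coeff q n).1, fun n => (coeff q n).2.1, fun n => (coeff q n).2.2, ?_⟩
  intro k _ _ W hW v hv
  obtain ⟨rfl, h₁, h₂, h₃, h₄, u, hu, hu'⟩ := hW.two_or_three_or_four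
  obtain ⟨C, hC⟩ : ∃ C, C = PointlessCurve.ofWeierstrass W h₁ h₂ h₃ h₄ := ⟨_, rfl⟩
  have hCv : C.x ∉ v.1 := by rwa [hC]
  have hCt : C.t = unif W := by rw [hC]; rfl
  -- By the parity of the coefficients the uniform relations are the even and odd relations of the
  -- statement, and the one of index 0 is the extra condition on C_0.
  have hS : ∀ φ : TreeVertex v → ℂ, φ ∈ spaceS W v (fun n => (coeff (Fintype.card k) n).1)
      (fun n => (coeff (Fintype.card k) n).2.1) (fun n => (coeff (Fintype.card k) n).2.2) ↔
      φ ∈ quotientGraphFunctions v ∧ ∀ n, C.CuspRelation φ n := by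
    subst hC
    set C := PointlessCurve.ofWeierstrass W h₁ h₂ h₃ h₄
    have hc : ∀ n, C.labelVertex v (.c n) = cVertex W v n := by
      intro n
      change vertex v (affineMat (unif W ^ (-n : ℤ)) 0) = vertex v (affineMat ((unif W)⁻¹ ^ n) 0)
      rw [zpow_neg, zpow_natCast, inv_pow]
    have hz₀ : C.labelVertex v .z₀ = zVertex₀ W v := by
      change vertex v (affineMat (unif W ^ (0 : ℤ)) (unif W : W.FunctionField)⁻¹) = _
      rw [zpow_zero, ← Units.val_inv_eq_inv_val]
      rfl
    have hz₁ : C.labelVertex v .z₁ = zVertex₁ W v := by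
      change vertex v (affineMat (unif W ^ (1 : ℤ)) (unif W : W.FunctionField)⁻¹) = _
      rw [zpow_one, ← Units.val_inv_eq_inv_val]
      rfl
    have ht : ∀ φ : TreeVertex v → ℂ, C.sumT φ = tSum W v φ := by
      intro φ
      refine Finset.sum_congr rfl fun l _ => congrArg φ ?_
      change vertex v (affineMat (unif W ^ (2 : ℤ)) _) = _
      rw [zpow_ofNat]
      change vertex v (affineMat (unif W ^ 2) ((unif W : W.FunctionField)⁻¹ +
        algebraMap k W.FunctionField l * (unif W : W.FunctionField))) = _
      rw [← Units.val_inv_eq_inv_val]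
      rfl
    intro φ
    simp only [PointlessCurve.CuspRelation, hc, hz₀, hz₁, ht]
    refine and_congr_right fun _ => ⟨fun ⟨h, h'⟩ n => ?_, fun h => ⟨?_, fun n => ⟨fun hn => ?_,
      fun hn => ?_⟩⟩⟩
    · rcases Nat.even_or_odd n with hn | hn
      · rw [(h' n).1 hn, (coeff_parity _ n).1 hn]
        ring
      · rw [(h' n).2 hn, ((coeff_parity _ n).2 hn).1, ((coeff_parity _ n).2 hn).2]
        ring
    · rw [h 0]
      simp [coeff]
    · rw [h n, (coeff_parity _ n).1 hn]
      ring
    · rw [h n, ((coeff_parity _ n).2 hn).1, ((coeff_parity _ n).2 hn).2]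
      ring
  have hu₃ : ∀ l, u l ^ 2 + C.a₃ * u l = l ^ 3 + C.a₄ * l := by rwa [hC]
  refine ⟨fun φ hφ => ?_, C.rank_eq hCv _ hS, ?_, ?_⟩
  · obtain ⟨hφ, h⟩ := (hS φ).1 hφ
    rw [← hCt]
    exact (hS _).2 ⟨C.heckeOp_mem hCv hφ, PointlessCurve.CuspRelation.heckeOp C hCv hφ h⟩
  · rintro E _ _ ⟨κ, hκ, -⟩ b
    let _ : Algebra k E := ((algebraMap W.FunctionField E).comp
      (algebraMap k W.FunctionField)).toAlgebra
    obtain ⟨θ, hθ⟩ := exists_quadratic_root (k := k) κ hκ C.a₃ C.a₆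
    exact ⟨fun f hf => (hS _).2 ⟨C.toTree_mem hCv hf.1, C.cuspRelation_toTree hCv b hθ hu hu₃ hf⟩,
      C.rank_toroidalFor_le hCv b hθ hu hu₃ _ hS⟩
  -- One extension suffices for finiteness: the intersection over all separable quadratic extensions
  -- lies in the space belonging to an explicit constant extension.
  · obtain ⟨E, _, _, θ, hsep, ⟨b⟩, hθ⟩ := C.exists_quadratic_extension hCv
    have hle : toroidalForms W.FunctionField ≤ toroidalFor b := by
      intro f hf
      have h := (Submodule.mem_inf.1 hf).2
      simp only [Submodule.mem_iInf] at h
      exact h E _ _ hsep b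
    have hrank := C.rank_toroidalFor_le hCv b hθ hu hu₃ _ hS
    have : Module.Finite ℂ (toroidalFor b) :=
      Module.rank_lt_aleph0_iff.1 (hrank.trans_lt Cardinal.natCast_lt_aleph0)
    exact Submodule.finiteDimensional_of_le hle
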